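/- Let $p$ be a prime. For an abelian group $G$ let $P_G$ be the poset of proper nontrivial subgroups of $G$, and let $\widetilde C_\bullet(P_G)$ be the reduced simplicial chain complex of its order complex: $\widetilde C_q(P_G)$ is the free abelian group on chains $G_1\subsetneq\cdots\subsetneq G_{q+1}$ in $P_G$ for $q\ge 0$, $\widetilde C_{-1}(P_G)=\mathbb Z$, and $\widetilde C_q(P_G)=0$ for $q<-1$. For a module $M$ over a commutative ring $R$ (for instance an abelian group, with $R=\mathbb Z$), let $D_G^\bullet(M)$ be the following cochain complex of $R$-modules: if $G=0$, then $D^0_G(M)=M$ and $D^q_G(M)=0$ for $q\ne 0$; if $G\neq 0$, then $D_G^q(M)=\operatorname{Hom}(\widetilde C_{q-2}(P_G),M)$, with coboundary induced by the boundary map of $\widetilde C_{\bullet-2}(P_G)$. (I) Let $G$ be a finite abelian $p$-group. 1. If $pG\ne 0$, then $H_q(\widetilde C_\bullet(P_G))=0$ for all $q$, and $H^q(D_G^\bullet(M))=0$ for all $q$ and all $M$. 2. If $pG=0$, then $G\cong(\mathbb Z/p)^r$ for some $r\ge 0$. For this $r$: if $G\ne0$, then $H_q(\widetilde C_\bullet(P_G))=0$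 for $q\neq r-2$, and $H_{r-2}(\widetilde C_\bullet(P_G))$ is a free abelian group. For every $M$ one has $H^q(D_G^\bullet(M))=0$ for $q\ne r$; and if $M$ is a free $R$-module, then $H^r(D_G^\bullet(M))$ is a free $R$-module. (II) For an elliptic curve $E$ over an affine scheme $S=\operatorname{Spec}A$ and $N_1,\dots,N_q\ge 1$, let $\mathscr S_{N_1,\dots,N_q}(E/S)$ be the function ring of the moduli problem which assigns to an $A$-algebra $B$ the set of chains $G_1\subseteq\cdots\subseteq G_q$ of finite locally free subgroup schemes of $E_B$, with $G_i$ of rank $N_1\cdots N_i$. Let $\mathscr K_N^\bullet(E/S)$ be the modular $N$-isogeny complex $$\mathscr K_N^q(E/S)=\prod_{N_1\cdots N_q=N,\ N_i>1}\mathscr S_{N_1,\dots,N_q}(E/S),\qquad (\delta f)_{N_1,\dots,N_{q}}=\sum_{i=1}^{q-1}(-1)^i u_i\bigl(f_{N_1,\dots,N_iN_{i+1},\dots,N_q}\bigr),$$ where $u_i$ is induced by forgetting $G_i$. Let $k$ be an algebraically closed field in which $p$ is invertible, let $E$ be an elliptic curve over $S=\operatorname{Spec}k$, and let $r\ge 0$.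 Then there is an isomorphism of cochain complexes of $k$-modules $$\mathscr K^\bullet_{p^r}(E/S)\;\cong\;\prod_{G}D_G^\bullet(k),$$ where $G$ runs over the subgroups of order $p^r$ of $E(k)$ (equivalently, of $E[p^\infty](k)$). Moreover $H^j(\mathscr K_{p^r}^\bullet(E/S))=0$ for $j\ne r$, and $H^r(\mathscr K_{p^r}^\bullet(E/S))$ is a finitely generated projective $k$-module. -/

import Mathlib

open CategoryTheory AlgebraicGeometry MonObj

universe u v w

noncomputable section

namespace IsogenyComplex

/-! ## The reduced chain complex of the order complex of a poset -/

section OrderComplex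

variable (P : Type u) [PartialOrder P]

/-- The `q`-simplices of the order complex of `P`: the finite chains in `P` with `q + 1` elements.
For `q = -1` this is the empty chain, which spans the augmentation term; for `q < -1` there
are none. -/
def Simplices (q : ℤ) : Type u :=
  {s : Finset P // IsChain (· ≤ ·) (s : Set P) ∧ (s.card : ℤ) = q + 1}

variable {P}

open Classical in
/-- The face of the simplex `s` opposite to the vertex `x`. -/
def Simplices.face {q : ℤ} (s : Simplices P (q + 1)) (x : P) (hx : x ∈ s.1) : Simplices P q :=
  ⟨s.1.erase x, s.2.1.mono (by simp), by
    have h := Finset.card_erase_add_one hx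
    have h' := s.2.2
    omega⟩

open Classical in
/-- The position of `x` in the chain `s`, i.e. the number of vertices strictly below `x`. -/
def position (s : Finset P) (x : P) : ℕ := (s.filter (· < x)).card

variable (P)

/-- The boundary map: on a chain `x₀ < ⋯ < x_{q+1}` it is the sum over `i` of `(-1)^i` times the
chain with `xᵢ` removed. For `q = -1` it is the augmentation. -/
def boundary (q : ℤ) : (Simplices P (q + 1) →₀ ℤ) →ₗ[ℤ] (Simplices P q →₀ ℤ) :=
  Finsupp.lift _ ℤ _ fun s =>
    ∑ x : {x // x ∈ s.1}, (-1 : ℤ) ^ position s.1 x.1 • Finsupp.single (s.face x.1 x.2) 1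

lemma boundary_single {q : ℤ} (s : Simplices P (q + 1)) :
    boundary P q (Finsupp.single s 1) =
      ∑ x : {x // x ∈ s.1}, (-1 : ℤ) ^ position s.1 x.1 • Finsupp.single (s.face x.1 x.2) 1 := by
  simp [boundary]

lemma position_erase_of_lt [DecidableEq P] {s : Finset P} {x y : P} (hx : x ∈ s) (h : x < y) :
    position (s.erase x) y + 1 = position s y := by
  classical
  unfold position
  rw [Finset.filter_erase]
  convert Finset.card_erase_add_one (s := s.filter (· < y)) (a := x) (by simp [hx, h])

lemma position_erase_of_not_lt [DecidableEq P] {s : Finset P} {x y : P} (h : ¬ x < y) :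
    position (s.erase x) y = position s y := by
  classical
  unfold position
  rw [Finset.filter_erase]
  convert congrArg Finset.card (Finset.erase_eq_of_notMem (s := s.filter (· < y)) (a := x)
    (by simp [h]))

lemma boundary_boundary (q : ℤ) : boundary P q ∘ₗ boundary P (q + 1) = 0 := by
  classical
  refine Finsupp.lhom_ext' fun s => LinearMap.ext_ring ?_
  simp only [LinearMap.comp_apply, Finsupp.lsingle_apply, LinearMap.zero_apply]
  rw [boundary_single, map_sum]
  simp only [map_smul, boundary_single, Finset.smul_sum, smul_smul]
  rw [Finset.sum_sigma']
  have mem : ∀ a : (Σ x : {x // x ∈ s.1}, {y // y ∈ (s.face x.1 x.2).1}),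
      a.2.1 ∈ s.1 ∧ a.2.1 ≠ a.1.1 := fun a => by
    have := a.2.2
    simp only [Simplices.face, Finset.mem_erase] at this
    exact ⟨this.2, this.1⟩
  refine Finset.sum_involution
    (fun a _ => ⟨⟨a.2.1, (mem a).1⟩, ⟨a.1.1, by
      simp only [Simplices.face, Finset.mem_erase]
      exact ⟨(mem a).2.symm, a.1.2⟩⟩⟩) ?_ ?_ ?_ ?_
  · intro a _
    obtain ⟨⟨x, hx⟩, ⟨y, hy⟩⟩ := a
    have hy' : y ≠ x ∧ y ∈ s.1 := by simpa [Simplices.face] using hy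
    have hface : (s.face x hx).face y hy =
        (s.face y hy'.2).face x (by simp [Simplices.face, hx, hy'.1.symm]) := by
      apply Subtype.ext
      simp only [Simplices.face]
      exact Finset.erase_right_comm
    have hs : (-1 : ℤ) ^ position s.1 x * (-1) ^ position (s.face x hx).1 y
        = - ((-1 : ℤ) ^ position s.1 y * (-1) ^ position (s.face y hy'.2).1 x) := by
      have e1 : (s.face x hx).1 = s.1.erase x := rfl
      have e2 : (s.face y hy'.2).1 = s.1.erase y := rfl
      rw [e1, e2]
      rcases s.2.1.total hx hy'.2 with h | h
      · have hlt : x < y := lt_of_le_of_ne h hy'.1.symm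
        rw [position_erase_of_not_lt P (x := y) (y := x) hlt.not_gt,
          ← position_erase_of_lt P hx hlt]
        ring
      · have hlt : y < x := lt_of_le_of_ne h hy'.1
        rw [position_erase_of_not_lt P (x := x) (y := y) hlt.not_gt,
          ← position_erase_of_lt P hy'.2 hlt]
        ring
    simp only
    rw [hface, hs, neg_smul]
    exact neg_add_cancel _
  · intro a _ _ h
    exact (mem a).2 (congrArg (fun b => b.1.1) h)
  · intro a _
    simp
  · intro a _
    rfl

/-- The reduced simplicial chain complex of the order complex of `P`, with `ℤ` in degree `-1`. -/
def reducedChains : ChainComplex (ModuleCat.{u} ℤ) ℤ :=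
  ChainComplex.of (fun q => ModuleCat.of ℤ (Simplices P q →₀ ℤ))
    (fun q => ModuleCat.ofHom (boundary P q))
    (fun q => by
      rw [← ModuleCat.ofHom_comp, boundary_boundary]
      rfl)

end OrderComplex

/-! ## The cochain complex attached to a finite abelian group -/

section GroupComplex

/-- The poset of proper nontrivial subgroups of `G`. -/
abbrev ProperSubgroups (G : Type u) [AddCommGroup G] : Type u :=
  {H : AddSubgroup G // H ≠ ⊥ ∧ H ≠ ⊤}

variable (R : Type w) [CommRing R] (G : Type u) [AddCommGroup G]
  (M : Type v) [AddCommGroup M] [Module R M]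

/-- The complex `Hom(C̃_{q-2}, M)`, where `C̃` is the reduced chain complex of the order complex of
the poset of proper nontrivial subgroups of `G`. -/
def homComplex : CochainComplex (ModuleCat.{max u v} R) ℕ :=
  CochainComplex.of
    (fun q => ModuleCat.of R ((reducedChains (ProperSubgroups G)).X ((q : ℤ) - 2) →ₗ[ℤ] M))
    (fun q => ModuleCat.ofHom
      { toFun := fun f => f ∘ₗ
          ((reducedChains (ProperSubgroups G)).d (((q + 1 : ℕ) : ℤ) - 2) ((q : ℤ) - 2)).hom
        map_add' := fun _ _ => rfl
        map_smul' := fun _ _ => rfl })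
    (fun q => by
      ext f : 2
      refine LinearMap.ext fun x => ?_
      have h := (reducedChains (ProperSubgroups G)).d_comp_d
        (((q + 1 + 1 : ℕ) : ℤ) - 2) (((q + 1 : ℕ) : ℤ) - 2) ((q : ℤ) - 2)
      have hx := congrArg (fun g => f (g.hom x)) h
      exact hx.trans (map_zero f))

open Classical in
/-- The complex `D_G(M)`: it is `M` in degree `0` if `G = 0`, and `Hom(C̃_{q-2}, M)` in degree `q`
otherwise. If `M` is an `R`-module, it is a complex of `R`-modules; for `R = ℤ` it is the
complex of abelian groups. -/
def complexD : CochainComplex (ModuleCat.{max u v} R) ℕ :=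
  if Subsingleton G then
    (CochainComplex.single₀ (ModuleCat.{max u v} R)).obj (ModuleCat.of R (ULift.{u} M))
  else homComplex R G M

end GroupComplex

/-! ## Elliptic curves and their finite subgroup schemes -/

/-- An elliptic curve over `Spec A`: a commutative group scheme, proper and smooth of relative
dimension one, with geometrically connected fibres. -/
structure EllipticCurve (A : Type u) [CommRing A] where
  /-- The underlying scheme over `Spec A`. -/
  scheme : Over (Spec (CommRingCat.of A))
  [grpObj : GrpObj scheme]
  [isCommMonObj : IsCommMonObj scheme]
  [isProper : IsProper scheme.hom]
  [smooth : SmoothOfRelativeDimension 1 scheme.hom]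
  [geometricallyConnected : GeometricallyConnected scheme.hom]

attribute [instance] EllipticCurve.grpObj EllipticCurve.isCommMonObj EllipticCurve.isProper
  EllipticCurve.smooth EllipticCurve.geometricallyConnected

section Moduli

variable {A : Type u} [CommRing A] (E : EllipticCurve A)

/-- The spectrum of an `A`-algebra as a scheme over `Spec A`. -/
abbrev specOver (A : Type u) [CommRing A] (C : Type u) [CommRing C] [Algebra A C] :
    Over (Spec (CommRingCat.of A)) :=
  Over.mk (Spec.map (CommRingCat.ofHom (algebraMap A C)))

/-- The morphism of spectra over `Spec A` induced by a homomorphism of `A`-algebras. -/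
def specMap {C C' : Type u} [CommRing C] [Algebra A C] [CommRing C'] [Algebra A C']
    (ψ : C →ₐ[A] C') : specOver A C' ⟶ specOver A C :=
  Over.homMk (Spec.map (CommRingCat.ofHom ψ.toRingHom)) (by
    change Spec.map _ ≫ Spec.map _ = Spec.map _
    rw [← Spec.map_comp, ← CommRingCat.ofHom_comp]
    congr 2
    exact ψ.comp_algebraMap)

/-- The group `E(C)` of points of `E` with values in an `A`-algebra `C`, written additively. -/
abbrev EllipticCurve.Points (C : Type u) [CommRing C] [Algebra A C] : Type u :=
  Additive (specOver A C ⟶ E.scheme)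

/-- The map `E(C) → E(C')` induced by a homomorphism `C → C'` of `A`-algebras. -/
def EllipticCurve.mapPoints {C C' : Type u} [CommRing C] [Algebra A C] [CommRing C'] [Algebra A C']
    (ψ : C →ₐ[A] C') (x : E.Points C) : E.Points C' :=
  Additive.ofMul (specMap ψ ≫ x.toMul)

/-- A subgroup functor of the base change `E_B`: it assigns to every `B`-algebra, given as a
homomorphism `φ : B → C` of `A`-algebras, a subgroup of `E_B(C) = E(C)`, functorially. -/
@[ext]
structure SubgroupFunctor (B : Type u) [CommRing B] [Algebra A B] where
  /-- The subgroup of `E(C)`. -/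
  points : ∀ {C : Type u} [CommRing C] [Algebra A C], (B →ₐ[A] C) → AddSubgroup (E.Points C)
  mapPoints_mem : ∀ {C C' : Type u} [CommRing C] [Algebra A C] [CommRing C'] [Algebra A C']
    (φ : B →ₐ[A] C) (ψ : C →ₐ[A] C') (x : E.Points C),
    x ∈ points φ → E.mapPoints ψ x ∈ points (ψ.comp φ)

variable {E}

/-- The subgroup functor `G` of `E_B` is a finite locally free subgroup scheme of rank `N`: it is
represented by `Spec H` for a `B`-algebra `H` that is finite and locally free (finitely generated
projective) of constant rank `N` as a `B`-module. Here `x` is the universal point. (The inclusion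
`Spec H → E_B` is then a proper monomorphism, hence a closed immersion.) -/
def SubgroupFunctor.IsFiniteLocallyFree {B : Type u} [CommRing B] [Algebra A B]
    (G : SubgroupFunctor E B) (N : ℕ) : Prop :=
  ∃ (H : Type u) (_ : CommRing H) (_ : Algebra A H) (_ : Algebra B H) (_ : IsScalarTower A B H),
    Module.Finite B H ∧ Module.Projective B H ∧
    (∀ 𝔭 : PrimeSpectrum B, Module.rankAtStalk (R := B) H 𝔭 = N) ∧
    ∃ x ∈ G.points (IsScalarTower.toAlgHom A B H),
      ∀ (C : Type u) [CommRing C] [Algebra A C] (φ : B →ₐ[A] C), ∀ y ∈ G.points φ,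
        ∃! ψ : H →ₐ[A] C, ψ.comp (IsScalarTower.toAlgHom A B H) = φ ∧ E.mapPoints ψ x = y

/-- The relation that `G'` is the base change of `G` along `φ : B → B'`. -/
def SubgroupFunctor.IsBaseChange {B B' : Type u} [CommRing B] [Algebra A B] [CommRing B']
    [Algebra A B'] (φ : B →ₐ[A] B') (G : SubgroupFunctor E B) (G' : SubgroupFunctor E B') : Prop :=
  ∀ (C : Type u) [CommRing C] [Algebra A C] (ψ : B' →ₐ[A] C),
    G'.points ψ = G.points (ψ.comp φ)

variable (E)

/-- The set `[N₁,…,N_q-Isog](E_B/B)` of chains `G₁ ⊆ ⋯ ⊆ G_q` of finite locally free subgroup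
schemes of `E_B` such that `G_i` has rank `N₁⋯N_i`. -/
@[ext]
structure SubgroupChain (B : Type u) [CommRing B] [Algebra A B] {q : ℕ} (N : Fin q → ℕ) where
  /-- The subgroup schemes of the chain. -/
  group : Fin q → SubgroupFunctor E B
  isFiniteLocallyFree : ∀ i, (group i).IsFiniteLocallyFree (Fin.partialProd N i.succ)
  mono : ∀ i j, i ≤ j → ∀ (C : Type u) [CommRing C] [Algebra A C] (φ : B →ₐ[A] C),
    (group i).points φ ≤ (group j).points φ

variable {E} in
/-- Forgetting one group, but not the last one: for `i < q`, removing `G_i` from a chain of type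
`(N₁,…,N_{q+1})` gives a chain of type `(N₁,…,N_iN_{i+1},…,N_{q+1})`. -/
def SubgroupChain.forget {B : Type u} [CommRing B] [Algebra A B] {q : ℕ} {N : Fin (q + 1) → ℕ}
    (G : SubgroupChain E B N) (i : Fin q) :
    SubgroupChain E B (i.castSucc.contractNth (· * ·) N) where
  group j := G.group (i.castSucc.succAbove j)
  isFiniteLocallyFree j := by
    have h := G.isFiniteLocallyFree (i.castSucc.succAbove j)
    rw [Fin.partialProd_contractNth, Function.comp_apply, Fin.succ_succAbove_succ]
    exact h
  mono j l hjl := G.mono _ _ ((Fin.strictMono_succAbove _).monotone hjl)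

/-- The function ring `S_{N₁,…,N_q}(E/A)` of the moduli problem `[N₁,…,N_q-Isog]` of `E` over
`Spec A`: the ring of all natural transformations from it to the affine line, as functors on
`A`-algebras. (By the Yoneda lemma this is the ring of global functions of any scheme over `Spec A`
that represents the moduli problem.) -/
def functionRing {q : ℕ} (N : Fin q → ℕ) :
    Subalgebra A (∀ B : CommAlgCat.{u} A, SubgroupChain E B N → B) where
  carrier := {f | ∀ (B B' : CommAlgCat.{u} A) (φ : B →ₐ[A] B') (G : SubgroupChain E B N)
    (G' : SubgroupChain E B' N), (∀ i, (G.group i).IsBaseChange φ (G'.group i)) →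
      f B' G' = φ (f B G)}
  mul_mem' hf hg B B' φ G G' h := by
    simp only [Pi.mul_apply, map_mul, hf B B' φ G G' h, hg B B' φ G G' h]
  add_mem' hf hg B B' φ G G' h := by
    simp only [Pi.add_apply, map_add, hf B B' φ G G' h, hg B B' φ G G' h]
  algebraMap_mem' a B B' φ G G' h := by
    simp only [Pi.algebraMap_apply, AlgHom.commutes]

/-- The map `u_i` of function rings induced by forgetting the group `G_i`. -/
def forgetMap {q : ℕ} (N : Fin (q + 1) → ℕ) (i : Fin q) :
    functionRing E (i.castSucc.contractNth (· * ·) N) →ₐ[A] functionRing E N where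
  toFun f := ⟨fun B G => f.1 B (G.forget i), fun B B' φ G G' h =>
    f.2 B B' φ (G.forget i) (G'.forget i) fun _ => h _⟩
  map_one' := rfl
  map_mul' _ _ := rfl
  map_zero' := rfl
  map_add' _ _ := rfl
  commutes' _ := rfl

/-- Tuples `(N₁,…,N_q)` of integers `N_i > 1` with product `N`. -/
abbrev Factorizations (q N : ℕ) : Type := {n : Fin q → ℕ // (∀ i, 1 < n i) ∧ ∏ i, n i = N}

/-- `(N₁,…,N_{q+1}) ↦ (N₁,…,N_iN_{i+1},…,N_{q+1})`. -/
def Factorizations.merge {q N : ℕ} (n : Factorizations (q + 1) N) (i : Fin q) :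
    Factorizations q N :=
  ⟨i.castSucc.contractNth (· * ·) n.1, by
    intro j
    unfold Fin.contractNth
    split_ifs
    · exact n.2.1 _
    · exact one_lt_mul'' (n.2.1 _) (n.2.1 _)
    · exact n.2.1 _, by
    have h := congrFun (Fin.partialProd_contractNth n.1 i.castSucc) (Fin.last q)
    have h2 : i.castSucc.succ.succAbove (Fin.last q) = Fin.last (q + 1) := by
      rw [Fin.succAbove_of_le_castSucc]
      · rfl
      · rw [Fin.le_def]; simp
    rw [Function.comp_apply, h2] at h
    simp only [Fin.partialProd, Fin.val_last, List.take_of_length_le, List.length_ofFn, le_refl,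
      List.prod_ofFn] at h
    rw [h, n.2.2]⟩

/-- The `A`-module in degree `q` of the modular `N`-isogeny complex: the product of the rings
`S_{N₁,…,N_q}(E/A)` over all `(N₁,…,N_q)` with `N₁⋯N_q = N` and all `N_i > 1`. -/
abbrev IsogenyCochains (N q : ℕ) : Type (u + 1) :=
  ∀ n : Factorizations q N, functionRing E n.1

/-- The coboundary: the component of `δ f` at `(N₁,…,N_{q+1})` is the sum over `1 ≤ i ≤ q` of
`(-1)^i u_i (f_{N₁,…,N_iN_{i+1},…,N_{q+1}})`. The index `i : Fin q` below starts at `0`. -/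
def coboundary (N q : ℕ) : IsogenyCochains E N q →ₗ[A] IsogenyCochains E N (q + 1) :=
  LinearMap.pi fun n => ∑ i : Fin q,
    (-1 : A) ^ ((i : ℕ) + 1) • (forgetMap E n.1 i).toLinearMap ∘ₗ LinearMap.proj (n.merge i)

lemma coboundary_apply (N q : ℕ) (f : IsogenyCochains E N q) (n : Factorizations (q + 1) N)
    (B : CommAlgCat.{u} A) (G : SubgroupChain E B n.1) :
    (coboundary E N q f n).1 B G =
      ∑ i : Fin q, (-1 : A) ^ ((i : ℕ) + 1) • (f (n.merge i)).1 B (G.forget i) := by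
  simp only [coboundary, LinearMap.pi_apply, LinearMap.sum_apply, LinearMap.smul_apply]
  rw [AddSubmonoidClass.coe_finsetSum, Finset.sum_apply, Finset.sum_apply]
  rfl

lemma cochain_congr {N q : ℕ} (f : IsogenyCochains E N q) {n n' : Factorizations q N} (h : n = n')
    {B : CommAlgCat.{u} A} (G : SubgroupChain E B n.1) (G' : SubgroupChain E B n'.1)
    (hG : G.group = G'.group) : (f n).1 B G = (f n').1 B G' := by
  subst h
  rw [SubgroupChain.ext hG]

lemma eq_of_partialProd_eq {q : ℕ} {n n' : Fin q → ℕ} (hn : ∀ i, 1 < n i)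
    (h : Fin.partialProd n = Fin.partialProd n') : n = n' := by
  have pos : ∀ i, 0 < Fin.partialProd n i := fun i => by
    induction i using Fin.induction with
    | zero => simp
    | succ i ih =>
      rw [Fin.partialProd_succ]
      exact Nat.mul_pos ih (lt_trans one_pos (hn i))
  funext i
  have h1 := congrFun h i.succ
  rw [Fin.partialProd_succ, Fin.partialProd_succ, ← h] at h1
  exact Nat.eq_of_mul_eq_mul_left (pos _) h1

lemma merge_merge {q N : ℕ} (n : Factorizations (q + 2) N) (i : Fin (q + 1)) (j : Fin q) :
    (n.merge i).merge j = (n.merge (i.succAbove j)).merge (j.predAbove i) := by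
  apply Subtype.ext
  refine eq_of_partialProd_eq ((n.merge i).merge j).2.1 ?_
  simp only [Factorizations.merge, Fin.partialProd_contractNth]
  funext l
  simp only [Function.comp_apply]
  rw [← Fin.castSucc_succAbove_castSucc, ← Fin.castSucc_predAbove_castSucc,
    ← Fin.succ_succAbove_succ, ← Fin.succ_predAbove_succ,
    Fin.succAbove_succAbove_succAbove_predAbove]

lemma coboundary_coboundary (N q : ℕ) : coboundary E N (q + 1) ∘ₗ coboundary E N q = 0 := by
  refine LinearMap.ext fun f => funext fun n => Subtype.ext (funext fun B => funext fun G => ?_)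
  rw [LinearMap.comp_apply, coboundary_apply]
  refine (Finset.sum_congr rfl fun (i : Fin (q + 1)) _ => congrArg (fun b => (-1 : A) ^ ((i : ℕ) + 1) • b)
    (coboundary_apply E N q f (n.merge i) B (G.forget i))).trans ?_
  simp only [Finset.smul_sum, smul_smul]
  refine (Fintype.sum_prod_type' (f := fun (i : Fin (q + 1)) (j : Fin q) =>
    ((-1 : A) ^ ((i : ℕ) + 1) * (-1) ^ ((j : ℕ) + 1)) •
      (f ((n.merge i).merge j)).1 B ((G.forget i).forget j))).symm.trans ?_
  refine Finset.sum_involution (fun a _ => (a.1.succAbove a.2, a.2.predAbove a.1)) ?_ ?_ ?_ ?_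
  · rintro ⟨i, j⟩ -
    have hv : (f ((n.merge i).merge j)).1 B ((G.forget i).forget j) =
        (f ((n.merge (i.succAbove j)).merge (j.predAbove i))).1 B
          ((G.forget (i.succAbove j)).forget (j.predAbove i)) := by
      refine cochain_congr E f (merge_merge n i j) _ _ (funext fun l => ?_)
      simp only [SubgroupChain.forget]
      rw [← Fin.castSucc_succAbove_castSucc, ← Fin.castSucc_predAbove_castSucc,
        Fin.succAbove_succAbove_succAbove_predAbove]
    have hs : (-1 : A) ^ ((i.succAbove j : ℕ) + 1) * (-1) ^ ((j.predAbove i : ℕ) + 1) =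
        -((-1 : A) ^ ((i : ℕ) + 1) * (-1) ^ ((j : ℕ) + 1)) := by
      have h := Fin.neg_one_pow_succAbove_add_predAbove (R := A) i j
      simp only [pow_succ, pow_add] at h ⊢
      linear_combination h
    simp only
    rw [hv, hs, neg_smul]
    exact add_neg_cancel _
  · rintro ⟨i, j⟩ - - h
    exact Fin.succAbove_ne i j (congrArg Prod.fst h)
  · intro a _
    simp
  · rintro ⟨i, j⟩ -
    exact Prod.ext (Fin.succAbove_succAbove_predAbove i j) (Fin.predAbove_predAbove_succAbove i j)

/-- The modular `N`-isogeny complex `K_N(E/A)`. -/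
def isogenyComplex (N : ℕ) : CochainComplex (ModuleCat.{u + 1} A) ℕ :=
  CochainComplex.of (fun q => ModuleCat.of A (IsogenyCochains E N q))
    (fun q => ModuleCat.ofHom (coboundary E N q))
    (fun q => by
      rw [← ModuleCat.ofHom_comp, coboundary_coboundary]
      rfl)

end Moduli

end IsogenyComplex

end

/-!
Fix a nonzero proper subgroup `a` of `G`. Since `H ≤ H + a ≥ a`, the proper subgroups `H ≠ 0` with
`H + a ≠ G` span a contractible subcomplex of the order complex. If `pG ≠ 0`, take `a = pG`: it is
contained in the Frattini subgroup, so the subcomplex is everything. If `pG = 0`, take `a` of order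
`p`: the remaining subgroups are the complements of `a`, their links are the order complexes of
groups of rank one less, and attaching the cones over these links creates homology in the top degree
only. The groups of chains being free and finitely generated, applying `Hom(-, M)` preserves
exactness below the top degree, where one finds `Hom(Z, M)` for the free group `Z` of cycles.

If `N` is invertible in `k`, then `E[N]` is finite étale, hence a disjoint union of copies of the
base over a separably closed field: there is a universal `N`-torsion point with values in a power
`k^J`. A subgroup scheme of rank dividing `N` is killed by `N` (Deligne), so it lies in `E[N]` and
is locally constant on the base. Therefore the moduli problem of chains of subgroups is represented
by a product of copies of `k` indexed by the chains of subgroups of `E(k)`, and sorting the chains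
by their last group splits the isogeny complex into the complexes `D_G(k)`.
-/

noncomputable section

namespace IsogenyComplex

/-! ## Points of an elliptic curve -/

section Points

variable {k : Type u} [CommRing k] (E : EllipticCurve k)
variable {C C' C'' : Type u} [CommRing C] [Algebra k C] [CommRing C'] [Algebra k C']
  [CommRing C''] [Algebra k C'']

lemma specMap_id : specMap (AlgHom.id k C) = 𝟙 (specOver k C) := by
  ext1
  simp [specMap]

lemma specMap_comp (ψ : C →ₐ[k] C') (ψ' : C' →ₐ[k] C'') :
    specMap (ψ'.comp ψ) = specMap ψ' ≫ specMap ψ := by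
  ext1
  simp only [specMap, Over.homMk_left, Over.comp_left, ← Spec.map_comp, ← CommRingCat.ofHom_comp]
  rfl

lemma specMap_injective : Function.Injective (specMap (A := k) (C := C) (C' := C')) :=
  fun ψ ψ' h => by
    have hSpec : Spec.map _ = Spec.map _ := congrArg (fun f => f.left) h
    rw [Spec.map_inj] at hSpec
    exact AlgHom.ext fun c => congrArg (fun f => f.hom c) hSpec

lemma specMap_surjective : Function.Surjective (specMap (A := k) (C := C) (C' := C')) :=
  fun g => by
    obtain ⟨φ, hφ⟩ := Spec.map_surjective g.left
    have h := Over.w g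
    rw [← hφ] at h
    change Spec.map φ ≫ Spec.map _ = Spec.map _ at h
    rw [← Spec.map_comp, Spec.map_inj] at h
    refine ⟨⟨φ.hom, fun c => congrArg (fun f => f.hom c) h⟩, ?_⟩
    ext1
    exact hφ

namespace EllipticCurve

lemma mapPoints_id (x : E.Points C) : E.mapPoints (AlgHom.id k C) x = x := by
  rw [mapPoints, specMap_id, Category.id_comp, ofMul_toMul]

lemma mapPoints_comp (ψ : C →ₐ[k] C') (ψ' : C' →ₐ[k] C'') (x : E.Points C) :
    E.mapPoints (ψ'.comp ψ) x = E.mapPoints ψ' (E.mapPoints ψ x) := by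
  simp only [mapPoints, specMap_comp, Category.assoc, toMul_ofMul]

lemma mapPoints_add (ψ : C →ₐ[k] C') (x y : E.Points C) :
    E.mapPoints ψ (x + y) = E.mapPoints ψ x + E.mapPoints ψ y := by
  simp only [mapPoints, toMul_add, MonObj.comp_mul, ofMul_mul]

/-- `EllipticCurve.mapPoints` as a homomorphism of groups. -/
def mapPointsHom (ψ : C →ₐ[k] C') : E.Points C →+ E.Points C' :=
  AddMonoidHom.mk' (E.mapPoints ψ) (E.mapPoints_add ψ)

lemma mapPoints_zero (ψ : C →ₐ[k] C') : E.mapPoints ψ (0 : E.Points C) = 0 :=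
  map_zero (E.mapPointsHom ψ)

lemma mapPoints_sub (ψ : C →ₐ[k] C') (x y : E.Points C) :
    E.mapPoints ψ (x - y) = E.mapPoints ψ x - E.mapPoints ψ y :=
  map_sub (E.mapPointsHom ψ) x y

lemma mapPoints_nsmul (ψ : C →ₐ[k] C') (n : ℕ) (x : E.Points C) :
    E.mapPoints ψ (n • x) = n • E.mapPoints ψ x :=
  map_nsmul (E.mapPointsHom ψ) n x

lemma points_ext {J : Type*} {D : J → Type u} [∀ i, CommRing (D i)] [∀ i, Algebra k (D i)]
    (ψ : ∀ i, C →ₐ[k] D i) (hψ : ∀ c : C, (∀ i, ψ i c = 0) → c = 0) {x y : E.Points C}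
    (h : ∀ i, E.mapPoints (ψ i) x = E.mapPoints (ψ i) y) : x = y := by
  have : IsSeparated E.scheme.hom := inferInstance
  let incl := Limits.equalizer.ι x.toMul y.toMul
  -- As `E` is separated, the equalizer of `x` and `y` is cut out in `Spec C` by an ideal `I`, and
  -- each `ψ i` factors through `C ⧸ I`.
  obtain ⟨I, e, he⟩ := IsClosedImmersion.Spec_iff.1 (inferInstance : IsClosedImmersion incl.left)
  have mem_ker (i : J) (c : C) (hc : c ∈ I) : ψ i c = 0 := by
    have hi : specMap (ψ i) ≫ x.toMul = specMap (ψ i) ≫ y.toMul := h i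
    have hlift : (Limits.equalizer.lift _ hi ≫ incl).left =
        Spec.map (CommRingCat.ofHom (ψ i).toRingHom) := by
      rw [Limits.equalizer.lift_ι]
      rfl
    obtain ⟨g, hg⟩ := Spec.map_surjective ((Limits.equalizer.lift _ hi).left ≫ e.hom)
    rw [Over.comp_left, he, ← Category.assoc, ← hg, ← Spec.map_comp, Spec.map_inj] at hlift
    have hg' := congrArg (fun f => f.hom c) hlift
    simp only [CommRingCat.hom_comp, CommRingCat.hom_ofHom, RingHom.comp_apply] at hg'
    rw [Ideal.Quotient.eq_zero_iff_mem.2 hc, map_zero] at hg'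
    exact hg'.symm
  have hI : I = ⊥ := (Submodule.eq_bot_iff I).2 fun c hc => hψ c fun i => mem_ker i c hc
  have : IsIso (CommRingCat.ofHom (Ideal.Quotient.mk I)) := by
    rw [ConcreteCategory.isIso_iff_bijective]
    refine ⟨?_, Ideal.Quotient.mk_surjective⟩
    subst hI
    exact (RingHom.injective_iff_ker_eq_bot _).2 Ideal.mk_ker
  have : IsIso incl.left := he ▸ inferInstance
  have : IsIso incl := (isIso_iff_of_reflects_iso incl (Over.forget _)).1 this
  exact congrArg Additive.ofMul ((cancel_epi incl).1 (Limits.equalizer.condition _ _))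

lemma mapPoints_injective {ψ : C →ₐ[k] C'} (hψ : Function.Injective ψ) :
    Function.Injective (E.mapPoints ψ) := fun _ _ h =>
  E.points_ext (fun _ : Unit => ψ) (fun c hc => hψ (by rw [hc (), map_zero])) fun _ => h

end EllipticCurve

end Points

/-! ## Unramifiedness of the torsion -/

section Infinitesimal

open TrivSqZeroExt

variable {k : Type u} [CommRing k] {R : Type u} [CommRing R] [Algebra k R]
  {M : Type u} [AddCommGroup M] [Module R M] [Module k M] [IsScalarTower k R M] [Module Rᵐᵒᵖ M]
  [IsCentralScalar R M]
  {M' : Type u} [AddCommGroup M'] [Module R M'] [Module k M'] [IsScalarTower k R M']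
  [Module Rᵐᵒᵖ M'] [IsCentralScalar R M']

variable (k) in
/-- The homomorphism of `k`-algebras `R[M] → R[M']` induced by an `R`-linear map `M → M'`, where
`R[M]` is the trivial square-zero extension of the `k`-algebra `R` by `M`. -/
def sqZeroMap (f : M →ₗ[R] M') : TrivSqZeroExt R M →ₐ[k] TrivSqZeroExt R M' where
  __ := TrivSqZeroExt.map f
  commutes' c := by simp [TrivSqZeroExt.algebraMap_eq_inl']

lemma sqZeroMap_apply (f : M →ₗ[R] M') (x : TrivSqZeroExt R M) :
    sqZeroMap k f x = inl x.fst + inr (f x.snd) := by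
  ext <;> simp [sqZeroMap]

lemma sqZeroMap_id : sqZeroMap k (LinearMap.id : M →ₗ[R] M) = AlgHom.id k _ := by
  ext <;> simp [sqZeroMap_apply]

lemma sqZeroMap_comp {M'' : Type u} [AddCommGroup M''] [Module R M''] [Module k M'']
    [IsScalarTower k R M''] [Module Rᵐᵒᵖ M''] [IsCentralScalar R M''] (f : M →ₗ[R] M')
    (g : M' →ₗ[R] M'') :
    sqZeroMap k (g ∘ₗ f) = (sqZeroMap k g).comp (sqZeroMap k f) := by
  ext <;> simp [sqZeroMap_apply]

lemma sqZeroMap_zero :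
    sqZeroMap k (0 : M →ₗ[R] M') = (inlAlgHom k R M').comp (fstHom k R M) := by
  ext <;> simp [sqZeroMap_apply]

lemma eq_zero_of_sqZeroMap_fst_of_sqZeroMap_snd {c : TrivSqZeroExt R (M' × M')}
    (h₁ : sqZeroMap k (LinearMap.fst R M' M') c = 0)
    (h₂ : sqZeroMap k (LinearMap.snd R M' M') c = 0) : c = 0 := by
  rw [sqZeroMap_apply] at h₁ h₂
  refine TrivSqZeroExt.ext ?_ (Prod.ext ?_ ?_)
  · simpa using congrArg fst h₁
  · simpa using congrArg snd h₁
  · simpa using congrArg snd h₂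

namespace EllipticCurve

variable (E : EllipticCurve k) {y : E.Points (TrivSqZeroExt R M)}

lemma mapPoints_sqZeroMap_zero (hy : E.mapPoints (fstHom k R M) y = 0) :
    E.mapPoints (sqZeroMap k (0 : M →ₗ[R] M')) y = 0 := by
  rw [sqZeroMap_zero, E.mapPoints_comp, hy, E.mapPoints_zero]

lemma mapPoints_sqZeroMap_prod (hy : E.mapPoints (fstHom k R M) y = 0) (f g : M →ₗ[R] M') :
    E.mapPoints (sqZeroMap k (f.prod g)) y =
      E.mapPoints (sqZeroMap k (LinearMap.inl R M' M' ∘ₗ f)) y +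
        E.mapPoints (sqZeroMap k (LinearMap.inr R M' M' ∘ₗ g)) y := by
  let proj (b : Bool) : M' × M' →ₗ[R] M' :=
    bif b then LinearMap.fst R M' M' else LinearMap.snd R M' M'
  refine E.points_ext (fun b => sqZeroMap k (proj b)) (fun c hc =>
    eq_zero_of_sqZeroMap_fst_of_sqZeroMap_snd (hc true) (hc false)) fun b => ?_
  rw [E.mapPoints_add]
  simp only [← E.mapPoints_comp, ← sqZeroMap_comp, ← LinearMap.comp_assoc]
  cases b
  · simp only [proj, cond_false, LinearMap.snd_comp_inl, LinearMap.snd_comp_inr,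
      LinearMap.zero_comp, LinearMap.id_comp, LinearMap.snd_prod, E.mapPoints_sqZeroMap_zero hy,
      zero_add]
  · simp only [proj, cond_true, LinearMap.fst_comp_inl, LinearMap.fst_comp_inr,
      LinearMap.zero_comp, LinearMap.id_comp, LinearMap.fst_prod, E.mapPoints_sqZeroMap_zero hy,
      add_zero]

lemma mapPoints_sqZeroMap_add (hy : E.mapPoints (fstHom k R M) y = 0) (f g : M →ₗ[R] M') :
    E.mapPoints (sqZeroMap k (f + g)) y =
      E.mapPoints (sqZeroMap k f) y + E.mapPoints (sqZeroMap k g) y := by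
  have h := congrArg (E.mapPoints
    (sqZeroMap k ((LinearMap.id : M' →ₗ[R] M').coprod LinearMap.id)))
    (E.mapPoints_sqZeroMap_prod hy f g)
  simp only [E.mapPoints_add, ← E.mapPoints_comp, ← sqZeroMap_comp, ← LinearMap.comp_assoc,
    LinearMap.coprod_inl, LinearMap.coprod_inr, LinearMap.id_comp, LinearMap.coprod_comp_prod] at h
  exact h

lemma mapPoints_sqZeroMap_nsmul (hy : E.mapPoints (fstHom k R M) y = 0) (n : ℕ) :
    E.mapPoints (sqZeroMap k (n • (LinearMap.id : M →ₗ[R] M))) y = n • y := by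
  induction n with
  | zero => rw [zero_smul, zero_smul, E.mapPoints_sqZeroMap_zero hy]
  | succ n ih =>
    rw [succ_nsmul, succ_nsmul, E.mapPoints_sqZeroMap_add hy, ih, sqZeroMap_id, E.mapPoints_id]

lemma eq_zero_of_nsmul_eq_zero_of_mapPoints_fst_eq_zero (hy : E.mapPoints (fstHom k R M) y = 0)
    {m : ℕ} (hm : IsUnit (m : k)) (h : m • y = 0) : y = 0 := by
  obtain ⟨c, hc⟩ := hm.exists_right_inv
  have h_id : (algebraMap k R c • (LinearMap.id : M →ₗ[R] M)) ∘ₗ (m • LinearMap.id) =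
      LinearMap.id := by
    ext x
    simp only [LinearMap.comp_apply, LinearMap.smul_apply, LinearMap.id_apply, algebraMap_smul]
    rw [← Nat.cast_smul_eq_nsmul k, smul_smul, mul_comm, hc, one_smul]
  calc y = E.mapPoints (sqZeroMap k LinearMap.id) y := by rw [sqZeroMap_id, E.mapPoints_id]
    _ = E.mapPoints (sqZeroMap k (algebraMap k R c • LinearMap.id))
          (E.mapPoints (sqZeroMap k (m • LinearMap.id)) y) := by
        rw [← E.mapPoints_comp, ← sqZeroMap_comp, h_id]
    _ = 0 := by rw [E.mapPoints_sqZeroMap_nsmul hy, h, E.mapPoints_zero]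

end EllipticCurve

end Infinitesimal

section Unramified

variable {k : Type u} [CommRing k] {R : Type u} [CommRing R] [Algebra k R]

lemma subsingleton_kaehlerDifferential_of_D_eq_zero (h : KaehlerDifferential.D k R = 0) :
    Subsingleton (Ω[R⁄k]) := by
  suffices (⊤ : Submodule R (Ω[R⁄k])) ≤ ⊥ from
    (subsingleton_iff_forall_eq 0).2 fun _ => this trivial
  rw [← KaehlerDifferential.span_range_derivation, Submodule.span_le]
  rintro _ ⟨r, rfl⟩
  exact congrArg (· r) h

open TrivSqZeroExt in
/-- The homomorphism `r ↦ r + d r` from `R` to `R[M]` attached to a derivation `d : R → M`. -/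
def derivationHom {M : Type u} [AddCommGroup M] [Module R M] [Module k M]
    [IsScalarTower k R M] [Module Rᵐᵒᵖ M] [IsCentralScalar R M] (d : Derivation k R M) :
    R →ₐ[k] TrivSqZeroExt R M where
  toFun r := inl r + inr (d r)
  map_one' := by simp
  map_mul' a b := by ext <;> simp
  map_zero' := by simp
  map_add' a b := by ext <;> simp
  commutes' c := by ext <;> simp [algebraMap_eq_inl']

open TrivSqZeroExt in
lemma EllipticCurve.formallyUnramified_of_torsion (E : EllipticCurve k) (x : E.Points R)
    (hmono : ∀ (C : Type u) [CommRing C] [Algebra k C],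
      Function.Injective fun g : R →ₐ[k] C => E.mapPoints g x)
    {m : ℕ} (hm : IsUnit (m : k)) (hx : m • x = 0) : Algebra.FormallyUnramified k R := by
  let _ : Module Rᵐᵒᵖ (Ω[R⁄k]) := Module.compHom _ ((RingHom.id R).fromOpposite mul_comm)
  have : IsCentralScalar R (Ω[R⁄k]) := ⟨fun _ _ => rfl⟩
  let d := KaehlerDifferential.D k R
  have hy : E.mapPoints (fstHom k R (Ω[R⁄k]))
      (E.mapPoints (inlAlgHom k R _) x - E.mapPoints (derivationHom d) x) = 0 := by
    rw [E.mapPoints_sub, ← E.mapPoints_comp, ← E.mapPoints_comp, sub_eq_zero]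
    congr 1
    ext
    simp [derivationHom]
  have h := E.eq_zero_of_nsmul_eq_zero_of_mapPoints_fst_eq_zero hy hm (by
    rw [smul_sub, ← E.mapPoints_nsmul, ← E.mapPoints_nsmul, hx, E.mapPoints_zero,
      E.mapPoints_zero, sub_zero])
  have h_hom := hmono _ (sub_eq_zero.1 h)
  refine (Algebra.formallyUnramified_iff k R).2 (subsingleton_kaehlerDifferential_of_D_eq_zero ?_)
  ext r
  simpa [derivationHom] using (congrArg (fun g => (g r).snd) h_hom).symm

end Unramified

/-! ## The torsion subgroup scheme -/

section TorsionScheme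

lemma of_forall_isOpenImmersion_spec (P : MorphismProperty Scheme.{u}) [IsZariskiLocalAtSource P]
    {X Y : Scheme.{u}} {f : X ⟶ Y}
    (h : ∀ (R : CommRingCat.{u}) (j : Spec R ⟶ X), IsOpenImmersion j → P (j ≫ f)) : P f :=
  (IsZariskiLocalAtSource.iff_of_openCover X.affineCover).2 fun i =>
    h _ _ (X.affineCover.map_prop i)

namespace EllipticCurve

variable {k : Type u} [CommRing k] (E : EllipticCurve k) (m : ℕ)

/-- The `m`-torsion subgroup scheme `E[m]` over `Spec k`: the equalizer of multiplication by `m`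
and the zero map. -/
def torsion : Over (Spec (CommRingCat.of k)) :=
  Limits.equalizer ((𝟙 E.scheme) ^ m) (1 : E.scheme ⟶ E.scheme)

/-- The inclusion of `E[m]` into `E`. -/
def torsionIncl : E.torsion m ⟶ E.scheme :=
  Limits.equalizer.ι ((𝟙 E.scheme) ^ m) (1 : E.scheme ⟶ E.scheme)

instance : Mono (E.torsionIncl m) :=
  inferInstanceAs (Mono (Limits.equalizer.ι _ _))

instance : IsProper (E.torsion m).hom := by
  have : IsSeparated E.scheme.hom := inferInstance
  have : IsClosedImmersion (E.torsionIncl m).left :=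
    inferInstanceAs (IsClosedImmersion
      (Limits.equalizer.ι ((𝟙 E.scheme) ^ m) (1 : E.scheme ⟶ E.scheme)).left)
  rw [← Over.w (E.torsionIncl m)]
  infer_instance

lemma torsionIncl_pow : E.torsionIncl m ^ m = 1 := by
  have h := Limits.equalizer.condition ((𝟙 E.scheme) ^ m) (1 : E.scheme ⟶ E.scheme)
  rw [MonObj.comp_one, MonObj.comp_pow, Category.comp_id] at h
  exact h

variable {m}

lemma exists_comp_torsionIncl {T : Over (Spec (CommRingCat.of k))} {y : T ⟶ E.scheme}
    (hy : y ^ m = 1) : ∃ z, z ≫ E.torsionIncl m = y := by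
  refine ⟨Limits.equalizer.lift y ?_, Limits.equalizer.lift_ι _ _⟩
  rw [MonObj.comp_one, MonObj.comp_pow, Category.comp_id, hy]

lemma formallyUnramified_torsion (hm : IsUnit (m : k)) : FormallyUnramified (E.torsion m).hom := by
  have : IsZariskiLocalAtSource @FormallyUnramified.{u} :=
    HasRingHomProperty.instIsZariskiLocalAtSource (Q := RingHom.FormallyUnramified)
  refine of_forall_isOpenImmersion_spec @FormallyUnramified fun R j hj => ?_
  obtain ⟨φ, hφ⟩ := Spec.map_surjective (j ≫ (E.torsion m).hom)
  rw [← hφ, HasRingHomProperty.Spec_iff (P := @FormallyUnramified)]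
  let _ : Algebra k R := φ.hom.toAlgebra
  let j' : specOver k R ⟶ E.torsion m := Over.homMk j hφ.symm
  have : Mono ((Over.forget _).map j') := (inferInstance : Mono j)
  have : Mono j' := (Over.forget _).mono_of_mono_map this
  have : Mono (j' ≫ E.torsionIncl m) := mono_comp _ _
  refine E.formallyUnramified_of_torsion (Additive.ofMul (j' ≫ E.torsionIncl m))
    (fun C _ _ g₁ g₂ h => specMap_injective ((cancel_mono (j' ≫ E.torsionIncl m)).1 h)) hm ?_
  rw [← ofMul_pow, ← MonObj.comp_pow, E.torsionIncl_pow, MonObj.comp_one, ofMul_one]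

end EllipticCurve

end TorsionScheme

/-! ## The universal torsion point -/

section UniversalTorsion

variable {k : Type u} [CommRing k] {E : EllipticCurve k}
  {A : Type u} [CommRing A] [Algebra k A]

/-- The point `t ∈ E(A)` is a universal `m`-torsion point: it represents the functor `C ↦ E(C)[m]`
on `k`-algebras. -/
structure IsUniversalTorsion (m : ℕ) (t : E.Points A) : Prop where
  nsmul_eq_zero : m • t = 0
  exists_hom : ∀ {C : Type u} [CommRing C] [Algebra k C] (y : E.Points C), m • y = 0 →
    ∃ χ : A →ₐ[k] C, E.mapPoints χ t = y
  hom_ext : ∀ {C : Type u} [CommRing C] [Algebra k C] (χ χ' : A →ₐ[k] C),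
    E.mapPoints χ t = E.mapPoints χ' t → χ = χ'

lemma isUniversalTorsion_of_iso {m : ℕ} (e : specOver k A ≅ E.torsion m) :
    IsUniversalTorsion m (E := E) (Additive.ofMul (e.hom ≫ E.torsionIncl m)) where
  nsmul_eq_zero := by
    rw [← ofMul_pow, ← MonObj.comp_pow, E.torsionIncl_pow, MonObj.comp_one, ofMul_one]
  exists_hom y hy := by
    obtain ⟨z, hz⟩ := E.exists_comp_torsionIncl (y := y.toMul) hy
    obtain ⟨χ, hχ⟩ := specMap_surjective (z ≫ e.inv)
    exact ⟨χ, by simp [EllipticCurve.mapPoints, hχ, hz]⟩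
  hom_ext χ χ' h := specMap_injective <| (cancel_mono (e.hom ≫ E.torsionIncl m)).1 h

end UniversalTorsion

section EtaleAlgebra

variable {k : Type u} [Field k]

lemma locallyQuasiFinite_of_formallyUnramified {X : Scheme.{u}} (f : X ⟶ Spec (CommRingCat.of k))
    [LocallyOfFiniteType f] [FormallyUnramified f] : LocallyQuasiFinite f := by
  have := HasRingHomProperty.instIsZariskiLocalAtSource (P := @LocallyQuasiFinite.{u})
    (Q := RingHom.QuasiFinite)
  refine of_forall_isOpenImmersion_spec @LocallyQuasiFinite fun R j hj => ?_
  have h_unr : FormallyUnramified (j ≫ f) :=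
    MorphismProperty.comp_mem (W := @FormallyUnramified) _ _ inferInstance inferInstance
  have h_ft : LocallyOfFiniteType (j ≫ f) := inferInstance
  obtain ⟨φ, hφ⟩ := Spec.map_surjective (j ≫ f)
  rw [← hφ] at h_unr h_ft ⊢
  rw [HasRingHomProperty.Spec_iff (P := @FormallyUnramified)] at h_unr
  rw [HasRingHomProperty.Spec_iff (P := @LocallyOfFiniteType)] at h_ft
  rw [HasRingHomProperty.Spec_iff (P := @LocallyQuasiFinite)]
  algebraize [φ.hom]
  exact (inferInstance : Algebra.QuasiFinite k R)

lemma exists_specOver_pi_iso [IsSepClosed k] (K : Over (Spec (CommRingCat.of k)))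
    [IsProper K.hom] [FormallyUnramified K.hom] :
    ∃ (J : Type u) (_ : Finite J), Nonempty (specOver k (J → k) ≅ K) := by
  have := locallyQuasiFinite_of_formallyUnramified K.hom
  have : IsFinite K.hom := IsFinite.of_isProper_of_locallyQuasiFinite K.hom
  have : IsAffine K.left := isAffine_of_isAffineHom K.hom
  let A := Γ(K.left, ⊤)
  obtain ⟨φ, hφ⟩ := Spec.map_surjective (K.left.isoSpec.inv ≫ K.hom)
  let _ : Algebra k A := φ.hom.toAlgebra
  have h_finite : IsFinite (Spec.map φ) := by rw [hφ]; infer_instance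
  have h_unramified : FormallyUnramified (Spec.map φ) := by
    rw [hφ]
    exact MorphismProperty.comp_mem (W := @FormallyUnramified) _ _ inferInstance inferInstance
  have : Module.Finite k A := (IsFinite.SpecMap_iff φ).1 h_finite
  have : Algebra.FormallyUnramified k A :=
    (HasRingHomProperty.Spec_iff (P := @FormallyUnramified)).1 h_unramified
  have : Algebra.FormallyEtale k A := Algebra.FormallyEtale.of_formallyUnramified_of_field k A
  have : IsArtinianRing A := isArtinian_of_tower k inferInstance
  let e := Algebra.FormallyEtale.equivPiOfIsSepClosed k A
  let e' : specOver k (PrimeSpectrum A → k) ≅ specOver k A :=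
    { hom := specMap e.toAlgHom
      inv := specMap e.symm.toAlgHom
      hom_inv_id := by
        rw [← specMap_comp, ← specMap_id]
        congr 1
        ext1 x
        simp
      inv_hom_id := by
        rw [← specMap_comp, ← specMap_id]
        congr 1
        ext1 x
        simp }
  exact ⟨PrimeSpectrum A, inferInstance, ⟨e' ≪≫ Over.isoMk K.left.isoSpec.symm hφ.symm⟩⟩

theorem EllipticCurve.exists_isUniversalTorsion [IsSepClosed k] (E : EllipticCurve k) {m : ℕ}
    (hm : (m : k) ≠ 0) :
    ∃ (J : Type u) (_ : Finite J) (t : E.Points (J → k)), IsUniversalTorsion m t := by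
  have := E.formallyUnramified_torsion hm.isUnit
  obtain ⟨J, hJ, ⟨e⟩⟩ := exists_specOver_pi_iso (E.torsion m)
  exact ⟨J, hJ, _, isUniversalTorsion_of_iso e⟩

end EtaleAlgebra

/-! ## Deligne's theorem -/

section Deligne

open WithConv LinearMap Coalgebra Bialgebra
open scoped TensorProduct

variable {R : Type u} {A : Type v} [CommRing R] [CommRing A]

section Bialgebra

variable [Bialgebra R A]

/-- Translation by the point `u` of `Spec A`, as an endomorphism of the bialgebra `A`. -/
def translateHom (u : WithConv (A →ₐ[R] R)) : A →ₐ[R] A :=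
  (toConv (AlgHom.id R A) * toConv ((Algebra.ofId R A).comp u.ofConv)).ofConv

lemma translateHom_one : translateHom (1 : WithConv (A →ₐ[R] R)) = AlgHom.id R A := by
  have h : toConv ((Algebra.ofId R A).comp (1 : WithConv (A →ₐ[R] R)).ofConv) = 1 := by
    ext
    simp [Algebra.ofId_apply]
  rw [translateHom, h, _root_.mul_one]

lemma translateHom_mul (u u' : WithConv (A →ₐ[R] R)) :
    translateHom (u * u') = (translateHom u).comp (translateHom u') := by
  have h : (translateHom u).comp (Algebra.ofId R A) = Algebra.ofId R A := Subsingleton.elim _ _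
  simp only [translateHom] at h ⊢
  rw [AlgHom.comp_convMul_distrib, AlgHom.comp_convMul_distrib, AlgHom.comp_id,
    ofConv_toConv, ← AlgHom.comp_assoc, h, toConv_ofConv, ← _root_.mul_assoc]

variable (R A) in
/-- The homomorphism of convolution algebras `Hom(A, R) → Hom(A, A)`. -/
def convLift : WithConv (A →ₗ[R] R) →+* WithConv (A →ₗ[R] A) where
  toFun f := toConv (Algebra.linearMap R A ∘ₗ f.ofConv)
  map_one' := by
    ext
    simp
  map_mul' f g := ofConv_injective (algHom_comp_convMul_distrib (Algebra.ofId R A) f g)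
  map_zero' := by
    ext
    simp
  map_add' f g := by
    ext
    simp

variable [IsCocomm R A]

variable (R A) in
/-- The convolution algebra `Hom(A, A)` as an algebra over the convolution algebra `Hom(A, R)`. -/
abbrev convDualAlgebra : Algebra (WithConv (A →ₗ[R] R)) (WithConv (A →ₗ[R] A)) :=
  (convLift R A).toAlgebra

attribute [local instance] convDualAlgebra

/-- The basis of `Hom(A, A)` over `Hom(A, R)` given by a basis of `A` over `R`. -/
def convDualBasis {J : Type*} [Fintype J] (b : Module.Basis J R A) :
    Module.Basis J (WithConv (A →ₗ[R] R)) (WithConv (A →ₗ[R] A)) :=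
  .ofEquivFun
    { toFun := fun f i => toConv (b.coord i ∘ₗ f.ofConv)
      invFun := fun c => toConv (∑ i, (c i).ofConv.smulRight (b i))
      left_inv := fun f => by
        ext
        simp
      right_inv := fun c => by
        classical
        ext
        simp [Finsupp.single_apply]
      map_add' := fun f g => by
        ext
        simp
      map_smul' := fun f g => by
        funext i
        have h : b.coord i ∘ₗ mul' R A ∘ₗ
            TensorProduct.map (Algebra.linearMap R A ∘ₗ f.ofConv) g.ofConv =
              mul' R R ∘ₗ TensorProduct.map f.ofConv (b.coord i ∘ₗ g.ofConv) := by
          ext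
          simp [← Algebra.smul_def]
        ext x
        exact congrArg (fun l => l (comul x)) h }

/-- The automorphism `f ↦ e ∘ f` of the algebra `Hom(A, A)` over `Hom(A, R)`. -/
def convCongr (e : A ≃ₐ[R] A) :
    WithConv (A →ₗ[R] A) ≃ₐ[WithConv (A →ₗ[R] R)] WithConv (A →ₗ[R] A) where
  toFun f := toConv (e.toLinearMap ∘ₗ f.ofConv)
  invFun f := toConv (e.symm.toLinearMap ∘ₗ f.ofConv)
  left_inv f := by
    ext
    simp
  right_inv f := by
    ext
    simp
  map_mul' f g := ofConv_injective (algHom_comp_convMul_distrib (e : A →ₐ[R] A) f g)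
  map_add' f g := by
    ext
    simp
  commutes' f := by
    ext x
    exact e.commutes _

end Bialgebra

attribute [local instance] convDualAlgebra

variable [HopfAlgebra R A]

/-- Translation by the point `u` of `Spec A`, as an automorphism of the Hopf algebra `A`. -/
def translate (u : WithConv (A →ₐ[R] R)) : A ≃ₐ[R] A :=
  AlgEquiv.ofAlgHom (translateHom u) (translateHom u⁻¹)
    (by rw [← translateHom_mul, mul_inv_cancel, translateHom_one])
    (by rw [← translateHom_mul, inv_mul_cancel, translateHom_one])

-- The norm over `Hom(A, R)` of the identity of `A` is invariant under translation by `u`, which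
-- multiplies the identity by the scalar `u`; hence `norm id = norm id * u ^ rank A`.
theorem conv_pow_finrank_eq_one [IsCocomm R A] [Module.Free R A] [Module.Finite R A]
    (u : WithConv (A →ₐ[R] R)) : u ^ Module.finrank R A = 1 := by
  cases subsingleton_or_nontrivial R
  · exact ofConv_injective (AlgHom.ext fun _ => Subsingleton.elim _ _)
  let u₀ : WithConv (A →ₗ[R] R) := toConv u.ofConv.toLinearMap
  have h_translate : convCongr (translate u) (toConv LinearMap.id) =
      toConv LinearMap.id * algebraMap _ _ u₀ := rfl
  have h_norm := Algebra.norm_eq_of_algEquiv (convCongr (translate u)) (toConv LinearMap.id)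
  rw [h_translate, map_mul, Algebra.norm_algebraMap_of_basis (convDualBasis (Module.finBasis R A)),
    Fintype.card_fin] at h_norm
  have h_unit : IsUnit (Algebra.norm (WithConv (A →ₗ[R] R))
      (toConv LinearMap.id : WithConv (A →ₗ[R] A))) :=
    (IsUnit.of_mul_eq_one _ id_mul_antipode).map _
  have h_pow : u₀ ^ Module.finrank R A = 1 :=
    h_unit.mul_left_cancel (by rw [h_norm, _root_.mul_one])
  rw [← AlgHom.toLinearMap_convPow] at h_pow
  exact ofConv_injective (AlgHom.toLinearMap_injective (toConv_injective h_pow))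

end Deligne

/-! ## A finite locally free subgroup scheme is killed by its rank -/

section Rank

open Algebra.TensorProduct WithConv
open scoped TensorProduct

variable {k : Type u} [CommRing k] {E : EllipticCurve k} {B : Type u} [CommRing B] [Algebra k B]
  {A : Type u} [CommRing A] [Algebra k A] [Algebra B A] [IsScalarTower k B A]

section Specialize

variable {D : Type u} [CommRing D] [Algebra k D] [Algebra B D] [IsScalarTower k B D]

/-- The image of an `A`-valued point under a homomorphism of `B`-algebras, where `B` is an algebra
over the base ring `k` of the elliptic curve. -/
def EllipticCurve.specialize (x : E.Points A) (ψ : A →ₐ[B] D) : E.Points D :=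
  E.mapPoints (ψ.restrictScalars k) x

lemma specialize_comp {D' : Type u} [CommRing D'] [Algebra k D'] [Algebra B D']
    [IsScalarTower k B D'] (x : E.Points A) (g : D →ₐ[B] D') (f : A →ₐ[B] D) :
    E.specialize x (g.comp f) = E.specialize (E.specialize x f) g :=
  E.mapPoints_comp (f.restrictScalars k) (g.restrictScalars k) x

lemma specialize_id (x : E.Points A) : E.specialize x (AlgHom.id B A) = x :=
  E.mapPoints_id x

lemma specialize_add (x y : E.Points A) (ψ : A →ₐ[B] D) :
    E.specialize (x + y) ψ = E.specialize x ψ + E.specialize y ψ :=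
  E.mapPoints_add _ x y

lemma specialize_zero (ψ : A →ₐ[B] D) : E.specialize (0 : E.Points A) ψ = 0 :=
  E.mapPoints_zero _

lemma SubgroupFunctor.specialize_mem (G : SubgroupFunctor E B) {x : E.Points A}
    (hx : x ∈ G.points (IsScalarTower.toAlgHom k B A)) (ψ : A →ₐ[B] D) :
    E.specialize x ψ ∈ G.points (IsScalarTower.toAlgHom k B D) := by
  have h_comp : (ψ.restrictScalars k).comp (IsScalarTower.toAlgHom k B A) =
      IsScalarTower.toAlgHom k B D := AlgHom.ext ψ.commutes
  rw [← h_comp]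
  exact G.mapPoints_mem _ (ψ.restrictScalars k) x hx

end Specialize

/-- The `B`-algebra `A` represents the subgroup functor `G` of `E_B`, with universal point `x`. -/
structure SubgroupFunctor.Represents (G : SubgroupFunctor E B) (A : Type u) [CommRing A]
    [Algebra k A] [Algebra B A] [IsScalarTower k B A] (x : E.Points A) : Prop where
  mem : x ∈ G.points (IsScalarTower.toAlgHom k B A)
  exists_hom : ∀ (D : Type u) [CommRing D] [Algebra k D] [Algebra B D] [IsScalarTower k B D],
    ∀ y ∈ G.points (IsScalarTower.toAlgHom k B D), ∃ ψ : A →ₐ[B] D, E.specialize x ψ = y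
  hom_ext : ∀ (D : Type u) [CommRing D] [Algebra k D] [Algebra B D] [IsScalarTower k B D]
    (ψ ψ' : A →ₐ[B] D), E.specialize x ψ = E.specialize x ψ' → ψ = ψ'

namespace SubgroupFunctor.Represents

variable {G : SubgroupFunctor E B} {x : E.Points A}

section HopfAlgebra

variable (h : G.Represents A x) {D : Type u} [CommRing D] [Algebra k D] [Algebra B D]
  [IsScalarTower k B D]

include h in
lemma exists_comul : ∃ Δ : A →ₐ[B] A ⊗[B] A, E.specialize x Δ =
    E.specialize x (includeLeft : A →ₐ[B] A ⊗[B] A) +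
      E.specialize x (includeRight : A →ₐ[B] A ⊗[B] A) :=
  h.exists_hom _ _ (add_mem (G.specialize_mem h.mem _) (G.specialize_mem h.mem _))

/-- The comultiplication of `A` given by the addition of points. -/
def comul : A →ₐ[B] A ⊗[B] A := h.exists_comul.choose

lemma specialize_comp_comul (g : A ⊗[B] A →ₐ[B] D) :
    E.specialize x (g.comp h.comul) =
      E.specialize x (g.comp includeLeft) + E.specialize x (g.comp includeRight) := by
  rw [specialize_comp, comul, h.exists_comul.choose_spec, specialize_add, specialize_comp,
    specialize_comp]

/-- The counit of `A` given by the point `0`. -/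
def counit : A →ₐ[B] B := (h.exists_hom B 0 (zero_mem _)).choose

lemma specialize_comp_counit (g : B →ₐ[B] D) : E.specialize x (g.comp h.counit) = 0 := by
  rw [specialize_comp, counit, (h.exists_hom B 0 (zero_mem _)).choose_spec, specialize_zero]

/-- The antipode of `A` given by the negation of points. -/
def antipode : A →ₐ[B] A := (h.exists_hom A (-x) (neg_mem h.mem)).choose

lemma specialize_antipode : E.specialize x h.antipode = -x :=
  (h.exists_hom A (-x) (neg_mem h.mem)).choose_spec

lemma coassoc : (Algebra.TensorProduct.assoc B B B A A A).toAlgHom.comp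
    ((map h.comul (.id B A)).comp h.comul) = (map (.id B A) h.comul).comp h.comul := by
  let α : A ⊗[B] A ⊗[B] A →ₐ[B] A ⊗[B] (A ⊗[B] A) :=
    (Algebra.TensorProduct.assoc B B B A A A).toAlgHom
  have h_left_left : (α.comp includeLeft).comp includeLeft =
      (map (.id B A) h.comul).comp includeLeft := by
    ext
    simp [α, Algebra.TensorProduct.one_def]
  have h_left_right : (α.comp includeLeft).comp includeRight =
      (includeRight : A ⊗[B] A →ₐ[B] A ⊗[B] (A ⊗[B] A)).comp includeLeft := by
    ext
    simp [α]
  have h_right : (α.comp (map h.comul (.id B A))).comp includeRight =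
      (includeRight : A ⊗[B] A →ₐ[B] A ⊗[B] (A ⊗[B] A)).comp includeRight := by
    ext
    simp [α, Algebra.TensorProduct.one_def]
  have h_map_right : (map (.id B A) h.comul).comp includeRight =
      (includeRight : A ⊗[B] A →ₐ[B] A ⊗[B] (A ⊗[B] A)).comp h.comul :=
    map_comp_includeRight _ _
  refine h.hom_ext _ _ _ ?_
  calc E.specialize x ((α.comp (map h.comul (.id B A))).comp h.comul)
      = E.specialize x ((α.comp includeLeft).comp h.comul) +
          E.specialize x ((α.comp (map h.comul (.id B A))).comp includeRight) := by
        rw [specialize_comp_comul, AlgHom.comp_assoc α _ includeLeft, map_comp_includeLeft]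
        rfl
    _ = E.specialize x ((map (.id B A) h.comul).comp includeLeft) +
          E.specialize x ((map (.id B A) h.comul).comp includeRight) := by
        rw [specialize_comp_comul, h_left_left, h_left_right, h_right, h_map_right,
          specialize_comp_comul, add_assoc]
    _ = E.specialize x ((map (.id B A) h.comul).comp h.comul) := by rw [specialize_comp_comul]

lemma rTensor_counit_comp_comul :
    (map h.counit (.id B A)).comp h.comul = (Algebra.TensorProduct.lid B A).symm := by
  refine h.hom_ext _ _ _ ?_
  rw [specialize_comp_comul, map_comp_includeLeft, map_comp_includeRight, specialize_comp_counit,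
    zero_add]
  rfl

lemma lTensor_counit_comp_comul :
    (map (.id B A) h.counit).comp h.comul = (Algebra.TensorProduct.rid B B A).symm := by
  refine h.hom_ext _ _ _ ?_
  rw [specialize_comp_comul, map_comp_includeLeft, map_comp_includeRight, specialize_comp_counit,
    add_zero]
  rfl

lemma lift_antipode_id_comp_comul :
    (lift h.antipode (.id B A) fun _ _ => Commute.all _ _).comp h.comul =
      (Algebra.ofId B A).comp h.counit := by
  refine h.hom_ext _ _ _ ?_
  rw [specialize_comp_comul, lift_comp_includeLeft, lift_comp_includeRight', specialize_antipode,
    specialize_id, specialize_comp_counit, neg_add_cancel]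

lemma lift_id_antipode_comp_comul :
    (lift (.id B A) h.antipode fun _ _ => Commute.all _ _).comp h.comul =
      (Algebra.ofId B A).comp h.counit := by
  refine h.hom_ext _ _ _ ?_
  rw [specialize_comp_comul, lift_comp_includeLeft, lift_comp_includeRight', specialize_antipode,
    specialize_id, specialize_comp_counit, add_neg_cancel]

lemma comm_comp_comul :
    (Algebra.TensorProduct.comm B A A).toAlgHom.comp h.comul = h.comul := by
  refine h.hom_ext _ _ _ ?_
  rw [specialize_comp_comul, ← h.comul.id_comp, specialize_comp_comul, add_comm]
  congr 2

/-- The Hopf algebra structure on the ring of functions of a represented subgroup functor. -/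
abbrev hopfAlgebra : HopfAlgebra B A :=
  let _ : Bialgebra B A := Bialgebra.ofAlgHom h.comul h.counit h.coassoc
    h.rTensor_counit_comp_comul h.lTensor_counit_comp_comul
  HopfAlgebra.ofAlgHom h.antipode h.lift_antipode_id_comp_comul h.lift_id_antipode_comp_comul

lemma isCocomm : let _ := h.hopfAlgebra; Coalgebra.IsCocomm B A :=
  let _ := h.hopfAlgebra
  ⟨congrArg AlgHom.toLinearMap h.comm_comp_comul⟩

lemma specialize_convMul (f g : A →ₐ[B] D) : let _ := h.hopfAlgebra
    E.specialize x (toConv f * toConv g).ofConv = E.specialize x f + E.specialize x g := by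
  have h_mul := h.specialize_comp_comul ((lmul' B).comp (map f g))
  have h_left : ((lmul' B).comp (map f g)).comp includeLeft = f := by
    ext
    simp
  have h_right : ((lmul' B).comp (map f g)).comp includeRight = g := by
    ext
    simp
  rw [h_left, h_right] at h_mul
  exact h_mul

lemma specialize_convPow (f : A →ₐ[B] D) (n : ℕ) : let _ := h.hopfAlgebra
    E.specialize x (toConv f ^ n).ofConv = n • E.specialize x f := by
  intro _
  induction n with
  | zero =>
    rw [zero_nsmul]
    exact h.specialize_comp_counit _
  | succ n ih =>
    rw [succ_nsmul, ← ih, pow_succ]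
    exact h.specialize_convMul _ f

end HopfAlgebra

theorem finrank_nsmul_eq_zero (h : G.Represents A x) [Module.Free B A] [Module.Finite B A]
    (y : E.Points B) (hy : y ∈ G.points (IsScalarTower.toAlgHom k B B)) :
    Module.finrank B A • y = 0 := by
  let _ := h.hopfAlgebra
  have := h.isCocomm
  obtain ⟨f, rfl⟩ := h.exists_hom B y hy
  rw [← h.specialize_convPow, conv_pow_finrank_eq_one]
  exact h.specialize_comp_counit _

end SubgroupFunctor.Represents

/-- The base change of a subgroup functor along `φ : B → B'`. -/
def SubgroupFunctor.baseChange (G : SubgroupFunctor E B) {B' : Type u} [CommRing B'] [Algebra k B']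
    (φ : B →ₐ[k] B') : SubgroupFunctor E B' where
  points ψ := G.points (ψ.comp φ)
  mapPoints_mem _ _ := G.mapPoints_mem _ _

namespace SubgroupFunctor.Represents

variable {G : SubgroupFunctor E B} {x : E.Points A}

lemma baseChange (h : G.Represents A x) (B' : Type u) [CommRing B']
    [Algebra k B'] [Algebra B B'] [IsScalarTower k B B'] :
    (G.baseChange (IsScalarTower.toAlgHom k B B')).Represents (B' ⊗[B] A)
      (E.specialize x (includeRight : A →ₐ[B] B' ⊗[B] A)) := by
  have h_mem := G.specialize_mem h.mem (includeRight : A →ₐ[B] B' ⊗[B] A)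
  refine ⟨h_mem, fun D _ _ _ _ y hy => ?_,
    fun D _ _ _ _ ψ ψ' hψ => ?_⟩
  all_goals
    let _ : Algebra B D := Algebra.compHom D (algebraMap B B')
    have : IsScalarTower B B' D := .of_algebraMap_eq' rfl
    have : IsScalarTower k B D := .of_algebraMap_eq fun c => by
      rw [IsScalarTower.algebraMap_apply B B' D, ← IsScalarTower.algebraMap_apply k B B',
        ← IsScalarTower.algebraMap_apply k B' D]
  · obtain ⟨ψ, rfl⟩ := h.exists_hom D y hy
    refine ⟨lift (Algebra.ofId B' D) ψ fun _ _ => Commute.all _ _, ?_⟩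
    rw [EllipticCurve.specialize, EllipticCurve.specialize, ← E.mapPoints_comp]
    congr 1
    ext
    simp
  · refine Algebra.TensorProduct.ext (Subsingleton.elim _ _) (h.hom_ext D _ _ ?_)
    simp only [EllipticCurve.specialize, ← E.mapPoints_comp] at hψ
    exact hψ

lemma finrank_nsmul_universal (h : G.Represents A x) [Module.Free B A] [Module.Finite B A] :
    Module.finrank B A • x = 0 := by
  cases subsingleton_or_nontrivial B
  · have := Module.subsingleton B A
    refine E.points_ext (J := Empty) (D := fun _ => A) nofun (fun a _ => Subsingleton.elim _ _)
      nofun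
  cases subsingleton_or_nontrivial A
  · rw [Module.finrank_zero_of_subsingleton, zero_smul]
  · rw [← Module.finrank_baseChange (R := A)]
    exact (h.baseChange A).finrank_nsmul_eq_zero x h.mem

theorem rank_nsmul_universal (h : G.Represents A x) [Module.Projective B A] [Module.Finite B A]
    {N : ℕ} (hN : ∀ 𝔭 : PrimeSpectrum B, Module.rankAtStalk (R := B) A 𝔭 = N) : N • x = 0 := by
  let loc (𝔭 : PrimeSpectrum B) : Type u := Localization 𝔭.asIdeal.primeCompl
  refine E.points_ext (D := fun 𝔭 => loc 𝔭 ⊗[B] A)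
    (fun 𝔭 => (includeRight : A →ₐ[B] loc 𝔭 ⊗[B] A).restrictScalars k) (fun a ha => ?_)
    fun 𝔭 => ?_
  · exact Module.eq_zero_of_localization_maximal (R := B)
      (fun P _ => Localization P.primeCompl ⊗[B] A)
      (fun P _ => TensorProduct.mk B (Localization P.primeCompl) A 1) a
      fun P hP => ha ⟨P, hP.isPrime⟩
  · have : Module.Free (loc 𝔭) (loc 𝔭 ⊗[B] A) := Module.free_of_flat_of_isLocalRing
    rw [E.mapPoints_nsmul, E.mapPoints_zero, ← hN 𝔭, Module.rankAtStalk_eq_finrank_tensorProduct]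
    exact (h.baseChange (loc 𝔭)).finrank_nsmul_universal

end SubgroupFunctor.Represents

end Rank

/-! ## Complete orthogonal idempotents -/

section Idempotents

lemma eq_zero_or_one_of_isIdempotentElem {D : Type*} [CommRing D] [IsLocalRing D] {e : D}
    (h : IsIdempotentElem e) : e = 0 ∨ e = 1 := by
  rcases IsLocalRing.isUnit_or_isUnit_of_add_one (add_sub_cancel e 1) with hu | hu
  · exact Or.inr ((IsIdempotentElem.iff_eq_one_of_isUnit hu).1 h)
  · exact Or.inl (by simpa using (IsIdempotentElem.iff_eq_one_of_isUnit hu).1 h.one_sub)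

variable {J : Type*}

section PiAlgHom

variable {k C : Type*} [CommRing k] [CommRing C] [Algebra k C]

lemma completeOrthogonalIdempotents_map_single [Fintype J] [DecidableEq J] (χ : (J → k) →ₐ[k] C) :
    CompleteOrthogonalIdempotents fun j => χ (Pi.single j 1) :=
  (CompleteOrthogonalIdempotents.single fun _ : J => k).map χ.toRingHom

lemma pi_algHom_apply [Fintype J] [DecidableEq J] (χ : (J → k) →ₐ[k] C) (f : J → k) :
    χ f = ∑ j, f j • χ (Pi.single j 1) := by
  simp_rw [← map_smul, ← map_sum, ← Pi.single_smul, smul_eq_mul, _root_.mul_one,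
    Finset.univ_sum_single]

lemma pi_algHom_ext [Finite J] [DecidableEq J] {χ χ' : (J → k) →ₐ[k] C}
    (h : ∀ j, χ (Pi.single j 1) = χ' (Pi.single j 1)) : χ = χ' := by
  have := Fintype.ofFinite J
  ext f
  rw [pi_algHom_apply, pi_algHom_apply χ']
  simp only [h]

lemma pi_algHom_eq_eval [Finite J] [DecidableEq J] {χ : (J → k) →ₐ[k] C} {i : J}
    (hi : χ (Pi.single i 1) = 1) :
    χ = (Algebra.ofId k C).comp (Pi.evalAlgHom k (fun _ => k) i) := by
  have := Fintype.ofFinite J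
  refine pi_algHom_ext fun j => ?_
  obtain rfl | hj := eq_or_ne j i
  · simp [hi]
  · simpa [hi, hj] using (completeOrthogonalIdempotents_map_single χ).ortho hj

lemma exists_pi_algHom_eq_eval [Finite J] [IsLocalRing C] (χ : (J → k) →ₐ[k] C) :
    ∃ i, χ = (Algebra.ofId k C).comp (Pi.evalAlgHom k (fun _ => k) i) := by
  classical
  have := Fintype.ofFinite J
  have hχ := completeOrthogonalIdempotents_map_single χ
  by_contra! h
  have h_zero (i : J) : χ (Pi.single i 1) = 0 :=
    (eq_zero_or_one_of_isIdempotentElem (hχ.idem i)).resolve_right fun h_one =>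
      h i (pi_algHom_eq_eval h_one)
  simpa [h_zero] using hχ.complete

end PiAlgHom

variable {B : Type*} [CommRing B]

lemma mul_eq_self_of_forall_map_eq_one {k : Type*} {B : Type u} [CommRing k] [CommRing B]
    [Algebra k B] {e e' : B} (he : IsIdempotentElem e)
    (h : ∀ (C : Type u) [CommRing C] [Algebra k C] (φ : B →ₐ[k] C), φ e = 1 → φ e' = 1) :
    e * e' = e := by
  have h_iff (b : B) : Ideal.Quotient.mkₐ k (Ideal.span {e - 1}) b = 1 ↔ e - 1 ∣ b - 1 := by
    rw [← map_one (Ideal.Quotient.mkₐ k _)]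
    exact (Ideal.Quotient.eq).trans Ideal.mem_span_singleton
  obtain ⟨b, hb⟩ := (h_iff e').1 (h _ _ ((h_iff e).2 dvd_rfl))
  linear_combination e * hb + b * he.eq

lemma eq_of_forall_map_eq_one_iff {k : Type*} {B : Type u} [CommRing k] [CommRing B]
    [Algebra k B] {e e' : B} (he : IsIdempotentElem e) (he' : IsIdempotentElem e')
    (h : ∀ (C : Type u) [CommRing C] [Algebra k C] (φ : B →ₐ[k] C), φ e = 1 ↔ φ e' = 1) :
    e = e' := by
  rw [← mul_eq_self_of_forall_map_eq_one he fun C _ _ φ => (h C φ).1, mul_comm,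
    mul_eq_self_of_forall_map_eq_one he' fun C _ _ φ => (h C φ).2]

variable {A : Type*} [CommRing A] [Algebra B A] [Fintype J] {ε : J → A}

/-- The homomorphism `b ↦ ∑ j, b j • ε j` of `B`-algebras from the functions on `J` given by
complete orthogonal idempotents `ε j` of a `B`-algebra. -/
def idempotentsAlgHom (hε : CompleteOrthogonalIdempotents ε) : (J → B) →ₐ[B] A :=
  AlgHom.ofLinearMap (Fintype.linearCombination B ε)
    (by simp [Fintype.linearCombination_apply, hε.complete])
    (fun b c => by
      classical
      simp [Fintype.linearCombination_apply, Finset.sum_mul_sum, hε.mul_eq, smul_smul,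
        mul_comm])

lemma idempotentsAlgHom_apply (hε : CompleteOrthogonalIdempotents ε) (b : J → B) :
    idempotentsAlgHom hε b = ∑ j, b j • ε j :=
  rfl

lemma idempotentsAlgHom_single [DecidableEq J] (hε : CompleteOrthogonalIdempotents ε) (j : J) :
    idempotentsAlgHom hε (Pi.single j (1 : B)) = ε j := by
  simp [idempotentsAlgHom_apply, Pi.single_apply]

lemma mul_idempotentsAlgHom (hε : CompleteOrthogonalIdempotents ε) (b : J → B) (j : J) :
    ε j * idempotentsAlgHom hε b = b j • ε j := by
  classical
  simp [idempotentsAlgHom_apply, Finset.mul_sum, hε.mul_eq]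

lemma idempotentsAlgHom_eq_zero_iff (hε : CompleteOrthogonalIdempotents ε) {b : J → B} :
    idempotentsAlgHom hε b = 0 ↔ ∀ j, b j • ε j = 0 := by
  refine ⟨fun h j => ?_, fun h => ?_⟩
  · rw [← mul_idempotentsAlgHom hε, h, mul_zero]
  · rw [idempotentsAlgHom_apply, Finset.sum_eq_zero fun j _ => h j]

lemma exists_idempotents_smul_eq_zero_iff [Module.Projective B A]
    (hε : CompleteOrthogonalIdempotents ε)
    (hsurj : Function.Surjective (idempotentsAlgHom (B := B) hε)) :
    ∃ e : J → B, (∀ j, IsIdempotentElem (e j)) ∧ ∀ j b, b • ε j = 0 ↔ b * e j = 0 := by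
  suffices ∀ j, ∃ e : B, e • ε j = ε j ∧ ∀ b : B, b • ε j = 0 → b * e = 0 by
    choose e he h_annihilator using this
    refine ⟨e, fun j => ?_, fun j b => ⟨h_annihilator j b, fun h => ?_⟩⟩
    · have := h_annihilator j (1 - e j) (by rw [sub_smul, he, one_smul, sub_self])
      rwa [sub_mul, _root_.one_mul, sub_eq_zero, eq_comm] at this
    · rw [← he, smul_smul, h, zero_smul]
  intro j
  -- Multiplication by `ε j` maps `A` to `B • ε j`; lift it to a linear form along `B → B • ε j`.
  obtain ⟨f, hf⟩ := Module.projective_lifting_property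
    (LinearMap.toSpanSingleton B A (ε j)).rangeRestrict
    ((LinearMap.mulLeft B (ε j)).codRestrict _ fun a => by
      obtain ⟨b, rfl⟩ := hsurj a
      exact ⟨b j, (mul_idempotentsAlgHom hε b j).symm⟩) (LinearMap.surjective_rangeRestrict _)
  have hf' (a : A) : f a • ε j = ε j * a := congrArg Subtype.val (LinearMap.congr_fun hf a)
  exact ⟨f (ε j), by rw [hf', (hε.idem j).eq], fun b hb => by
    rw [← smul_eq_mul, ← map_smul, hb, map_zero]⟩

section

variable (hε : CompleteOrthogonalIdempotents ε)
  (hsurj : Function.Surjective (idempotentsAlgHom (B := B) hε)) {e : J → B}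
  (he : ∀ j, IsIdempotentElem (e j)) (h_smul : ∀ j b, b • ε j = 0 ↔ b * e j = 0)

include hsurj he h_smul in
lemma exists_algHom_apply_idempotent_iff {D : Type*} [CommRing D] [Algebra B D] {ε' : J → D}
    (hε' : CompleteOrthogonalIdempotents ε') :
    (∃ ψ : A →ₐ[B] D, ∀ j, ψ (ε j) = ε' j) ↔ ∀ j, e j • ε' j = ε' j := by
  classical
  constructor
  · rintro ⟨ψ, hψ⟩ j
    have h_eq : (1 - e j) • ε j = 0 := by rw [h_smul, sub_mul, _root_.one_mul, (he j).eq, sub_self]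
    rw [sub_smul, one_smul, sub_eq_zero] at h_eq
    rw [← hψ, ← map_smul, ← h_eq]
  · intro h
    refine ⟨AlgHom.liftOfSurjective _ hsurj (idempotentsAlgHom hε') fun b hb => ?_, fun j => ?_⟩
    · rw [RingHom.mem_ker] at hb ⊢
      refine (idempotentsAlgHom_eq_zero_iff hε').2 fun j => ?_
      rw [← h j, smul_smul, (h_smul j (b j)).1 ((idempotentsAlgHom_eq_zero_iff hε).1 hb j),
        zero_smul]
    · rw [← idempotentsAlgHom_single (B := B) hε, AlgHom.liftOfSurjective_apply,
        idempotentsAlgHom_single]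

include hsurj he h_smul in
lemma finrank_eq_card_idempotents [IsLocalRing B] :
    Module.Free B A ∧ Module.finrank B A = Nat.card {j // e j = 1} := by
  classical
  let v (j : {j // e j = 1}) : A := ε j.1
  have h_indep : LinearIndependent B v := by
    refine Fintype.linearIndependent_iff.2 fun g hg i => ?_
    have h_zero : g i • ε i = 0 := by
      rw [← mul_zero (ε i), ← hg, Finset.mul_sum, Finset.sum_eq_single i
        (fun j _ hj => by simp [v, hε.ortho fun h => hj (Subtype.ext h.symm)]) (by simp)]
      simp [v, (hε.idem i.1).eq]
    simpa [i.2] using (h_smul i.1 (g i)).1 h_zero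
  have h_span : ⊤ ≤ Submodule.span B (Set.range v) := fun a _ => by
    obtain ⟨b, rfl⟩ := hsurj a
    refine Submodule.sum_mem _ fun j _ => Submodule.smul_mem _ _ ?_
    rcases eq_zero_or_one_of_isIdempotentElem (he j) with h0 | h1
    · have h_zero : ε j = 0 := by
        rw [← one_smul B (ε j), h_smul, h0, mul_zero]
      exact h_zero ▸ zero_mem _
    · exact Submodule.subset_span ⟨⟨j, h1⟩, rfl⟩
  let basis := Module.Basis.mk h_indep h_span
  exact ⟨.of_basis basis, by rw [Module.finrank_eq_card_basis basis, Nat.card_eq_fintype_card]⟩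

end

end Idempotents

/-! ## Subgroup schemes of the torsion -/

section Described

lemma surjective_of_finite_of_algHom_ext {B A A' : Type u} [CommRing B] [CommRing A] [Algebra B A]
    [CommRing A'] [Algebra B A'] [Module.Finite B A] (f : A' →ₐ[B] A)
    (h : ∀ (D : Type u) [CommRing D] [Algebra B D] (ψ ψ' : A →ₐ[B] D),
      ψ.comp f = ψ'.comp f → ψ = ψ') : Function.Surjective f := by
  have h_finite : f.toRingHom.Finite :=
    RingHom.Finite.of_comp_finite (f := algebraMap B A') <| by
      rw [AlgHom.toRingHom_eq_coe, f.comp_algebraMap, RingHom.finite_algebraMap]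
      infer_instance
  have h_epi : Epi (CommRingCat.ofHom f.toRingHom) := by
    refine ⟨fun {D} g g' hg => ?_⟩
    have hg' (a : A') : g.hom (f a) = g'.hom (f a) := congrArg (fun l => l.hom a) hg
    let _ : Algebra B D := (g.hom.comp (algebraMap B A)).toAlgebra
    let ψ : A →ₐ[B] D := { g.hom with commutes' := fun _ => rfl }
    let ψ' : A →ₐ[B] D := { g'.hom with
      commutes' := fun b => by
        change g'.hom _ = g.hom _
        rw [← f.commutes, hg'] }
    ext a
    exact congrArg (fun l => l a) (h D ψ ψ' (AlgHom.ext hg'))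
  exact RingHom.surjective_of_epi_of_finite (CommRingCat.ofHom f.toRingHom) h_finite

variable {k : Type u} [CommRing k] {E : EllipticCurve k} {J : Type u}

/-- The `k`-rational point that is the value at `j` of a point over `J → k`, that is, of a family of
`k`-rational points. -/
def valueAt (t : E.Points (J → k)) (j : J) : E.Points k :=
  E.mapPoints (Pi.evalAlgHom k (fun _ => k) j) t

lemma mapPoints_ofId_valueAt (t : E.Points (J → k)) (j : J) (C : Type u) [CommRing C]
    [Algebra k C] : E.mapPoints (Algebra.ofId k C) (valueAt t j) =
      E.mapPoints ((Algebra.ofId k C).comp (Pi.evalAlgHom k (fun _ => k) j)) t :=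
  (E.mapPoints_comp _ _ _).symm

variable {m : ℕ} {t : E.Points (J → k)}

namespace IsUniversalTorsion

lemma nsmul_mapPoints {A : Type u} [CommRing A] [Algebra k A] {t : E.Points A}
    (ht : IsUniversalTorsion m t) {C : Type u} [CommRing C] [Algebra k C] (χ : A →ₐ[k] C) :
    m • E.mapPoints χ t = 0 := by
  rw [← E.mapPoints_nsmul, ht.nsmul_eq_zero, E.mapPoints_zero]

lemma valueAt_injective [Nontrivial k] (ht : IsUniversalTorsion m t) :
    Function.Injective (valueAt t) := by
  classical
  intro i j h
  have h_single := congrArg (fun χ => χ (Pi.single i 1)) (ht.hom_ext _ _ h)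
  by_contra hij
  simp [Ne.symm hij] at h_single

lemma exists_valueAt_eq [IsLocalRing k] [Finite J] (ht : IsUniversalTorsion m t) (y : E.Points k)
    (hy : m • y = 0) : ∃ j, valueAt t j = y := by
  obtain ⟨χ, rfl⟩ := ht.exists_hom y hy
  obtain ⟨i, rfl⟩ := exists_pi_algHom_eq_eval χ
  refine ⟨i, ?_⟩
  rw [← mapPoints_ofId_valueAt]
  exact (E.mapPoints_id _).symm

end IsUniversalTorsion

variable {B : Type u} [CommRing B] [Algebra k B] {G : SubgroupFunctor E B}

lemma SubgroupFunctor.Represents.idempotentsAlgHom_surjective [Fintype J] [DecidableEq J]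
    {A : Type u} [CommRing A] [Algebra k A] [Algebra B A] [IsScalarTower k B A] [Module.Finite B A]
    {χ : (J → k) →ₐ[k] A} (h : G.Represents A (E.mapPoints χ t)) :
    Function.Surjective
      (idempotentsAlgHom (B := B) (completeOrthogonalIdempotents_map_single χ)) := by
  refine surjective_of_finite_of_algHom_ext _ fun D _ _ ψ ψ' hψ => ?_
  let _ : Algebra k D := Algebra.compHom D (algebraMap k B)
  have : IsScalarTower k B D := .of_algebraMap_eq' rfl
  refine h.hom_ext D ψ ψ' ?_
  rw [EllipticCurve.specialize, EllipticCurve.specialize, ← E.mapPoints_comp, ← E.mapPoints_comp]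
  congr 1
  refine pi_algHom_ext fun j => ?_
  have h_single := DFunLike.congr_fun hψ (Pi.single j 1)
  rwa [AlgHom.comp_apply, AlgHom.comp_apply, idempotentsAlgHom_single] at h_single

/-- The subgroup functor `G` of `E_B` lies in the `m`-torsion `Spec (J → k)`, with universal point
`t`, and is cut out there by idempotents `e j` of `B`: on the copy `Spec B` of `Spec B × {j}` in
the `m`-torsion of `E_B`, it is the open and closed subscheme where `e j = 1`. -/
structure IsDescribedBy [DecidableEq J] (G : SubgroupFunctor E B) (m : ℕ) (t : E.Points (J → k))
    (e : J → B) : Prop where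
  nsmul_eq_zero : ∀ {C : Type u} [CommRing C] [Algebra k C] (φ : B →ₐ[k] C), ∀ y ∈ G.points φ,
    m • y = 0
  mem_iff : ∀ {C : Type u} [CommRing C] [Algebra k C] (φ : B →ₐ[k] C) (χ : (J → k) →ₐ[k] C),
    E.mapPoints χ t ∈ G.points φ ↔ ∀ j, φ (e j) * χ (Pi.single j 1) = χ (Pi.single j 1)
  isIdempotentElem : ∀ j, IsIdempotentElem (e j)

theorem SubgroupFunctor.Represents.exists_isDescribedBy [Finite J] [DecidableEq J]
    (ht : IsUniversalTorsion m t) {A : Type u} [CommRing A] [Algebra k A] [Algebra B A]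
    [IsScalarTower k B A] {x : E.Points A} (h : G.Represents A x) [Module.Finite B A]
    [Module.Projective B A] {N : ℕ}
    (hN : ∀ 𝔭 : PrimeSpectrum B, Module.rankAtStalk (R := B) A 𝔭 = N) (hm : N ∣ m) :
    ∃ e : J → B, IsDescribedBy G m t e ∧ (IsLocalRing B → Nat.card {j // e j = 1} = N) := by
  have := Fintype.ofFinite J
  have hx : m • x = 0 := by
    obtain ⟨c, rfl⟩ := hm
    rw [mul_comm, mul_smul, h.rank_nsmul_universal hN, smul_zero]
  obtain ⟨χ, rfl⟩ := ht.exists_hom x hx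
  have hε := completeOrthogonalIdempotents_map_single χ
  have hsurj := h.idempotentsAlgHom_surjective
  obtain ⟨e, he, h_smul⟩ := exists_idempotents_smul_eq_zero_iff hε hsurj
  refine ⟨e, ⟨fun {C} _ _ φ y hy => ?_, fun {C} _ _ φ χ' => ?_, he⟩, fun _ => ?_⟩
  · let _ : Algebra B C := φ.toRingHom.toAlgebra
    have : IsScalarTower k B C := .of_algebraMap_eq fun c => (φ.commutes c).symm
    obtain ⟨ψ, rfl⟩ := h.exists_hom C y hy
    rw [EllipticCurve.specialize, ← E.mapPoints_nsmul, hx, E.mapPoints_zero]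
  · let _ : Algebra B C := φ.toRingHom.toAlgebra
    have : IsScalarTower k B C := .of_algebraMap_eq fun c => (φ.commutes c).symm
    refine Iff.trans ⟨fun hy => ?_, ?_⟩ (exists_algHom_apply_idempotent_iff hε hsurj he h_smul
      (completeOrthogonalIdempotents_map_single χ'))
    · obtain ⟨ψ, hψ⟩ := h.exists_hom C _ hy
      rw [EllipticCurve.specialize, ← E.mapPoints_comp] at hψ
      exact ⟨ψ, fun j => DFunLike.congr_fun (ht.hom_ext _ _ hψ) _⟩
    · rintro ⟨ψ, hψ⟩
      have h_comp : χ' = (ψ.restrictScalars k).comp χ :=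
        pi_algHom_ext fun j => (hψ j).symm
      rw [h_comp, E.mapPoints_comp]
      exact G.specialize_mem h.mem ψ
  · obtain ⟨_, h_card⟩ := finrank_eq_card_idempotents hε hsurj he h_smul
    rw [← h_card, ← hN (IsLocalRing.closedPoint B), Module.rankAtStalk_eq_finrank_of_free,
      Pi.natCast_apply, Nat.cast_id]

end Described

section FiniteLocallyFree

variable {k : Type u} [CommRing k] {E : EllipticCurve k} {B : Type u} [CommRing B] [Algebra k B]
  {G : SubgroupFunctor E B} {N : ℕ}

namespace SubgroupFunctor

lemma IsFiniteLocallyFree.exists_represents (h : G.IsFiniteLocallyFree N) :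
    ∃ (A : Type u) (_ : CommRing A) (_ : Algebra k A) (_ : Algebra B A)
      (_ : IsScalarTower k B A) (x : E.Points A), Module.Finite B A ∧ Module.Projective B A ∧
      (∀ 𝔭 : PrimeSpectrum B, Module.rankAtStalk (R := B) A 𝔭 = N) ∧ G.Represents A x := by
  obtain ⟨A, _, _, _, _, h_finite, h_projective, hN, x, hx, h_rep⟩ := h
  refine ⟨A, _, _, _, _, x, h_finite, h_projective, hN, hx, ?_, ?_⟩
  · intro D _ _ _ _ y hy
    obtain ⟨ψ, ⟨hψ, hψ'⟩, -⟩ := h_rep D _ y hy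
    exact ⟨{ ψ with commutes' := DFunLike.congr_fun hψ }, hψ'⟩
  · intro D _ _ _ _ ψ ψ' h
    have h_comp (ψ : A →ₐ[B] D) : (ψ.restrictScalars k).comp (IsScalarTower.toAlgHom k B A) =
        IsScalarTower.toAlgHom k B D := AlgHom.ext ψ.commutes
    exact AlgHom.restrictScalars_injective k <|
      (h_rep D _ _ (G.specialize_mem hx ψ)).unique ⟨h_comp ψ, rfl⟩ ⟨h_comp ψ', h.symm⟩

lemma Represents.isFiniteLocallyFree {A : Type u} [CommRing A] [Algebra k A] [Algebra B A]
    [IsScalarTower k B A] {x : E.Points A} (h : G.Represents A x) [Module.Finite B A]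
    [Module.Projective B A] (hN : ∀ 𝔭 : PrimeSpectrum B, Module.rankAtStalk (R := B) A 𝔭 = N) :
    G.IsFiniteLocallyFree N := by
  refine ⟨A, _, _, _, inferInstance, inferInstance, inferInstance, hN, x, h.mem, ?_⟩
  intro C _ _ φ y hy
  let _ : Algebra B C := φ.toRingHom.toAlgebra
  have : IsScalarTower k B C := .of_algebraMap_eq fun c => (φ.commutes c).symm
  obtain ⟨ψ, hψ⟩ := h.exists_hom C y hy
  refine ⟨ψ.restrictScalars k, ⟨AlgHom.ext ψ.commutes, hψ⟩, ?_⟩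
  rintro ψ' ⟨h_comp, hψ'⟩
  exact congrArg (AlgHom.restrictScalars k) <|
    h.hom_ext C { ψ' with commutes' := DFunLike.congr_fun h_comp } ψ (hψ'.trans hψ.symm)

variable {B' : Type u} [CommRing B'] [Algebra k B']

lemma IsFiniteLocallyFree.baseChange (h : G.IsFiniteLocallyFree N) (φ : B →ₐ[k] B') :
    (G.baseChange φ).IsFiniteLocallyFree N := by
  obtain ⟨A, _, _, _, _, x, _, _, hN, h_rep⟩ := h.exists_represents
  let _ : Algebra B B' := φ.toRingHom.toAlgebra
  have : IsScalarTower k B B' := .of_algebraMap_eq fun c => (φ.commutes c).symm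
  refine (h_rep.baseChange B').isFiniteLocallyFree fun 𝔭 => ?_
  rw [Module.rankAtStalk_baseChange, hN]

end SubgroupFunctor

/-- The base change of a chain of subgroup schemes. -/
def SubgroupChain.baseChange {B' : Type u} [CommRing B'] [Algebra k B'] {q : ℕ} {N : Fin q → ℕ}
    (G : SubgroupChain E B N) (φ : B →ₐ[k] B') : SubgroupChain E B' N where
  group i := (G.group i).baseChange φ
  isFiniteLocallyFree i := (G.isFiniteLocallyFree i).baseChange φ
  mono i j h _ _ _ _ := G.mono i j h _ _

end FiniteLocallyFree

namespace IsDescribedBy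

variable {k : Type u} [CommRing k] {E : EllipticCurve k} {J : Type u} [DecidableEq J] {m : ℕ}
  {t : E.Points (J → k)} {B : Type u} [CommRing B] [Algebra k B] {G : SubgroupFunctor E B}
  {e : J → B} {B' : Type u} [CommRing B'] [Algebra k B'] {G' : SubgroupFunctor E B'} {e' : J → B'}

lemma mapPoints_valueAt_mem_iff (h : IsDescribedBy G m t e) {C : Type u} [CommRing C] [Algebra k C]
    (φ : B →ₐ[k] C) (j : J) :
    E.mapPoints (Algebra.ofId k C) (valueAt t j) ∈ G.points φ ↔ φ (e j) = 1 := by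
  rw [mapPoints_ofId_valueAt, h.mem_iff]
  refine ⟨fun h => by simpa using h j, fun h i => ?_⟩
  obtain rfl | hij := eq_or_ne j i
  · simp [h]
  · simp [hij]

lemma isBaseChange (ht : IsUniversalTorsion m t) (h : IsDescribedBy G m t e)
    (h' : IsDescribedBy G' m t e') {φ : B →ₐ[k] B'} (he : ∀ j, e' j = φ (e j)) :
    G.IsBaseChange φ G' := by
  refine fun C _ _ ψ => AddSubgroup.ext fun y => ?_
  by_cases hy : m • y = 0
  · obtain ⟨χ, rfl⟩ := ht.exists_hom y hy
    simp [h.mem_iff, h'.mem_iff, he]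
  · exact iff_of_false (fun h_mem => hy (h'.nsmul_eq_zero _ _ h_mem))
      fun h_mem => hy (h.nsmul_eq_zero _ _ h_mem)

lemma eq_of_isBaseChange (h : IsDescribedBy G m t e) (h' : IsDescribedBy G' m t e')
    {φ : B →ₐ[k] B'} (hG : G.IsBaseChange φ G') (j : J) : e' j = φ (e j) := by
  refine eq_of_forall_map_eq_one_iff (k := k) (h'.isIdempotentElem j)
    ((h.isIdempotentElem j).map φ) fun C _ _ ψ => ?_
  rw [← h'.mapPoints_valueAt_mem_iff, hG, h.mapPoints_valueAt_mem_iff, AlgHom.comp_apply]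

end IsDescribedBy

/-! ## Constant subgroup schemes -/

section ConstantSubgroup

variable {k : Type u} [CommRing k] {E : EllipticCurve k}

/-- The constant subgroup scheme of the `m`-torsion of `E` given by a group `c` of rational points:
it consists of the `m`-torsion points whose values at all residue fields lie in `c`. -/
def constSubgroup (m : ℕ) (c : AddSubgroup (E.Points k)) : SubgroupFunctor E k where
  points {C} _ _ _ := (nsmulAddMonoidHom m).ker ⊓
    ⨅ (L : Type u) (_ : Field L) (_ : Algebra k L) (ψ : C →ₐ[k] L),
      (c.map (E.mapPointsHom (Algebra.ofId k L))).comap (E.mapPointsHom ψ)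
  mapPoints_mem φ ψ x hx := by
    simp only [AddSubgroup.mem_inf, AddSubgroup.mem_iInf, AddSubgroup.mem_comap] at hx ⊢
    refine ⟨?_, fun L _ _ χ => ?_⟩
    · have h_zero := congrArg (E.mapPoints ψ) hx.1
      rwa [nsmulAddMonoidHom_apply, E.mapPoints_nsmul, E.mapPoints_zero] at h_zero
    · have h_mem : E.mapPoints (χ.comp ψ) x ∈ _ := hx.2 L ‹_› ‹_› (χ.comp ψ)
      rwa [E.mapPoints_comp] at h_mem


variable {m : ℕ} {c : AddSubgroup (E.Points k)}

lemma mem_constSubgroup_points {C : Type u} [CommRing C] [Algebra k C] {φ : k →ₐ[k] C}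
    {y : E.Points C} : y ∈ (constSubgroup m c).points φ ↔ m • y = 0 ∧
      ∀ (L : Type u) [Field L] [Algebra k L] (ψ : C →ₐ[k] L),
        ∃ g ∈ c, E.mapPoints (Algebra.ofId k L) g = E.mapPoints ψ y := by
  simp only [constSubgroup, AddSubgroup.mem_inf, AddSubgroup.mem_iInf]
  rfl

section Indicator

variable {J : Type u} {S : Set J} {C : Type u} [CommRing C] [Algebra k C]

/-- The restriction of functions on `J` to the subset `S`. -/
def restrictAlgHom (k : Type u) [CommRing k] (S : Set J) : (J → k) →ₐ[k] (S → k) :=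
  AlgHom.pi fun j => Pi.evalAlgHom k (fun _ => k) j.1

lemma restrictAlgHom_surjective : Function.Surjective (restrictAlgHom k S) :=
  Subtype.val_injective.surjective_comp_right

variable [DecidableEq J]

lemma restrictAlgHom_single_of_notMem {j : J} (hj : j ∉ S) :
    restrictAlgHom k S (Pi.single j 1) = 0 :=
  funext fun i => Pi.single_eq_of_ne (ne_of_mem_of_not_mem i.2 hj) 1

lemma exists_comp_restrictAlgHom_eq [Finite J] {χ : (J → k) →ₐ[k] C}
    (hχ : ∀ j ∉ S, χ (Pi.single j 1) = 0) :
    ∃ ψ : (S → k) →ₐ[k] C, ψ.comp (restrictAlgHom k S) = χ := by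
  have := Fintype.ofFinite J
  refine ⟨AlgHom.liftOfSurjective _ restrictAlgHom_surjective χ fun f hf => ?_,
    AlgHom.liftOfSurjective_comp ..⟩
  change χ f = 0
  rw [pi_algHom_apply]
  refine Finset.sum_eq_zero fun j _ => ?_
  by_cases hj : j ∈ S
  · rw [show f j = 0 from congrFun (RingHom.mem_ker.1 hf) ⟨j, hj⟩, zero_smul]
  · rw [hχ j hj, smul_zero]

lemma indicator_mul_eq_self_iff {χ : (J → k) →ₐ[k] C} (φ : k →ₐ[k] C) :
    (∀ j, φ (S.indicator 1 j) * χ (Pi.single j 1) = χ (Pi.single j 1)) ↔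
      ∀ j ∉ S, χ (Pi.single j 1) = 0 := by
  refine forall_congr' fun j => ?_
  by_cases hj : j ∈ S <;> simp [hj, eq_comm]

variable {t : E.Points (J → k)} {G : SubgroupFunctor E k}

lemma IsDescribedBy.isFiniteLocallyFree_card [Finite J] (ht : IsUniversalTorsion m t)
    (h : IsDescribedBy G m t (S.indicator 1)) : G.IsFiniteLocallyFree (Nat.card S) := by
  have := Fintype.ofFinite S
  refine ⟨S → k, inferInstance, inferInstance, inferInstance, inferInstance, inferInstance,
    inferInstance, fun 𝔭 => ?_, E.mapPoints (restrictAlgHom k S) t, ?_, fun C _ _ φ y hy => ?_⟩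
  · have := 𝔭.nontrivial
    rw [Module.rankAtStalk_eq_finrank_of_free, Pi.natCast_apply, Module.finrank_pi, Nat.cast_id,
      Nat.card_eq_fintype_card]
  · rw [h.mem_iff, indicator_mul_eq_self_iff]
    exact fun _ => restrictAlgHom_single_of_notMem
  · obtain ⟨χ, rfl⟩ := ht.exists_hom y (h.nsmul_eq_zero φ y hy)
    rw [h.mem_iff, indicator_mul_eq_self_iff] at hy
    obtain ⟨ψ, rfl⟩ := exists_comp_restrictAlgHom_eq hy
    refine ⟨ψ, ⟨Subsingleton.elim _ _, (E.mapPoints_comp _ _ _).symm⟩, ?_⟩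
    rintro ψ' ⟨-, hψ'⟩
    rw [← E.mapPoints_comp] at hψ'
    exact (AlgHom.cancel_right restrictAlgHom_surjective).1 (ht.hom_ext _ _ hψ')

end Indicator

end ConstantSubgroup

section Field

lemma exists_algHom_field_eq_one {k : Type*} [CommRing k] {C : Type u} [CommRing C] [Algebra k C]
    {a : C} (ha : IsIdempotentElem a) (h0 : a ≠ 0) :
    ∃ (L : Type u) (_ : Field L) (_ : Algebra k L) (ψ : C →ₐ[k] L), ψ a = 1 := by
  have h_nonunit : 1 - a ∈ nonunits C := fun h =>
    h0 (h.mul_left_eq_zero.1 (by rw [mul_sub, _root_.mul_one, ha.eq, sub_self]))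
  obtain ⟨P, _, hP⟩ := exists_max_ideal_of_mem_nonunits h_nonunit
  refine ⟨C ⧸ P, Ideal.Quotient.field P, inferInstance, Ideal.Quotient.mkₐ k P, ?_⟩
  rw [eq_comm, ← sub_eq_zero, ← map_one (Ideal.Quotient.mkₐ k P), ← map_sub]
  exact Ideal.Quotient.eq_zero_iff_mem.2 hP

variable {k : Type u} [Field k] {E : EllipticCurve k} {J : Type u} {m : ℕ} {t : E.Points (J → k)}

lemma constSubgroup_isDescribedBy [Finite J] [DecidableEq J] (ht : IsUniversalTorsion m t)
    (c : AddSubgroup (E.Points k)) :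
    IsDescribedBy (constSubgroup m c) m t ((valueAt t ⁻¹' c).indicator 1) := by
  have := Fintype.ofFinite J
  refine ⟨fun _ _ h => h.1, fun φ χ => ?_, fun j => ?_⟩
  · rw [mem_constSubgroup_points, indicator_mul_eq_self_iff]
    refine ⟨fun ⟨_, h⟩ j hj => ?_, fun h => ⟨ht.nsmul_mapPoints χ, fun L _ _ ψ => ?_⟩⟩
    · by_contra h0
      have h_idem : IsIdempotentElem (χ (Pi.single j 1)) :=
        (completeOrthogonalIdempotents_map_single χ).idem j
      obtain ⟨L, _, _, ψ, hψ⟩ := exists_algHom_field_eq_one (k := k) h_idem h0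
      obtain ⟨g, hg, hg'⟩ := h L ψ
      rw [← E.mapPoints_comp, pi_algHom_eq_eval (χ := ψ.comp χ) hψ, ← mapPoints_ofId_valueAt] at hg'
      obtain rfl := E.mapPoints_injective (Algebra.ofId k L).injective hg'
      exact hj hg
    · obtain ⟨i, hi⟩ := exists_pi_algHom_eq_eval (ψ.comp χ)
      refine ⟨valueAt t i, ?_, by rw [← E.mapPoints_comp, hi, mapPoints_ofId_valueAt]⟩
      by_contra hic
      have h_single := DFunLike.congr_fun hi (Pi.single i 1)
      simp [h i hic] at h_single
  · by_cases hj : j ∈ valueAt t ⁻¹' (c : Set (E.Points k)) <;> simp [hj, IsIdempotentElem]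

lemma card_preimage_valueAt [Finite J] (ht : IsUniversalTorsion m t) {c : AddSubgroup (E.Points k)}
    (hc : ∀ g ∈ c, m • g = 0) : Nat.card (valueAt t ⁻¹' (c : Set (E.Points k))) = Nat.card c :=
  Nat.card_preimage_of_injective ht.valueAt_injective fun g hg => ht.exists_valueAt_eq g (hc g hg)

lemma nsmul_eq_zero_of_card_dvd {X : Type*} [AddGroup X] {c : AddSubgroup X} (h : Nat.card c ∣ m)
    {g : X} (hg : g ∈ c) : m • g = 0 :=
  addOrderOf_dvd_iff_nsmul_eq_zero.1 ((c.addOrderOf_dvd_natCard hg).trans h)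

lemma constSubgroup_isFiniteLocallyFree [Finite J] (ht : IsUniversalTorsion m t)
    {c : AddSubgroup (E.Points k)} (hc : Nat.card c ∣ m) :
    (constSubgroup m c).IsFiniteLocallyFree (Nat.card c) := by
  classical
  rw [← card_preimage_valueAt ht fun g => nsmul_eq_zero_of_card_dvd hc]
  exact (constSubgroup_isDescribedBy ht c).isFiniteLocallyFree_card ht

variable {B : Type u} [CommRing B] [Algebra k B] {G : SubgroupFunctor E B} {N : ℕ}

lemma SubgroupFunctor.IsFiniteLocallyFree.exists_isDescribedBy [Finite J] [DecidableEq J]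
    (ht : IsUniversalTorsion m t) (h : G.IsFiniteLocallyFree N) (hm : N ∣ m) :
    ∃ e : J → B, IsDescribedBy G m t e ∧ (IsLocalRing B → Nat.card {j // e j = 1} = N) := by
  obtain ⟨A, _, _, _, _, x, _, _, hN, h_rep⟩ := h.exists_represents
  exact h_rep.exists_isDescribedBy ht hN hm

/-- The group of rational points of `E` that lie in the subgroup functor `G` of `E_B`. -/
def SubgroupFunctor.rationalPoints (G : SubgroupFunctor E B) : AddSubgroup (E.Points k) :=
  (G.points (AlgHom.id k B)).comap (E.mapPointsHom (Algebra.ofId k B))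

namespace SubgroupFunctor.IsFiniteLocallyFree

variable [Finite J] [IsLocalRing B] (ht : IsUniversalTorsion m t) (h : G.IsFiniteLocallyFree N)
  (hm : N ∣ m)

include ht h hm

lemma card_rationalPoints : Nat.card G.rationalPoints = N := by
  classical
  obtain ⟨e, he, h_card⟩ := h.exists_isDescribedBy ht hm
  rw [← h_card inferInstance, ← card_preimage_valueAt ht fun g hg => ?_]
  · exact Nat.card_congr (Equiv.subtypeEquivRight fun j =>
      he.mapPoints_valueAt_mem_iff (AlgHom.id k B) j)
  · refine E.mapPoints_injective (Algebra.ofId k B).injective ?_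
    rw [E.mapPoints_nsmul, E.mapPoints_zero]
    exact he.nsmul_eq_zero _ _ hg

theorem isBaseChange_constSubgroup_rationalPoints :
    (constSubgroup m G.rationalPoints).IsBaseChange (Algebra.ofId k B) G := by
  classical
  obtain ⟨e, he, -⟩ := h.exists_isDescribedBy ht hm
  refine (constSubgroup_isDescribedBy ht _).isBaseChange ht he fun j => ?_
  have h_mem : j ∈ valueAt t ⁻¹' (G.rationalPoints : Set (E.Points k)) ↔ e j = 1 :=
    he.mapPoints_valueAt_mem_iff (AlgHom.id k B) j
  obtain hj | hj := eq_zero_or_one_of_isIdempotentElem (he.isIdempotentElem j)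
  · rw [Set.indicator_of_notMem (by simp [h_mem, hj]), hj, map_zero]
  · rw [Set.indicator_of_mem (h_mem.2 hj), hj, Pi.one_apply, map_one]

end SubgroupFunctor.IsFiniteLocallyFree

end Field

/-! ## The function rings -/

/-- A chain of subgroups of `X` such that the orders of successive quotients are given by `N`. -/
@[ext]
structure AddSubgroupChain (X : Type*) [AddGroup X] {q : ℕ} (N : Fin q → ℕ) where
  /-- The subgroups of the chain. -/
  group : Fin q → AddSubgroup X
  card_group : ∀ i, Nat.card (group i) = Fin.partialProd N i.succ
  monotone : Monotone group

section FunctionRing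

variable {k : Type u} [Field k] {E : EllipticCurve k} {J : Type u} {m : ℕ} {t : E.Points (J → k)}
  {q : ℕ} {N : Fin q → ℕ}

section ConstChain

variable [Finite J] (ht : IsUniversalTorsion m t) (hN : ∀ i : Fin q, Fin.partialProd N i.succ ∣ m)

/-- The chain of constant subgroup schemes given by a chain of groups of rational points. -/
def constChain (c : AddSubgroupChain (E.Points k) N) : SubgroupChain E k N where
  group i := constSubgroup m (c.group i)
  isFiniteLocallyFree i := by
    rw [← c.card_group]
    exact constSubgroup_isFiniteLocallyFree ht (c.card_group i ▸ hN i)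
  mono i j h C _ _ φ y := by
    simp only [mem_constSubgroup_points]
    exact And.imp_right fun hy L _ _ ψ => (hy L ψ).imp fun _ => And.imp_left fun hg =>
      c.monotone h hg

/-- Evaluation of functions on the moduli problem at the chains of constant subgroup schemes. -/
def evalConst : functionRing E N →ₗ[k] (AddSubgroupChain (E.Points k) N → k) where
  toFun f c := f.1 (CommAlgCat.of k k) (constChain ht hN c)
  map_add' _ _ := rfl
  map_smul' _ _ := rfl

lemma exists_apply_eq_algebraMap_evalConst {B : Type u} [CommRing B] [Algebra k B] [IsLocalRing B]
    (f : functionRing E N) (G : SubgroupChain E B N) :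
    ∃ c, f.1 (CommAlgCat.of k B) G = algebraMap k B (evalConst ht hN f c) := by
  let c : AddSubgroupChain (E.Points k) N :=
    { group := fun i => (G.group i).rationalPoints
      card_group := fun i => (G.isFiniteLocallyFree i).card_rationalPoints ht (hN i)
      monotone := fun i j hij _ hg => G.mono i j hij _ _ hg }
  exact ⟨c, f.2 (CommAlgCat.of k k) (CommAlgCat.of k B) (Algebra.ofId k B) (constChain ht hN c) G
    fun i => (G.isFiniteLocallyFree i).isBaseChange_constSubgroup_rationalPoints ht (hN i)⟩

lemma evalConst_injective : Function.Injective (evalConst ht hN) := by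
  rw [injective_iff_map_eq_zero]
  refine fun f hf => Subtype.ext (funext fun B => funext fun G => ?_)
  refine Module.eq_zero_of_localization_maximal (R := B) (fun P _ => Localization.AtPrime P)
    (fun P _ => Algebra.linearMap B (Localization.AtPrime P)) (f.1 B G) fun P _ => ?_
  let φ : B →ₐ[k] Localization.AtPrime P := IsScalarTower.toAlgHom k B (Localization.AtPrime P)
  obtain ⟨c, hc⟩ := exists_apply_eq_algebraMap_evalConst ht hN f (G.baseChange φ)
  rw [hf, Pi.zero_apply, map_zero] at hc
  exact (f.2 B (CommAlgCat.of k (Localization.AtPrime P)) φ G (G.baseChange φ)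
    fun _ _ _ _ _ => rfl).symm.trans hc

include ht hN

lemma AddSubgroupChain.ext_valueAt {c c' : AddSubgroupChain (E.Points k) N}
    (h : ∀ i j, valueAt t j ∈ c.group i ↔ valueAt t j ∈ c'.group i) : c = c' := by
  have h_exists (c : AddSubgroupChain (E.Points k) N) {i g} (hg : g ∈ c.group i) :
      ∃ j, valueAt t j = g :=
    ht.exists_valueAt_eq g (nsmul_eq_zero_of_card_dvd (c.card_group i ▸ hN i) hg)
  ext i g
  refine ⟨fun hg => ?_, fun hg => ?_⟩
  · obtain ⟨j, rfl⟩ := h_exists c hg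
    exact (h i j).1 hg
  · obtain ⟨j, rfl⟩ := h_exists c' hg
    exact (h i j).2 hg

lemma AddSubgroupChain.finite : Finite (AddSubgroupChain (E.Points k) N) :=
  Finite.of_injective (fun c (i : Fin q) => {j | valueAt t j ∈ c.group i}) fun _ _ h =>
    AddSubgroupChain.ext_valueAt ht hN fun i => Set.ext_iff.1 (congrFun h i)

end ConstChain

section Idempotent

variable [Fintype J] [DecidableEq J] (ht : IsUniversalTorsion m t)
  (hN : ∀ i : Fin q, Fin.partialProd N i.succ ∣ m)
  {B : Type u} [CommRing B] [Algebra k B] {B' : Type u} [CommRing B'] [Algebra k B']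

/-- The idempotents describing the subgroup schemes of the chain `G`. -/
def SubgroupChain.idempotent (G : SubgroupChain E B N) (i : Fin q) : J → B :=
  ((G.isFiniteLocallyFree i).exists_isDescribedBy ht (hN i)).choose

lemma SubgroupChain.isDescribedBy_idempotent (G : SubgroupChain E B N) (i : Fin q) :
    IsDescribedBy (G.group i) m t (G.idempotent ht hN i) :=
  ((G.isFiniteLocallyFree i).exists_isDescribedBy ht (hN i)).choose_spec.1

lemma idempotent_constChain (c : AddSubgroupChain (E.Points k) N) (i : Fin q) :
    (constChain ht hN c).idempotent ht hN i =
      (valueAt t ⁻¹' (c.group i : Set (E.Points k))).indicator 1 :=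
  funext fun j => (constSubgroup_isDescribedBy ht (c.group i)).eq_of_isBaseChange
    ((constChain ht hN c).isDescribedBy_idempotent ht hN i) (φ := AlgHom.id k k)
    (fun _ _ _ _ => rfl) j

open Classical in
/-- The idempotent of `B` that is `1` exactly where the chain `G` is the constant chain given
by `c`. -/
def chainIdempotent (c : AddSubgroupChain (E.Points k) N) (G : SubgroupChain E B N) : B :=
  ∏ i, ∏ j, if valueAt t j ∈ c.group i then G.idempotent ht hN i j
    else 1 - G.idempotent ht hN i j

lemma chainIdempotent_eq_of_isBaseChange (c : AddSubgroupChain (E.Points k) N)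
    {G : SubgroupChain E B N} {G' : SubgroupChain E B' N} {φ : B →ₐ[k] B'}
    (h : ∀ i, (G.group i).IsBaseChange φ (G'.group i)) :
    chainIdempotent ht hN c G' = φ (chainIdempotent ht hN c G) := by
  have h_idem (i j) : G'.idempotent ht hN i j = φ (G.idempotent ht hN i j) :=
    (G.isDescribedBy_idempotent ht hN i).eq_of_isBaseChange (G'.isDescribedBy_idempotent ht hN i)
      (h i) j
  simp only [chainIdempotent, h_idem, map_prod, apply_ite φ, map_sub, map_one]

open Classical in
lemma chainIdempotent_constChain (c c' : AddSubgroupChain (E.Points k) N) :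
    chainIdempotent ht hN c (constChain ht hN c') = if c = c' then 1 else 0 := by
  simp only [chainIdempotent, idempotent_constChain]
  split_ifs with h
  · subst h
    refine Finset.prod_eq_one fun i _ => Finset.prod_eq_one fun j _ => ?_
    by_cases hj : valueAt t j ∈ c.group i <;> simp [hj]
  · obtain ⟨i, j, hij⟩ : ∃ i j, ¬(valueAt t j ∈ c.group i ↔ valueAt t j ∈ c'.group i) := by
      by_contra! h_iff
      exact h (AddSubgroupChain.ext_valueAt ht hN h_iff)
    refine Finset.prod_eq_zero (Finset.mem_univ i) (Finset.prod_eq_zero (Finset.mem_univ j) ?_)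
    by_cases hj : valueAt t j ∈ c.group i <;> simp_all

end Idempotent

variable [Finite J] (ht : IsUniversalTorsion m t) (hN : ∀ i : Fin q, Fin.partialProd N i.succ ∣ m)

lemma evalConst_surjective : Function.Surjective (evalConst ht hN) := by
  classical
  have := Fintype.ofFinite J
  have := AddSubgroupChain.finite ht hN
  have := Fintype.ofFinite (AddSubgroupChain (E.Points k) N)
  intro v
  refine ⟨⟨fun B G => ∑ c, v c • chainIdempotent ht hN c G, fun B B' φ G G' h => ?_⟩,
    funext fun c => ?_⟩
  · simp only [map_sum, map_smul, chainIdempotent_eq_of_isBaseChange ht hN _ h]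
  · change ∑ c', v c' • chainIdempotent ht hN c' (constChain ht hN c) = v c
    simp [chainIdempotent_constChain]

/-- The function ring of the moduli problem is the ring of functions on the set of chains of groups
of rational points. -/
def functionRingEquiv : functionRing E N ≃ₗ[k] (AddSubgroupChain (E.Points k) N → k) :=
  LinearEquiv.ofBijective (evalConst ht hN) ⟨evalConst_injective ht hN, evalConst_surjective ht hN⟩

end FunctionRing

/-! ## The differentials of the two complexes -/

section Complexes

variable {P : Type u} [PartialOrder P]

open Classical in
/-- The face of a simplex opposite to a vertex, in a degree that is only propositionally one less;
this avoids casts between the degrees `(q + 1 : ℕ) - 2` and `(q - 2) + 1`. -/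
def Simplices.faceOf {i j : ℤ} (h : j + 1 = i) (s : Simplices P i) (x : P) (hx : x ∈ s.1) :
    Simplices P j :=
  Simplices.face (h ▸ s) x (by subst h; exact hx)

open Classical in
lemma Simplices.faceOf_val {i j : ℤ} (h : j + 1 = i) (s : Simplices P i) (x : P) (hx : x ∈ s.1) :
    (s.faceOf h x hx).1 = s.1.erase x := by
  subst h
  rfl

lemma Simplices.isEmpty_of_lt {q : ℤ} (h : q < -1) : IsEmpty (Simplices P q) :=
  ⟨fun s => by have := s.2.2; omega⟩

lemma reducedChains_d_single {i j : ℤ} (h : j + 1 = i) (s : Simplices P i) :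
    ((reducedChains P).d i j).hom (Finsupp.single s 1 : Simplices P i →₀ ℤ) =
      (∑ x : {x // x ∈ s.1}, (-1 : ℤ) ^ position s.1 x.1 •
        Finsupp.single (s.faceOf h x.1 x.2) 1 : Simplices P j →₀ ℤ) := by
  subst h
  have hd : (reducedChains P).d (j + 1) j = ModuleCat.ofHom (boundary P j) :=
    ChainComplex.of_d (fun q => ModuleCat.of ℤ (Simplices P q →₀ ℤ))
      (fun q => ModuleCat.ofHom (boundary P q)) j
  rw [hd]
  exact boundary_single P s

lemma reducedChains_d_d {i j l : ℤ} (x : (reducedChains P).X i) :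
    ((reducedChains P).d j l).hom (((reducedChains P).d i j).hom x) = 0 :=
  congrArg (fun g => g.hom x) ((reducedChains P).d_comp_d i j l)

variable (R : Type w) [CommRing R] (G : Type u) [AddCommGroup G]
  (M : Type v) [AddCommGroup M] [Module R M]

lemma homComplex_d_apply (q : ℕ)
    (f : (reducedChains (ProperSubgroups G)).X ((q : ℤ) - 2) →ₗ[ℤ] M) :
    ((homComplex R G M).d q (q + 1)).hom f =
      (f ∘ₗ ((reducedChains (ProperSubgroups G)).d (((q + 1 : ℕ) : ℤ) - 2) ((q : ℤ) - 2)).hom :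
        (reducedChains (ProperSubgroups G)).X (((q + 1 : ℕ) : ℤ) - 2) →ₗ[ℤ] M) :=
  congrArg (fun g => g.hom f) (CochainComplex.of_d
    (fun q : ℕ => ModuleCat.of R
      ((reducedChains (ProperSubgroups G)).X ((q : ℤ) - 2) →ₗ[ℤ] M)) _ q)

lemma complexD_eq_homComplex [Nontrivial G] : complexD R G M = homComplex R G M :=
  if_neg (not_subsingleton G)

lemma complexD_eq_single [Subsingleton G] : complexD R G M =
    (CochainComplex.single₀ (ModuleCat.{max u v} R)).obj (ModuleCat.of R (ULift.{u} M)) :=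
  if_pos ‹_›

end Complexes

/-! ## Chains of subgroups as flags -/

section PartialProd

variable {q : ℕ}

lemma partialProd_strictMono {n : Fin q → ℕ} (hn : ∀ i, 1 < n i) :
    StrictMono (Fin.partialProd n) := by
  have h_pos (i) : 0 < Fin.partialProd n i := by
    induction i using Fin.induction with
    | zero => simp only [Fin.partialProd_zero, zero_lt_one]
    | succ i ih =>
      rw [Fin.partialProd_succ]
      exact Nat.mul_pos ih (zero_lt_one.trans (hn i))
  refine Fin.strictMono_iff_lt_succ.2 fun i => ?_
  rw [Fin.partialProd_succ]
  exact lt_mul_of_one_lt_right (h_pos _) (hn i)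

lemma one_lt_of_partialProd_strictMono {n : Fin q → ℕ} (hn : StrictMono (Fin.partialProd n))
    (i : Fin q) : 1 < n i := by
  have h := hn (Fin.castSucc_lt_succ (i := i))
  rw [Fin.partialProd_succ] at h
  exact Nat.lt_of_mul_lt_mul_left (by rwa [_root_.mul_one])

lemma exists_partialProd_eq {a : Fin (q + 1) → ℕ} (h_zero : a 0 = 1)
    (h_dvd : ∀ i : Fin q, a i.castSucc ∣ a i.succ) : ∃ n : Fin q → ℕ, Fin.partialProd n = a := by
  refine ⟨fun i => a i.succ / a i.castSucc, funext fun i => ?_⟩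
  induction i using Fin.induction with
  | zero => rw [Fin.partialProd_zero, h_zero]
  | succ i ih => rw [Fin.partialProd_succ, ih, Nat.mul_div_cancel' (h_dvd i)]

lemma partialProd_last (n : Fin q → ℕ) : Fin.partialProd n (Fin.last q) = ∏ i, n i := by
  simp [Fin.partialProd, List.prod_ofFn, List.take_of_length_le]

lemma partialProd_dvd_prod (n : Fin q → ℕ) (i : Fin (q + 1)) :
    Fin.partialProd n i ∣ ∏ i, n i := by
  rw [← partialProd_last]
  induction i using Fin.reverseInduction with
  | last => exact dvd_rfl
  | cast j ih => exact (Fin.partialProd_succ n j ▸ dvd_mul_right _ _).trans ih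

lemma Factorizations.partialProd_dvd {N : ℕ} (n : Factorizations q N) (i : Fin (q + 1)) :
    Fin.partialProd n.1 i ∣ N :=
  (partialProd_dvd_prod n.1 i).trans n.2.2.dvd

end PartialProd

lemma exists_strictMono_range_eq {α : Type*} [PartialOrder α] {t : Finset α}
    (ht : IsChain (· ≤ ·) (t : Set α)) {q : ℕ} (hq : t.card = q) :
    ∃ c : Fin q → α, StrictMono c ∧ Set.range c = t := by
  classical
  -- An arbitrary linear extension of the order sorts the chain.
  let T : Finset (LinearExtension α) := t
  obtain ⟨f, hf, hr⟩ : ∃ f : Fin q → LinearExtension α, StrictMono f ∧ Set.range f = T :=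
    ⟨T.orderEmbOfFin hq, (T.orderEmbOfFin hq).strictMono, T.range_orderEmbOfFin hq⟩
  have h_mem (i) : f i ∈ (T : Set (LinearExtension α)) := hr ▸ Set.mem_range_self i
  refine ⟨f, fun i j hij => ?_, hr⟩
  have h := hf hij
  refine lt_of_le_of_ne (α := α) ((ht.total (h_mem i) (h_mem j)).resolve_right fun h' => ?_) h.ne
  exact not_le_of_gt h ((toLinearExtension (α := α)).monotone (a := f j) (b := f i) h')

section Flags

variable {X : Type u} [AddCommGroup X]

/-- The proper nontrivial subgroups of a subgroup `G` of `X`, regarded as subgroups of `X`. -/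
def properSubgroupsEmbedding (G : AddSubgroup X) : ProperSubgroups G ↪o AddSubgroup X where
  toFun K := K.1.map G.subtype
  inj' _ _ h := Subtype.ext (AddSubgroup.map_injective G.subtype_injective h)
  map_rel_iff' := AddSubgroup.map_le_map_iff_of_injective G.subtype_injective

lemma range_properSubgroupsEmbedding (G : AddSubgroup X) :
    Set.range (properSubgroupsEmbedding G) = Set.Ioo ⊥ G := by
  have h_top : (⊤ : AddSubgroup G).map G.subtype = G := by
    rw [← AddMonoidHom.range_eq_map, AddSubgroup.range_subtype]
  ext H
  constructor
  · rintro ⟨K, rfl⟩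
    refine ⟨bot_lt_iff_ne_bot.2 fun h => K.2.1 ?_,
      lt_of_le_of_ne (AddSubgroup.map_subtype_le _) fun h => K.2.2 ?_⟩
    · exact AddSubgroup.map_injective G.subtype_injective (h.trans (AddSubgroup.map_bot _).symm)
    · exact AddSubgroup.map_injective G.subtype_injective (h.trans h_top.symm)
  · rintro ⟨h_bot, h_lt⟩
    have h_map : (H.addSubgroupOf G).map G.subtype = H :=
      AddSubgroup.map_addSubgroupOf_eq_of_le h_lt.le
    refine ⟨⟨H.addSubgroupOf G, fun h => h_bot.ne' ?_, fun h => h_lt.ne ?_⟩, h_map⟩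
    · rw [← h_map, h, AddSubgroup.map_bot]
    · rw [← h_map, h, h_top]

lemma properSubgroupsEmbedding_mem_Ioo {G : AddSubgroup X} (K : ProperSubgroups G) :
    properSubgroupsEmbedding G K ∈ Set.Ioo ⊥ G :=
  range_properSubgroupsEmbedding G ▸ Set.mem_range_self K

/-- The tuple `c` lists `G` and the subgroups of `G` that belong to the simplex `s`. -/
def IsFlagOf {q : ℕ} (c : Fin q → AddSubgroup X) (G : AddSubgroup X)
    (s : Finset (ProperSubgroups G)) : Prop :=
  Set.range c = insert G (properSubgroupsEmbedding G '' s)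

section

variable {q : ℕ} {c : Fin q → AddSubgroup X} {G G' : AddSubgroup X}
  {s s' : Finset (ProperSubgroups G)}

lemma IsFlagOf.eq_or_mem (h : IsFlagOf c G s) (i : Fin q) :
    c i = G ∨ ∃ K ∈ s, properSubgroupsEmbedding G K = c i := by
  have h_mem : c i ∈ Set.range c := Set.mem_range_self i
  rwa [h] at h_mem

lemma IsFlagOf.exists_eq_embedding (h : IsFlagOf c G s) {K : ProperSubgroups G} (hK : K ∈ s) :
    ∃ i, c i = properSubgroupsEmbedding G K := by
  have h_mem : properSubgroupsEmbedding G K ∈ Set.range c :=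
    h ▸ Set.mem_insert_of_mem _ ⟨K, hK, rfl⟩
  exact h_mem

lemma IsFlagOf.exists_eq (h : IsFlagOf c G s) : ∃ i, c i = G := by
  have h_mem : G ∈ Set.range c := h ▸ Set.mem_insert _ _
  exact h_mem

lemma IsFlagOf.le (h : IsFlagOf c G s) (i : Fin q) : c i ≤ G := by
  obtain hi | ⟨K, -, hi⟩ := h.eq_or_mem i
  · exact hi.le
  · exact hi ▸ (properSubgroupsEmbedding_mem_Ioo K).2.le

lemma IsFlagOf.ne_bot (h : IsFlagOf c G s) (hG : G ≠ ⊥) (i : Fin q) : c i ≠ ⊥ := by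
  obtain hi | ⟨K, -, hi⟩ := h.eq_or_mem i
  · exact hi ▸ hG
  · exact hi ▸ (properSubgroupsEmbedding_mem_Ioo K).1.ne'

lemma IsFlagOf.group_unique {s' : Finset (ProperSubgroups G')} (h : IsFlagOf c G s)
    (h' : IsFlagOf c G' s') : G = G' := by
  obtain ⟨i, hi⟩ := h.exists_eq
  obtain ⟨i', hi'⟩ := h'.exists_eq
  exact le_antisymm (hi ▸ h'.le i) (hi' ▸ h.le i')

lemma IsFlagOf.simplex_unique (h : IsFlagOf c G s) (h' : IsFlagOf c G s') : s = s' := by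
  have h_notMem (s : Finset (ProperSubgroups G)) : G ∉ properSubgroupsEmbedding G '' s := by
    rintro ⟨K, -, hK⟩
    exact (properSubgroupsEmbedding_mem_Ioo K).2.ne hK
  have h_image : properSubgroupsEmbedding G '' s = properSubgroupsEmbedding G '' s' := by
    rw [← Set.insert_sdiff_self_of_notMem (h_notMem s),
      ← Set.insert_sdiff_self_of_notMem (h_notMem s'), ← h, ← h']
  exact Finset.coe_injective ((properSubgroupsEmbedding G).injective.image_injective h_image)

lemma IsFlagOf.last {c : Fin (q + 1) → AddSubgroup X} (h : IsFlagOf c G s) (hc : Monotone c) :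
    c (Fin.last q) = G := by
  obtain ⟨i, hi⟩ := h.exists_eq
  exact le_antisymm (h.le _) (hi ▸ hc (Fin.le_last i))

lemma IsFlagOf.exists_partialProd_eq [Finite G] (h : IsFlagOf c G s) (hc : StrictMono c)
    (hG : G ≠ ⊥) : ∃ n : Factorizations q (Nat.card G),
      ∀ i, Nat.card (c i) = Fin.partialProd n.1 i.succ := by
  obtain _ | q := q
  · exact h.exists_eq.choose.elim0
  have h_finite (i) : Finite (c i) :=
    Finite.of_injective _ (AddSubgroup.inclusion_injective (h.le i))
  let a : Fin (q + 2) → ℕ := Fin.cons 1 fun i => Nat.card (c i)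
  have h_dvd : ∀ i : Fin (q + 1), a i.castSucc ∣ a i.succ :=
    Fin.cases (one_dvd _) fun i => AddSubgroup.card_dvd_of_le (hc.monotone (Fin.castSucc_le_succ i))
  have h_lt : StrictMono a := Fin.strictMono_iff_lt_succ.2 <|
    Fin.cases ((AddSubgroup.one_lt_card_iff_ne_bot _).2 (h.ne_bot hG 0)) fun i =>
      lt_of_le_of_ne (Nat.le_of_dvd Nat.card_pos (h_dvd i.succ)) fun h_eq =>
        (hc (Fin.castSucc_lt_succ (i := i))).ne
          (AddSubgroup.eq_of_le_of_card_ge (hc.monotone (Fin.castSucc_le_succ i)) h_eq.ge)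
  obtain ⟨n, hn⟩ := IsogenyComplex.exists_partialProd_eq (a := a) rfl h_dvd
  refine ⟨⟨n, one_lt_of_partialProd_strictMono (hn ▸ h_lt), ?_⟩, fun i => ?_⟩
  · rw [← partialProd_last, hn, ← h.last hc.monotone]
    rfl
  · rw [hn]
    rfl

lemma exists_isFlagOf_of_isChain (hs : IsChain (· ≤ ·) (s : Set (ProperSubgroups G)))
    (hq : s.card + 1 = q) : ∃ c : Fin q → AddSubgroup X, StrictMono c ∧ IsFlagOf c G s := by
  classical
  let t : Finset (AddSubgroup X) := insert G (s.map (properSubgroupsEmbedding G).toEmbedding)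
  have h_card : t.card = q := by
    rw [Finset.card_insert_of_notMem, Finset.card_map, hq]
    intro h
    obtain ⟨K, -, hK⟩ := Finset.mem_map.1 h
    exact (properSubgroupsEmbedding_mem_Ioo K).2.ne hK
  have h_coe : (t : Set (AddSubgroup X)) = insert G (properSubgroupsEmbedding G '' s) := by
    rw [Finset.coe_insert, Finset.coe_map]
    rfl
  have ht : IsChain (· ≤ ·) (t : Set (AddSubgroup X)) := by
    rw [h_coe]
    refine IsChain.insert ((properSubgroupsEmbedding G).monotone.isChain_image hs) ?_
    rintro _ ⟨K, -, rfl⟩ -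
    exact Or.inr (properSubgroupsEmbedding_mem_Ioo K).2.le
  obtain ⟨c, hc, h_range⟩ := exists_strictMono_range_eq ht h_card
  exact ⟨c, hc, h_range.trans h_coe⟩

end

section

variable {q : ℕ} {c : Fin (q + 1) → AddSubgroup X}

lemma exists_isFlagOf (hc : StrictMono c) (h_bot : ∀ i, c i ≠ ⊥) :
    ∃ s : Finset (ProperSubgroups (c (Fin.last q))),
      IsChain (· ≤ ·) (s : Set (ProperSubgroups (c (Fin.last q)))) ∧ s.card = q ∧
        IsFlagOf c (c (Fin.last q)) s := by
  classical
  have h_mem (i : Fin q) :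
      c i.castSucc ∈ Set.range (properSubgroupsEmbedding (c (Fin.last q))) := by
    rw [range_properSubgroupsEmbedding]
    exact ⟨bot_lt_iff_ne_bot.2 (h_bot _), hc (Fin.castSucc_lt_last i)⟩
  choose K hK using h_mem
  have hK_mono : StrictMono K := fun i j hij => by
    rw [← (properSubgroupsEmbedding _).lt_iff_lt, hK, hK]
    exact hc (Fin.castSucc_lt_castSucc_iff.2 hij)
  refine ⟨Finset.univ.map ⟨K, hK_mono.injective⟩, ?_, ?_, ?_⟩
  · simp only [Finset.coe_map, Function.Embedding.coeFn_mk, Finset.coe_univ, Set.image_univ]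
    exact hK_mono.monotone.isChain_range
  · rw [Finset.card_map, Finset.card_univ, Fintype.card_fin]
  · have h_image : properSubgroupsEmbedding _ '' Set.range K = Set.range (c ∘ Fin.castSucc) := by
      rw [← Set.range_comp]
      exact congrArg Set.range (funext hK)
    rw [IsFlagOf, Finset.coe_map, Finset.coe_univ, Set.image_univ, Function.Embedding.coeFn_mk,
      h_image]
    ext H
    simp only [Set.mem_range, Set.mem_insert_iff, Fin.exists_fin_succ', Function.comp_apply]
    rw [or_comm, eq_comm]

variable {G : AddSubgroup X} {s : Finset (ProperSubgroups G)}

lemma IsFlagOf.exists_vertex (h : IsFlagOf c G s) (hc : StrictMono c) (i : Fin q) :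
    ∃ K : {x // x ∈ s}, properSubgroupsEmbedding G K.1 = c i.castSucc := by
  obtain hi | ⟨K, hK, hi⟩ := h.eq_or_mem i.castSucc
  · exact absurd (hi.trans (h.last hc.monotone).symm) (hc (Fin.castSucc_lt_last i)).ne
  · exact ⟨⟨K, hK⟩, hi⟩

/-- The `i`-th vertex of the simplex belonging to a flag. -/
def IsFlagOf.vertex (h : IsFlagOf c G s) (hc : StrictMono c) (i : Fin q) : {x // x ∈ s} :=
  (h.exists_vertex hc i).choose

lemma IsFlagOf.embedding_vertex (h : IsFlagOf c G s) (hc : StrictMono c) (i : Fin q) :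
    properSubgroupsEmbedding G (h.vertex hc i).1 = c i.castSucc :=
  (h.exists_vertex hc i).choose_spec

lemma IsFlagOf.strictMono_vertex (h : IsFlagOf c G s) (hc : StrictMono c) :
    StrictMono (h.vertex hc) := fun i j hij => by
  rw [← Subtype.coe_lt_coe, ← (properSubgroupsEmbedding G).lt_iff_lt, h.embedding_vertex hc,
    h.embedding_vertex hc]
  exact hc (Fin.castSucc_lt_castSucc_iff.2 hij)

lemma IsFlagOf.vertex_bijective (h : IsFlagOf c G s) (hc : StrictMono c) :
    Function.Bijective (h.vertex hc) := by
  refine ⟨(h.strictMono_vertex hc).injective, fun x => ?_⟩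
  obtain ⟨j, hj⟩ := h.exists_eq_embedding x.2
  obtain ⟨i, rfl⟩ | rfl := j.eq_castSucc_or_eq_last
  · refine ⟨i, Subtype.ext ((properSubgroupsEmbedding G).injective ?_)⟩
    rw [h.embedding_vertex hc, hj]
  · exact absurd (hj.symm.trans (h.last hc.monotone)) (properSubgroupsEmbedding_mem_Ioo x.1).2.ne

lemma IsFlagOf.position_vertex (h : IsFlagOf c G s) (hc : StrictMono c) (i : Fin q) :
    position s (h.vertex hc i).1 = i := by
  classical
  rw [← Fin.card_Iio i, position]
  symm
  refine Finset.card_bij (fun j _ => (h.vertex hc j).1) (fun j hj => ?_) (fun j _ j' _ hj => ?_)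
    fun x hx => ?_
  · exact Finset.mem_filter.2
      ⟨(h.vertex hc j).2, h.strictMono_vertex hc (Finset.mem_Iio.1 hj)⟩
  · exact (h.vertex_bijective hc).1 (Subtype.ext hj)
  · obtain ⟨hx_mem, hx_lt⟩ := Finset.mem_filter.1 hx
    obtain ⟨j, hj⟩ := (h.vertex_bijective hc).2 ⟨x, hx_mem⟩
    refine ⟨j, Finset.mem_Iio.2 ((h.strictMono_vertex hc).lt_iff_lt.1 ?_), congrArg Subtype.val hj⟩
    rw [hj]
    exact hx_lt

lemma IsFlagOf.face [DecidableEq (ProperSubgroups G)] (h : IsFlagOf c G s) (hc : StrictMono c)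
    (i : Fin q) : IsFlagOf (c ∘ i.castSucc.succAbove) G (s.erase (h.vertex hc i).1) := by
  unfold IsFlagOf
  rw [Set.range_comp, Fin.range_succAbove, Set.image_compl_eq_range_sdiff_image hc.injective, h,
    Set.image_singleton, ← h.embedding_vertex hc i, Finset.coe_erase,
    Set.image_sdiff (properSubgroupsEmbedding G).injective, Set.image_singleton]
  exact Set.insert_sdiff_of_notMem _ fun h' => (properSubgroupsEmbedding_mem_Ioo _).2.ne' h'

end

end Flags

/-! ## Comparison of the isogeny complex with the complexes of subgroups -/

section Comparison

namespace AddSubgroupChain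

variable {X : Type u} [AddCommGroup X] {N q : ℕ}

lemma strictMono {n : Factorizations q N} (c : AddSubgroupChain X n.1) : StrictMono c.group :=
  c.monotone.strictMono_of_injective fun i j h => by
    have h_card := c.card_group i
    rw [h, c.card_group] at h_card
    exact Fin.succ_injective _ ((partialProd_strictMono n.2.1).injective h_card).symm

lemma ne_bot {n : Factorizations q N} (c : AddSubgroupChain X n.1) (i : Fin q) :
    c.group i ≠ ⊥ := fun h => by
  have h_lt := partialProd_strictMono n.2.1 (Fin.succ_pos i)
  rw [Fin.partialProd_zero, ← c.card_group, h, AddSubgroup.card_bot] at h_lt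
  exact lt_irrefl _ h_lt

/-- Forgetting one group, but not the last one. -/
def forget {n : Factorizations (q + 1) N} (c : AddSubgroupChain X n.1) (i : Fin q) :
    AddSubgroupChain X (n.merge i).1 where
  group := c.group ∘ i.castSucc.succAbove
  card_group j := by
    rw [Function.comp_apply, c.card_group, Factorizations.merge, Fin.partialProd_contractNth,
      Function.comp_apply, Fin.succ_succAbove_succ]
  monotone := c.monotone.comp (Fin.strictMono_succAbove _).monotone

variable (hN : 1 < N)
include hN

lemma existsUnique_isFlagOf (c : Σ n : Factorizations q N, AddSubgroupChain X n.1) :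
    ∃! s : Σ G : {G : AddSubgroup X // Nat.card G = N},
      Simplices (ProperSubgroups G.1) ((q : ℤ) - 2), IsFlagOf c.2.group s.1.1 s.2.1 := by
  obtain ⟨n, c⟩ := c
  refine existsUnique_of_exists_of_unique ?_ ?_
  · obtain _ | q := q
    · exact absurd n.2.2 (by simpa using hN.ne)
    · obtain ⟨s, h_chain, h_card, hs⟩ := exists_isFlagOf c.strictMono c.ne_bot
      have h_last : Nat.card (c.group (Fin.last q)) = N := by
        rw [c.card_group, Fin.succ_last, partialProd_last, n.2.2]
      exact ⟨⟨⟨_, h_last⟩, ⟨s, h_chain, by push_cast; omega⟩⟩, hs⟩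
  · rintro ⟨⟨G, hG⟩, s⟩ ⟨⟨G', hG'⟩, s'⟩ h h'
    obtain rfl : G = G' := h.group_unique h'
    obtain rfl : s = s' := Subtype.ext (h.simplex_unique h')
    rfl

lemma existsUnique_of_simplex (s : Σ G : {G : AddSubgroup X // Nat.card G = N},
      Simplices (ProperSubgroups G.1) ((q : ℤ) - 2)) :
    ∃! c : Σ n : Factorizations q N, AddSubgroupChain X n.1,
      IsFlagOf c.2.group s.1.1 s.2.1 := by
  obtain ⟨⟨G, rfl⟩, s⟩ := s
  refine existsUnique_of_exists_of_unique ?_ ?_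
  · have : Finite G := Nat.finite_of_card_ne_zero (by omega)
    obtain ⟨c, hc, hs⟩ := exists_isFlagOf_of_isChain (q := q) s.2.1 (by have := s.2.2; omega)
    obtain ⟨n, hn⟩ := hs.exists_partialProd_eq hc ((AddSubgroup.one_lt_card_iff_ne_bot G).1 hN)
    exact ⟨⟨n, c, hn, hc.monotone⟩, hs⟩
  · rintro ⟨n, c⟩ ⟨n', c'⟩ h h'
    have h_group : c.group = c'.group :=
      (StrictMono.range_inj c.strictMono c'.strictMono).1 (Eq.trans h (Eq.symm h'))
    obtain rfl : n = n' := by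
      refine Subtype.ext (eq_of_partialProd_eq n.2.1 (funext (Fin.cases ?_ fun i => ?_)))
      · rw [Fin.partialProd_zero, Fin.partialProd_zero]
      · rw [← c.card_group, ← c'.card_group, h_group]
    rw [AddSubgroupChain.ext h_group]

/-- A chain of subgroups `G₁ ⊂ ⋯ ⊂ G_q` with `G_q` of order `N` corresponds to the simplex
`{G₁, …, G_{q-1}}` of proper nontrivial subgroups of `G_q`. -/
def flagEquiv : (Σ n : Factorizations q N, AddSubgroupChain X n.1) ≃
    (Σ G : {G : AddSubgroup X // Nat.card G = N},
      Simplices (ProperSubgroups G.1) ((q : ℤ) - 2)) where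
  toFun c := (existsUnique_isFlagOf hN c).choose
  invFun s := (existsUnique_of_simplex hN s).choose
  left_inv c := (existsUnique_of_simplex hN _).unique (existsUnique_of_simplex hN _).choose_spec.1
    (existsUnique_isFlagOf hN c).choose_spec.1
  right_inv s := (existsUnique_isFlagOf hN _).unique (existsUnique_isFlagOf hN _).choose_spec.1
    (existsUnique_of_simplex hN s).choose_spec.1

lemma isFlagOf_flagEquiv_symm (s : Σ G : {G : AddSubgroup X // Nat.card G = N},
      Simplices (ProperSubgroups G.1) ((q : ℤ) - 2)) :
    IsFlagOf ((flagEquiv hN).symm s).2.group s.1.1 s.2.1 :=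
  (existsUnique_of_simplex hN s).choose_spec.1

lemma flagEquiv_symm_eq {c : Σ n : Factorizations q N, AddSubgroupChain X n.1}
    {s : Σ G : {G : AddSubgroup X // Nat.card G = N},
      Simplices (ProperSubgroups G.1) ((q : ℤ) - 2)}
    (h : IsFlagOf c.2.group s.1.1 s.2.1) : (flagEquiv hN).symm s = c :=
  (existsUnique_of_simplex hN s).unique (isFlagOf_flagEquiv_symm hN s) h

end AddSubgroupChain

variable {k : Type u} [Field k] {E : EllipticCurve k} {N q : ℕ} {J : Type u} [Finite J]
  {t : E.Points (J → k)} (ht : IsUniversalTorsion N t)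

/-- Cochains of the isogeny complex are functions on the chains of groups of rational points. -/
def cochainEquiv (q : ℕ) : IsogenyCochains E N q ≃ₗ[k]
    ((Σ n : Factorizations q N, AddSubgroupChain (E.Points k) n.1) → k) :=
  (LinearEquiv.piCongrRight fun n : Factorizations q N =>
      functionRingEquiv ht fun i => n.partialProd_dvd i.succ).trans
    (LinearEquiv.piCurry k
      fun (n : Factorizations q N) (_ : AddSubgroupChain (E.Points k) n.1) => k).symm

variable (hN : 1 < N)

/-- Cochains of the isogeny complex are families of cochains on the posets of proper nontrivial
subgroups. The sign is the discrepancy between the coboundaries, since the first group of a chain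
has index `1` in the isogeny complex and index `0` in a simplex. -/
def comparisonEquiv (q : ℕ) : IsogenyCochains E N q ≃ₗ[k]
    (∀ G : {G : AddSubgroup (E.Points k) // Nat.card G = N},
      (Simplices (ProperSubgroups G.1) ((q : ℤ) - 2) →₀ ℤ) →ₗ[ℤ] k) :=
  ((cochainEquiv ht q).trans (LinearEquiv.smulOfUnit ((-1 : kˣ) ^ q))).trans <|
    (LinearEquiv.funCongrLeft k k (AddSubgroupChain.flagEquiv hN).symm).trans <|
    (LinearEquiv.piCurry k fun (G : {G : AddSubgroup (E.Points k) // Nat.card G = N})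
      (_ : Simplices (ProperSubgroups G.1) ((q : ℤ) - 2)) => k).trans <|
    LinearEquiv.piCongrRight fun _ => Finsupp.llift k ℤ k _

lemma comparisonEquiv_apply_single (f : IsogenyCochains E N q)
    {G : {G : AddSubgroup (E.Points k) // Nat.card G = N}}
    {s : Simplices (ProperSubgroups G.1) ((q : ℤ) - 2)} {n : Factorizations q N}
    {c : AddSubgroupChain (E.Points k) n.1} (h : IsFlagOf c.group G.1 s.1) :
    comparisonEquiv ht hN q f G (Finsupp.single s 1) = (-1) ^ q *
      (f n).1 (CommAlgCat.of k k) (constChain ht (fun i => n.partialProd_dvd i.succ) c) := by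
  have h_apply : comparisonEquiv ht hN q f G (Finsupp.single s 1) = ((-1 : kˣ) ^ q) •
      cochainEquiv ht q f ((AddSubgroupChain.flagEquiv hN).symm ⟨G, s⟩) := by
    simp only [comparisonEquiv, LinearEquiv.trans_apply, LinearEquiv.piCongrRight_apply,
      LinearEquiv.funCongrLeft_apply, Finsupp.llift_apply, Finsupp.lift_apply,
      Finsupp.sum_single_index, zero_smul, one_smul]
    rfl
  rw [h_apply, AddSubgroupChain.flagEquiv_symm_eq hN (c := ⟨n, c⟩) h, Units.smul_def,
    Units.val_pow_eq_pow_val, Units.val_neg, Units.val_one, smul_eq_mul]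
  rfl

lemma comparisonEquiv_coboundary (f : IsogenyCochains E N q)
    (G : {G : AddSubgroup (E.Points k) // Nat.card G = N}) :
    comparisonEquiv ht hN (q + 1) (coboundary E N q f) G =
      comparisonEquiv ht hN q f G ∘ₗ ((reducedChains (ProperSubgroups G.1)).d
        (((q + 1 : ℕ) : ℤ) - 2) ((q : ℤ) - 2)).hom := by
  classical
  refine Finsupp.lhom_ext' fun s => LinearMap.ext_ring ?_
  have hq : ((q : ℤ) - 2) + 1 = ((q + 1 : ℕ) : ℤ) - 2 := by push_cast; ring
  obtain ⟨⟨n, c⟩, (h : IsFlagOf c.group G.1 s.1), -⟩ :=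
    AddSubgroupChain.existsUnique_of_simplex hN ⟨G, s⟩
  change comparisonEquiv ht hN (q + 1) (coboundary E N q f) G (Finsupp.single s 1) =
    comparisonEquiv ht hN q f G (((reducedChains (ProperSubgroups G.1)).d
      (((q + 1 : ℕ) : ℤ) - 2) ((q : ℤ) - 2)).hom (Finsupp.single s 1 : Simplices _ _ →₀ ℤ))
  rw [comparisonEquiv_apply_single ht hN _ h, coboundary_apply, reducedChains_d_single hq,
    Finset.mul_sum]
  refine Eq.trans ?_ (map_sum (comparisonEquiv ht hN q f G) _ _).symm
  refine Fintype.sum_bijective (h.vertex c.strictMono) (h.vertex_bijective c.strictMono) _ _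
    fun i => ?_
  have h_face : IsFlagOf (c.forget i).group G.1 (s.faceOf hq _ (h.vertex c.strictMono i).2).1 := by
    rw [Simplices.faceOf_val]
    convert h.face c.strictMono i
    rfl
  rw [map_zsmul, h.position_vertex c.strictMono, comparisonEquiv_apply_single ht hN _ h_face]
  change (-1 : k) ^ (q + 1) * ((-1 : k) ^ ((i : ℕ) + 1) *
    (f (n.merge i)).1 (CommAlgCat.of k k)
      (constChain ht (fun j => (n.merge i).partialProd_dvd j.succ) (c.forget i))) = _
  rw [zsmul_eq_mul]
  push_cast
  ring

end Comparison

/-! ## Exactness of complexes of chains in a poset -/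

section ExactAt

variable {α : Type u} [PartialOrder α]

open Classical in
/-- The simplicial boundary on formal combinations of finite subsets of a poset. -/
def finsetBoundary : (Finset α →₀ ℤ) →ₗ[ℤ] (Finset α →₀ ℤ) :=
  Finsupp.lift _ ℤ _ fun s => ∑ x ∈ s, (-1 : ℤ) ^ position s x • Finsupp.single (s.erase x) 1

/-- The formal combinations of chains with `m` elements, all of them in `Q`. -/
def chainsIn (Q : Set α) (m : ℕ) : Submodule ℤ (Finset α →₀ ℤ) :=
  Finsupp.supported ℤ ℤ {s | IsChain (· ≤ ·) (s : Set α) ∧ (s : Set α) ⊆ Q ∧ s.card = m}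

/-- The augmented chain complex of the order complex of `Q` is exact at the chains with `m`
elements. -/
def ExactAt (Q : Set α) (m : ℕ) : Prop :=
  ∀ z ∈ chainsIn Q m, finsetBoundary z = 0 → ∃ w ∈ chainsIn Q (m + 1), finsetBoundary w = z

variable {Q Q' A B : Set α} {m : ℕ} {z : Finset α →₀ ℤ}

lemma finsetBoundary_single [DecidableEq α] (s : Finset α) : finsetBoundary (Finsupp.single s 1) =
    ∑ x ∈ s, (-1 : ℤ) ^ position s x • (Finsupp.single (s.erase x) 1 : Finset α →₀ ℤ) := by
  simp only [finsetBoundary, Finsupp.lift_apply, Finsupp.sum_single_index, zero_smul, one_smul]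
  congr!

lemma finsetBoundary_single_apply [DecidableEq α] (s t : Finset α) :
    finsetBoundary (Finsupp.single s 1) t =
      ∑ x ∈ s, if s.erase x = t then (-1 : ℤ) ^ position s x else 0 := by
  simp only [finsetBoundary_single, Finsupp.finsetSum_apply, Finsupp.smul_apply,
    Finsupp.single_apply, smul_eq_mul, mul_ite, _root_.mul_one, mul_zero]

lemma finsetBoundary_apply (z : Finset α →₀ ℤ) (t : Finset α) :
    finsetBoundary z t = ∑ s ∈ z.support, z s * finsetBoundary (Finsupp.single s 1) t := by
  conv_lhs => rw [← Finsupp.sum_single z, Finsupp.sum, map_sum, Finsupp.finsetSum_apply]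
  refine Finset.sum_congr rfl fun s _ => ?_
  rw [← Finsupp.smul_single_one, map_smul, Finsupp.smul_apply, smul_eq_mul]

lemma chainsIn_mono (h : Q ⊆ Q') : chainsIn Q m ≤ chainsIn Q' m :=
  Finsupp.supported_mono fun _ hs => ⟨hs.1, hs.2.1.trans h, hs.2.2⟩

lemma chainsIn_inf_chainsIn : chainsIn A m ⊓ chainsIn B m = chainsIn (A ∩ B) m := by
  rw [chainsIn, chainsIn, ← Finsupp.supported_inter, chainsIn]
  congr 1
  ext s
  simp only [Set.mem_inter_iff, Set.mem_ofPred_eq, Set.subset_inter_iff]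
  tauto

lemma chainsIn_induction {S : Submodule ℤ (Finset α →₀ ℤ)}
    (h : ∀ s : Finset α, IsChain (· ≤ ·) (s : Set α) → (s : Set α) ⊆ Q → s.card = m →
      Finsupp.single s 1 ∈ S) : chainsIn Q m ≤ S := by
  rw [chainsIn, Finsupp.supported_eq_span_single, Submodule.span_le]
  rintro _ ⟨s, ⟨h_chain, h_sub, h_card⟩, rfl⟩
  exact h s h_chain h_sub h_card

lemma exists_finset_mem_chainsIn (hz : z ∈ chainsIn Q m) :
    ∃ T : Finset α, (T : Set α) ⊆ Q ∧ z ∈ chainsIn (T : Set α) m := by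
  classical
  refine ⟨z.support.biUnion id, fun x hx => ?_, fun s hs => ?_⟩
  · obtain ⟨s, hs, hxs⟩ := Finset.mem_biUnion.1 (Finset.mem_coe.1 hx)
    exact (hz hs).2.1 hxs
  · exact ⟨(hz hs).1, fun x hx => Finset.mem_coe.2 (Finset.mem_biUnion.2 ⟨s, hs, hx⟩), (hz hs).2.2⟩

lemma finsetBoundary_mem_chainsIn (hz : z ∈ chainsIn Q (m + 1)) :
    finsetBoundary z ∈ chainsIn Q m := by
  classical
  suffices chainsIn Q (m + 1) ≤ (chainsIn Q m).comap finsetBoundary from this hz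
  refine chainsIn_induction fun s h_chain h_sub h_card => ?_
  rw [Submodule.mem_comap, finsetBoundary_single]
  refine Submodule.sum_mem _ fun x hx => Submodule.smul_mem _ _ ?_
  refine Finsupp.single_mem_supported ℤ _ ⟨h_chain.mono ?_, Set.Subset.trans ?_ h_sub, ?_⟩
  · exact Finset.coe_subset.2 (s.erase_subset x)
  · exact Finset.coe_subset.2 (s.erase_subset x)
  · rw [Finset.card_erase_of_mem hx, h_card, Nat.add_sub_cancel]

lemma finsetBoundary_eq_zero (hz : z ∈ chainsIn Q 0) : finsetBoundary z = 0 := by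
  classical
  suffices chainsIn Q 0 ≤ LinearMap.ker finsetBoundary from this hz
  refine chainsIn_induction fun s _ _ h_card => ?_
  rw [LinearMap.mem_ker, finsetBoundary_single, Finset.card_eq_zero.1 h_card, Finset.sum_empty]

section Simplices

variable {P : Type v} [PartialOrder P] (f : P ↪o α)

/-- The chains of the order complex of `P` as formal combinations of finite subsets of a poset that
contains `P`. -/
def chainsToFinsets (j : ℤ) : (Simplices P j →₀ ℤ) →ₗ[ℤ] (Finset α →₀ ℤ) :=
  Finsupp.lmapDomain ℤ ℤ fun s => s.1.map f.toEmbedding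

lemma chainsToFinsets_injective (j : ℤ) : Function.Injective (chainsToFinsets f j) :=
  Finsupp.mapDomain_injective fun _ _ h => Subtype.ext (Finset.map_injective _ h)

lemma range_chainsToFinsets {j : ℤ} (hj : j + 1 = m) :
    LinearMap.range (chainsToFinsets f j) = chainsIn (Set.range f) m := by
  rw [LinearMap.range_eq_map, ← Finsupp.supported_univ, chainsToFinsets,
    Finsupp.lmapDomain_supported, Set.image_univ, chainsIn]
  congr 1
  ext t
  constructor
  · rintro ⟨⟨s, h_chain, h_card⟩, rfl⟩
    refine ⟨?_, ?_, ?_⟩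
    · rw [Finset.coe_map]
      exact f.monotone.isChain_image h_chain
    · rw [Finset.coe_map]
      exact Set.image_subset_range _ _
    · exact (Finset.card_map _).trans (by rw [← Nat.cast_inj (R := ℤ), h_card, hj])
  · rintro ⟨h_chain, h_sub, h_card⟩
    obtain ⟨s, rfl⟩ : ∃ s : Finset P, s.map f.toEmbedding = t := by
      classical
      obtain ⟨s, -, hs⟩ := Finset.subset_set_image_iff.1 (Set.image_univ ▸ h_sub)
      exact ⟨s, (Finset.map_eq_image _ _).trans hs⟩
    refine ⟨⟨s, fun x hx y hy _ => ?_, by rw [hj, ← h_card, Finset.card_map]⟩, rfl⟩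
    have h_mem {x} (hx : x ∈ s) := Finset.mem_coe.2 (Finset.mem_map_of_mem f.toEmbedding hx)
    exact (h_chain.total (h_mem hx) (h_mem hy)).imp f.le_iff_le.1 f.le_iff_le.1

lemma finsetBoundary_chainsToFinsets {i j : ℤ} (h : j + 1 = i) (x : Simplices P i →₀ ℤ) :
    finsetBoundary (chainsToFinsets f i x) =
      chainsToFinsets f j (((reducedChains P).d i j).hom x) := by
  classical
  suffices finsetBoundary ∘ₗ chainsToFinsets f i =
      chainsToFinsets f j ∘ₗ ((reducedChains P).d i j).hom from congrArg (fun g => g x) this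
  refine Finsupp.lhom_ext' fun s => LinearMap.ext_ring ?_
  change finsetBoundary (chainsToFinsets f i (Finsupp.single s 1)) = chainsToFinsets f j
    (((reducedChains P).d i j).hom (Finsupp.single s 1 : Simplices P i →₀ ℤ))
  rw [reducedChains_d_single h]
  refine Eq.trans ?_ (map_sum (chainsToFinsets f j) _ _).symm
  simp only [map_zsmul, chainsToFinsets, Finsupp.lmapDomain_apply, Finsupp.mapDomain_single]
  rw [finsetBoundary_single, Finset.sum_map, ← Finset.sum_attach, Finset.univ_eq_attach]
  refine Finset.sum_congr rfl fun x _ => ?_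
  have h_position : position (s.1.map f.toEmbedding) (f x.1) = position s.1 x.1 := by
    simp only [position]
    rw [Finset.filter_map, Finset.card_map]
    simp only [Function.comp_def, RelEmbedding.coe_toEmbedding, f.lt_iff_lt]
  have h_erase : (s.1.map f.toEmbedding).erase (f x.1) =
      (s.faceOf h x.1 x.2).1.map f.toEmbedding := by
    rw [Simplices.faceOf_val, Finset.map_erase]
    congr!
  rw [RelEmbedding.coe_toEmbedding, h_position, h_erase]

lemma ExactAt.exists_reducedChains_d_eq {f : P ↪o α} (h : ExactAt (Set.range f) m) {i j l : ℤ}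
    (hm : j + 1 = m) (hij : j + 1 = i) (hjl : l + 1 = j) {z : Simplices P j →₀ ℤ}
    (hz : ((reducedChains P).d j l).hom z = 0) :
    ∃ y : Simplices P i →₀ ℤ, ((reducedChains P).d i j).hom y = z := by
  obtain ⟨w, hw, h_eq⟩ := h (chainsToFinsets f j z) (range_chainsToFinsets f hm ▸ ⟨z, rfl⟩)
    (by rw [finsetBoundary_chainsToFinsets f hjl, hz]; exact map_zero _)
  rw [← range_chainsToFinsets f (j := i) (by push_cast; omega)] at hw
  obtain ⟨y, rfl⟩ := hw
  exact ⟨y, chainsToFinsets_injective f j (by rw [← finsetBoundary_chainsToFinsets f hij, h_eq])⟩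

end Simplices

lemma finsetBoundary_finsetBoundary (hz : z ∈ chainsIn Q m) :
    finsetBoundary (finsetBoundary z) = 0 := by
  have h_range : Set.range (RelEmbedding.refl (α := α) (· ≤ ·)) = Set.univ := Set.range_id
  have hz_univ := chainsIn_mono (Set.subset_univ Q) hz
  rw [← h_range, ← range_chainsToFinsets _ (sub_add_cancel (m : ℤ) 1)] at hz_univ
  obtain ⟨x, rfl⟩ := hz_univ
  rw [finsetBoundary_chainsToFinsets _ (sub_add_cancel _ 1)]
  refine (finsetBoundary_chainsToFinsets _ (sub_add_cancel _ 1) _).trans ?_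
  refine (congrArg (chainsToFinsets _ _) (reducedChains_d_d x)).trans ?_
  exact map_zero (chainsToFinsets _ _)

lemma ExactAt.union_of_inter (hA : ExactAt A m) (hB : ExactAt B m)
    (hAB : ∀ l, l + 1 = m → ExactAt (A ∩ B) l)
    (h_chain : ∀ s : Finset α, IsChain (· ≤ ·) (s : Set α) → (s : Set α) ⊆ A ∪ B →
      (s : Set α) ⊆ A ∨ (s : Set α) ⊆ B) : ExactAt (A ∪ B) m := by
  classical
  intro z hz hz_cycle
  obtain ⟨a, ha, b, hb, rfl⟩ : ∃ a ∈ chainsIn A m, ∃ b ∈ chainsIn B m, a + b = z := by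
    refine Submodule.mem_sup.1 ((?_ : chainsIn (A ∪ B) m ≤ chainsIn A m ⊔ chainsIn B m) hz)
    refine chainsIn_induction fun s hs h_sub h_card => ?_
    obtain h | h := h_chain s hs h_sub
    · exact Submodule.mem_sup_left (Finsupp.single_mem_supported ℤ _ ⟨hs, h, h_card⟩)
    · exact Submodule.mem_sup_right (Finsupp.single_mem_supported ℤ _ ⟨hs, h, h_card⟩)
  rw [map_add] at hz_cycle
  obtain ⟨c, hc, h_eq⟩ : ∃ c ∈ chainsIn (A ∩ B) m, finsetBoundary c = finsetBoundary a := by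
    obtain _ | l := m
    · exact ⟨0, zero_mem _, by rw [map_zero, finsetBoundary_eq_zero ha]⟩
    · refine hAB l rfl _ ?_ (finsetBoundary_finsetBoundary ha)
      refine chainsIn_inf_chainsIn.le ⟨finsetBoundary_mem_chainsIn ha, ?_⟩
      rw [eq_neg_of_add_eq_zero_left hz_cycle]
      exact neg_mem (finsetBoundary_mem_chainsIn hb)
  obtain ⟨v, hv, hv_eq⟩ := hA (a - c) (sub_mem ha (chainsIn_mono Set.inter_subset_left hc))
    (by rw [map_sub, h_eq, sub_self])
  obtain ⟨w, hw, hw_eq⟩ := hB (b + c) (add_mem hb (chainsIn_mono Set.inter_subset_right hc))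
    (by rw [map_add, h_eq, add_comm, hz_cycle])
  refine ⟨v + w, add_mem (chainsIn_mono Set.subset_union_left hv)
    (chainsIn_mono Set.subset_union_right hw), ?_⟩
  rw [map_add, hv_eq, hw_eq]
  abel

lemma eq_zero_of_finsetBoundary_eq_zero {c : α} (hz : ∀ s ∈ z.support, c ∈ s)
    (hz_cycle : finsetBoundary z = 0) : z = 0 := by
  classical
  rw [← Finsupp.support_eq_empty, Finset.eq_empty_iff_forall_notMem]
  intro s hs
  have h_coeff : z s * (-1) ^ position s c = 0 := by
    have h := finsetBoundary_apply z (s.erase c)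
    rw [hz_cycle, Finsupp.zero_apply, Finset.sum_eq_single_of_mem s hs,
      finsetBoundary_single_apply, Finset.sum_eq_single_of_mem c (hz s hs), if_pos rfl] at h
    · exact h.symm
    · exact fun x hx hxc => if_neg fun h_eq => hxc ((Finset.erase_inj s hx).1 h_eq)
    · intro t ht hts
      rw [finsetBoundary_single_apply, Finset.sum_eq_zero, mul_zero]
      refine fun x _ => if_neg fun h_eq => hts ?_
      obtain rfl : c = x := by
        by_contra hcx
        exact Finset.notMem_erase c s (h_eq ▸ Finset.mem_erase.2 ⟨hcx, hz t ht⟩)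
      rw [← Finset.insert_erase (hz t ht), h_eq, Finset.insert_erase (hz s hs)]
  exact Finsupp.mem_support_iff.1 hs
    ((mul_eq_zero.1 h_coeff).resolve_right (pow_ne_zero _ (by norm_num)))

section Cone

variable {c : α} (hc : c ∈ Q) (h : ∀ x ∈ Q, x ≤ c ∨ c ≤ x)
include hc h

lemma chainsIn_le_sup_of_cone : chainsIn Q m ≤
    chainsIn Q m ⊓ Finsupp.supported ℤ ℤ {s | c ∈ s} ⊔ (chainsIn Q (m + 1)).map finsetBoundary := by
  classical
  refine chainsIn_induction fun s hs h_sub h_card => ?_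
  set S := chainsIn Q m ⊓ Finsupp.supported ℤ ℤ {s | c ∈ s} ⊔
    (chainsIn Q (m + 1)).map finsetBoundary
  have h_mem {t : Finset α} (ht : IsChain (· ≤ ·) (t : Set α)) (ht_sub : (t : Set α) ⊆ Q)
      (ht_card : t.card = m) (hct : c ∈ t) : Finsupp.single t 1 ∈ S :=
    Submodule.mem_sup_left (Submodule.mem_inf.2
      ⟨Finsupp.single_mem_supported ℤ _ ⟨ht, ht_sub, ht_card⟩,
        Finsupp.single_mem_supported ℤ (s := {s | c ∈ s}) _ hct⟩)
  by_cases hcs : c ∈ s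
  · exact h_mem hs h_sub h_card hcs
  have ht : IsChain (· ≤ ·) (insert c s : Set α) := hs.insert fun x hx _ => (h x (h_sub hx)).symm
  have ht_sub : (insert c s : Set α) ⊆ Q := Set.insert_subset hc h_sub
  rw [← Finset.coe_insert] at ht ht_sub
  have ht_card : (insert c s).card = m + 1 := by rw [Finset.card_insert_of_notMem hcs, h_card]
  have h_faces : ∑ x ∈ s, (-1 : ℤ) ^ position (insert c s) x •
      Finsupp.single ((insert c s).erase x) 1 ∈ S := by
    refine Submodule.sum_mem _ fun x hx => Submodule.smul_mem _ _ ?_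
    have h_coe := Finset.coe_subset.2 ((insert c s).erase_subset x)
    refine h_mem (ht.mono h_coe) (h_coe.trans ht_sub) ?_
      (Finset.mem_erase.2 ⟨fun h => hcs (h ▸ hx), Finset.mem_insert_self c s⟩)
    rw [Finset.card_erase_of_mem (Finset.mem_insert_of_mem hx), ht_card, Nat.add_sub_cancel]
  have h_boundary : finsetBoundary (Finsupp.single (insert c s) 1) ∈ S :=
    Submodule.mem_sup_right (Submodule.mem_map_of_mem
      (Finsupp.single_mem_supported ℤ _ ⟨ht, ht_sub, ht_card⟩))
  rw [finsetBoundary_single, Finset.sum_insert hcs, Finset.erase_insert hcs,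
    Submodule.add_mem_iff_left _ h_faces] at h_boundary
  rwa [Submodule.smul_mem_iff_of_isUnit] at h_boundary
  exact isUnit_neg_one.pow _

lemma exactAt_of_cone : ExactAt Q m := by
  intro z hz hz_cycle
  obtain ⟨y, ⟨-, hy⟩, _, ⟨w, hw, rfl⟩, rfl⟩ :=
    Submodule.mem_sup.1 (chainsIn_le_sup_of_cone hc h hz)
  rw [map_add, finsetBoundary_finsetBoundary hw, add_zero] at hz_cycle
  exact ⟨w, hw, by rw [eq_zero_of_finsetBoundary_eq_zero hy hz_cycle, zero_add]⟩

end Cone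

lemma ExactAt.insert_of_link {b : α} (hQ : ExactAt Q m)
    (h_link : ∀ l, l + 1 = m → ExactAt {x ∈ Q | x < b ∨ b < x} l) : ExactAt (insert b Q) m := by
  by_cases hb : b ∈ Q
  · rwa [Set.insert_eq_of_mem hb]
  have h_union : Q ∪ insert b {x ∈ Q | x < b ∨ b < x} = insert b Q := by
    rw [Set.union_insert, Set.union_eq_self_of_subset_right (Set.sep_subset _ _)]
  have h_inter : Q ∩ insert b {x ∈ Q | x < b ∨ b < x} = {x ∈ Q | x < b ∨ b < x} := by
    rw [Set.inter_insert_of_notMem hb, Set.inter_eq_right.2 (Set.sep_subset _ _)]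
  rw [← h_union]
  refine hQ.union_of_inter (exactAt_of_cone (Set.mem_insert _ _) ?_) (h_inter.symm ▸ h_link)
    fun s hs h_sub => ?_
  · rintro x (rfl | ⟨-, hx | hx⟩)
    exacts [Or.inl le_rfl, Or.inl hx.le, Or.inr hx.le]
  by_cases hbs : b ∈ s
  · refine Or.inr fun x hx => or_iff_not_imp_left.2 fun hxb => ⟨?_, ?_⟩
    · exact Set.mem_of_mem_insert_of_ne (h_union ▸ h_sub hx) hxb
    · exact (hs.total hx hbs).imp (lt_of_le_of_ne · hxb) (lt_of_le_of_ne · (Ne.symm hxb))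
  · refine Or.inl fun x hx => Set.mem_of_mem_insert_of_ne (h_union ▸ h_sub hx) ?_
    rintro rfl
    exact hbs hx

lemma ExactAt.induction_insert {Q₀ : Set α} (h₀ : ExactAt Q₀ m) (h_sub : Q₀ ⊆ Q)
    (h_insert : ∀ b ∈ Q \ Q₀, ∀ Q', Q₀ ⊆ Q' → Q' ⊆ Q → (∀ x ∈ Q', b < x → x ∈ Q₀) →
      ExactAt Q' m → ExactAt (insert b Q') m) : ExactAt Q m := by
  classical
  have h_finite (n : ℕ) (T : Finset α) (h_card : T.card = n) (hT : (T : Set α) ⊆ Q \ Q₀) :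
      ExactAt (Q₀ ∪ T) m := by
    induction n generalizing T with
    | zero => rwa [Finset.card_eq_zero.1 h_card, Finset.coe_empty, Set.union_empty]
    | succ n ih =>
      obtain ⟨b, hb⟩ := T.exists_maximal (Finset.card_pos.1 (by omega))
      have h_erase := (Finset.coe_subset.2 (T.erase_subset b)).trans hT
      rw [← Finset.insert_erase hb.1, Finset.coe_insert, Set.union_insert]
      refine h_insert b (hT hb.1) _ Set.subset_union_left
        (Set.union_subset h_sub (h_erase.trans Set.sdiff_subset)) ?_
        (ih _ (by rw [Finset.card_erase_of_mem hb.1, h_card, Nat.add_sub_cancel]) h_erase)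
      rintro x (hx | hx) hbx
      · exact hx
      · exact absurd hbx (hb.not_gt (Finset.mem_of_mem_erase hx))
  intro z hz hz_cycle
  obtain ⟨T, hT, hz_mem⟩ := exists_finset_mem_chainsIn hz
  have hT_filter : (T : Set α) ⊆ Q₀ ∪ (T.filter (· ∉ Q₀) : Finset α) := fun x hx =>
    or_iff_not_imp_left.2 fun h => Finset.mem_filter.2 ⟨hx, h⟩
  obtain ⟨w, hw, h_eq⟩ := h_finite _ (T.filter (· ∉ Q₀)) rfl
    (fun x hx => ⟨hT (Finset.mem_filter.1 hx).1, (Finset.mem_filter.1 hx).2⟩) z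
    (chainsIn_mono hT_filter hz_mem) hz_cycle
  exact ⟨w, chainsIn_mono (Set.union_subset h_sub
    fun x hx => hT (Finset.mem_filter.1 hx).1) hw, h_eq⟩

end ExactAt

section Lattice

variable {α : Type u} [Lattice α] [OrderBot α] {a x : α} {m : ℕ}

lemma exactAt_setOf_sup_ne (ha : a ≠ ⊥) (hax : a < x) :
    ExactAt {y ∈ Set.Ioo ⊥ x | y ⊔ a ≠ x} m := by
  have h_sub : Set.Ico a x ⊆ {y ∈ Set.Ioo ⊥ x | y ⊔ a ≠ x} := fun y hy =>
    ⟨⟨(bot_lt_iff_ne_bot.2 ha).trans_le hy.1, hy.2⟩, by rw [sup_of_le_left hy.1]; exact hy.2.ne⟩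
  have h_cone : ExactAt (Set.Ico a x) m :=
    exactAt_of_cone (Set.left_mem_Ico.2 hax) fun y hy => Or.inr hy.1
  refine h_cone.induction_insert h_sub
    fun b ⟨⟨hb, hb_sup⟩, hba⟩ Q' h_le _ h_gt hQ' => hQ'.insert_of_link fun l _ => ?_
  have h_lt : b < b ⊔ a := left_lt_sup.2 fun h => hba ⟨h, hb.2⟩
  refine exactAt_of_cone (c := b ⊔ a)
    ⟨h_le ⟨le_sup_right, lt_of_le_of_ne (_root_.sup_le hb.2.le hax.le) hb_sup⟩, Or.inr h_lt⟩ ?_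
  rintro y ⟨hy, hyb | hby⟩
  · exact Or.inl (hyb.trans h_lt).le
  · exact Or.inr (_root_.sup_le hby.le (h_gt y hy hby).1)

lemma exactAt_Ioo_of_sup_ne (ha : a ≠ ⊥) (hax : a < x) (h : ∀ y < x, y ⊔ a ≠ x) :
    ExactAt (Set.Ioo ⊥ x) m := by
  have h_eq : {y ∈ Set.Ioo ⊥ x | y ⊔ a ≠ x} = Set.Ioo ⊥ x :=
    Set.sep_eq_self_iff_mem_true.2 fun y hy => h y hy.2
  exact h_eq ▸ exactAt_setOf_sup_ne ha hax

lemma covBy_of_sup_eq [IsModularLattice α] {y : α} (ha : IsAtom a) (hy : y < x)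
    (h : y ⊔ a = x) : y ⋖ x := by
  have h_not_le : ¬ a ≤ y := fun h_le => hy.ne (h ▸ (sup_of_le_left h_le).symm)
  rw [← h, sup_comm]
  exact covBy_sup_of_inf_covBy_left ((ha.not_le_iff_disjoint.1 h_not_le).eq_bot ▸ ha.bot_covBy)

lemma exactAt_Ioo_of_lt_rank [IsModularLattice α] [IsAtomic α] {ρ : α → ℕ} (h_bot : ρ ⊥ = 0)
    (h_atom : ∀ ⦃a⦄, IsAtom a → ∀ y, ρ (y ⊔ a) ≤ ρ y + 1) (hm : m + 1 < ρ x) :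
    ExactAt (Set.Ioo ⊥ x) m := by
  induction m using Nat.strong_induction_on generalizing x with
  | _ m ih =>
  obtain rfl | ⟨a, ha, h_le⟩ := eq_bot_or_exists_atom_le x
  · omega
  have hax : a < x := lt_of_le_of_ne h_le fun h => by
    have h_rank := h_atom ha ⊥
    rw [bot_sup_eq, h] at h_rank
    omega
  refine (exactAt_setOf_sup_ne ha.1 hax).induction_insert (Set.sep_subset _ _)
    fun b ⟨hb, hb_notMem⟩ Q' h_sub h_le' _ hQ' => hQ'.insert_of_link fun l hl => ?_
  have h_sup : b ⊔ a = x := by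
    by_contra h
    exact hb_notMem ⟨hb, h⟩
  have hbx := covBy_of_sup_eq ha hb.2 h_sup
  have h_link : {y ∈ Q' | y < b ∨ b < y} = Set.Ioo ⊥ b := by
    ext y
    constructor
    · rintro ⟨hy, hyb | hby⟩
      · exact ⟨(h_le' hy).1, hyb⟩
      · exact absurd (h_le' hy).2 (hbx.2 hby)
    · exact fun hy => ⟨h_sub ⟨⟨hy.1, hy.2.trans hb.2⟩, fun h =>
        (covBy_of_sup_eq ha (hy.2.trans hb.2) h).2 hy.2 hb.2⟩, Or.inl hy.2⟩
  rw [h_link]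
  exact ih l (by omega) (by have h_rank := h_sup ▸ h_atom ha b; omega)

end Lattice

/-! ## Subgroups of finite abelian `p`-groups -/

section PGroups

variable {G : Type u} [AddCommGroup G]

lemma eq_top_of_sup_range_nsmul_eq_top {m n : ℕ} (hG : ∀ g : G, m ^ n • g = 0) {y : AddSubgroup G}
    (h : y ⊔ (nsmulAddMonoidHom m).range = ⊤) : y = ⊤ := by
  have h_pow (i : ℕ) (g : G) : ∃ g', g - m ^ i • g' ∈ y := by
    induction i with
    | zero => exact ⟨g, by rw [pow_zero, one_nsmul, sub_self]; exact zero_mem y⟩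
    | succ i ih =>
      obtain ⟨g', hg'⟩ := ih
      obtain ⟨a, ha, _, ⟨b, rfl⟩, rfl⟩ := AddSubgroup.mem_sup.1 (h ▸ AddSubgroup.mem_top g')
      refine ⟨b, ?_⟩
      have h_add := add_mem hg' (nsmul_mem ha (m ^ i))
      rwa [smul_add, nsmulAddMonoidHom_apply, ← mul_nsmul', ← pow_succ, sub_add_eq_sub_sub_swap,
        sub_add_cancel] at h_add
  refine AddSubgroup.eq_top_iff' y |>.2 fun g => ?_
  obtain ⟨g', hg'⟩ := h_pow n g
  rwa [hG, sub_zero] at hg'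

lemma range_subtype_properSubgroups : Set.range (OrderEmbedding.subtype
    fun H : AddSubgroup G => H ≠ ⊥ ∧ H ≠ ⊤) = Set.Ioo ⊥ ⊤ := by
  ext H
  simp only [OrderEmbedding.coe_subtype, Subtype.range_coe_subtype, Set.mem_ofPred_eq,
    Set.mem_Ioo, bot_lt_iff_ne_bot, lt_top_iff_ne_top]

variable [Finite G] {p n : ℕ}

lemma card_eq_of_isAtom (hp : p.Prime) (hG : Nat.card G = p ^ n) {A : AddSubgroup G}
    (hA : IsAtom A) : Nat.card A = p := by
  have := Fact.mk hp
  obtain ⟨i, -, hi⟩ := (Nat.dvd_prime_pow hp).1 (hG ▸ AddSubgroup.card_addSubgroup_dvd_card A)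
  have h_dvd : p ∣ Nat.card A := by
    obtain _ | i := i
    · exact absurd (AddSubgroup.card_eq_one.1 hi) hA.1
    · exact hi ▸ dvd_pow_self p i.succ_ne_zero
  obtain ⟨g, hg⟩ := exists_prime_addOrderOf_dvd_card' p h_dvd
  rw [← AddSubgroup.addOrderOf_coe] at hg
  have h_eq : AddSubgroup.zmultiples (g : G) = A := by
    refine (hA.le_iff.1 (AddSubgroup.zmultiples_le_of_mem g.2)).resolve_left fun h => ?_
    rw [AddSubgroup.zmultiples_eq_bot.1 h, addOrderOf_zero] at hg
    exact hp.ne_one hg.symm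
  rw [← h_eq, Nat.card_zmultiples, hg]

lemma log_card_sup_le (hp : p.Prime) (hG : Nat.card G = p ^ n) {A : AddSubgroup G} (hA : IsAtom A)
    (H : AddSubgroup G) :
    Nat.log p (Nat.card (H ⊔ A : AddSubgroup G)) ≤ Nat.log p (Nat.card H) + 1 := by
  have h_index : H.relIndex (H ⊔ A) ≤ p := by
    rw [sup_comm, AddSubgroup.relIndex_sup_right, ← card_eq_of_isAtom hp hG hA]
    exact Nat.le_of_dvd Nat.card_pos (H.relIndex_dvd_card A)
  have h_card := AddSubgroup.relIndex_mul_relIndex ⊥ H (H ⊔ A) bot_le le_sup_left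
  rw [AddSubgroup.relIndex_bot_left, AddSubgroup.relIndex_bot_left] at h_card
  rw [← Nat.log_mul_base hp.one_lt Nat.card_pos.ne', ← h_card]
  exact Nat.log_mono_right (Nat.mul_le_mul_left _ h_index)

lemma strictMono_log_card (hp : p.Prime) (hG : Nat.card G = p ^ n) :
    StrictMono fun H : AddSubgroup G => Nat.log p (Nat.card H) := by
  have h_pow (H : AddSubgroup G) : ∃ i, Nat.card H = p ^ i :=
    ((Nat.dvd_prime_pow hp).1 (hG ▸ AddSubgroup.card_addSubgroup_dvd_card H)).imp fun _ h => h.2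
  choose i hi using h_pow
  intro H K h
  have h_card : Nat.card H < Nat.card K := lt_of_not_ge fun h_ge =>
    h.ne (AddSubgroup.eq_of_le_of_card_ge h.le h_ge)
  simp only [hi, Nat.log_pow hp.one_lt] at h_card ⊢
  exact (Nat.pow_lt_pow_iff_right hp.one_lt).1 h_card

lemma isEmpty_simplices_of_lt [Nontrivial G] (hp : p.Prime) (hG : Nat.card G = p ^ n) {j : ℤ}
    (hj : (n : ℤ) - 2 < j) : IsEmpty (Simplices (ProperSubgroups G) j) := by
  refine ⟨fun s => ?_⟩
  have h_top : Nat.log p (Nat.card (⊤ : AddSubgroup G)) = n := by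
    rw [AddSubgroup.card_top, hG, Nat.log_pow hp.one_lt]
  have h_mono := strictMono_log_card hp hG
  have h_card : s.1.card ≤ (Finset.Ioo 0 n).card := by
    refine Finset.card_le_card_of_injOn (fun H => Nat.log p (Nat.card H.1))
      (fun H _ => Finset.mem_coe.2 (Finset.mem_Ioo.2 ⟨?_, ?_⟩)) fun H hH K hK h => ?_
    · exact (Nat.zero_le _).trans_lt (h_mono (bot_lt_iff_ne_bot.2 H.2.1))
    · exact (h_mono (lt_top_iff_ne_top.2 H.2.2)).trans_eq h_top
    · by_contra h_ne
      obtain h_le | h_le := s.2.1.total hH hK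
      · exact (h_mono (lt_of_le_of_ne h_le (Subtype.coe_ne_coe.2 h_ne))).ne h
      · exact (h_mono (lt_of_le_of_ne h_le (Subtype.coe_ne_coe.2 (Ne.symm h_ne)))).ne' h
  have h_pos : 0 < n := ((Nat.zero_le _).trans_lt (h_mono bot_lt_top)).trans_eq h_top
  have h_card_eq := s.2.2
  rw [Nat.card_Ioo] at h_card
  omega

lemma exactAt_Ioo_subgroups [Nontrivial G] (hp : p.Prime) (hG : Nat.card G = p ^ n) {m : ℕ}
    (h : m + 1 < n ∨ ∃ g : G, p • g ≠ 0) : ExactAt (Set.Ioo (⊥ : AddSubgroup G) ⊤) m := by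
  obtain hm | ⟨g, hg⟩ := h
  · refine exactAt_Ioo_of_lt_rank (ρ := fun H => Nat.log p (Nat.card H)) ?_
      (fun A hA H => log_card_sup_le hp hG hA H) ?_
    · rw [AddSubgroup.card_bot, Nat.log_one_right]
    · rwa [AddSubgroup.card_top, hG, Nat.log_pow hp.one_lt]
  · let A : AddSubgroup G := (nsmulAddMonoidHom p).range
    have h_frattini (H : AddSubgroup G) (h_sup : H ⊔ A = ⊤) : H = ⊤ := by
      refine eq_top_of_sup_range_nsmul_eq_top (n := n) (fun g => ?_) h_sup
      rw [← hG]
      exact card_nsmul_eq_zero'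
    have h_bot : A ≠ ⊥ := fun h => hg ((AddSubgroup.eq_bot_iff_forall A).1 h _ ⟨g, rfl⟩)
    have h_top : A ≠ ⊤ := fun h => bot_ne_top (h_frattini ⊥ (by rw [h, sup_top_eq]))
    exact exactAt_Ioo_of_sup_ne h_bot h_top.lt_top fun H hH h_sup => hH.ne (h_frattini H h_sup)

theorem exists_reducedChains_d_eq [Nontrivial G] (hp : p.Prime) (hG : Nat.card G = p ^ n)
    {i j l : ℤ} (hij : j + 1 = i) (hjl : l + 1 = j) (h : (∀ g : G, p • g = 0) → j ≠ n - 2)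
    {z : Simplices (ProperSubgroups G) j →₀ ℤ}
    (hz : ((reducedChains (ProperSubgroups G)).d j l).hom z = 0) :
    ∃ y : Simplices (ProperSubgroups G) i →₀ ℤ,
      ((reducedChains (ProperSubgroups G)).d i j).hom y = z := by
  by_cases h_empty : j < -1 ∨ n - 2 < j
  · have : IsEmpty (Simplices (ProperSubgroups G) j) :=
      h_empty.elim Simplices.isEmpty_of_lt (isEmpty_simplices_of_lt hp hG)
    exact ⟨0, Subsingleton.elim (α := Simplices (ProperSubgroups G) j →₀ ℤ) _ _⟩
  obtain ⟨m, hm⟩ := Int.eq_ofNat_of_zero_le (a := j + 1) (by omega)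
  have h_exact : ExactAt (Set.Ioo (⊥ : AddSubgroup G) ⊤) m := by
    refine exactAt_Ioo_subgroups hp hG (or_iff_not_imp_right.2 fun h_tors => ?_)
    have := h fun g => not_not.1 fun hg => h_tors ⟨g, hg⟩
    omega
  rw [← range_subtype_properSubgroups] at h_exact
  exact h_exact.exists_reducedChains_d_eq hm hij hjl hz

end PGroups

/-! ## Homology of complexes of modules -/

section Homology

variable {R : Type w} [Ring R] {I : Type*} {c : ComplexShape I}
  (C : HomologicalComplex (ModuleCat.{v} R) c) {i j l : I}

lemma isZero_homology_iff (hi : c.prev j = i) (hl : c.next j = l) :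
    Limits.IsZero (C.homology j) ↔ Function.Exact (C.d i j).hom (C.d j l).hom := by
  rw [← HomologicalComplex.exactAt_iff_isZero_homology,
    HomologicalComplex.exactAt_iff' C i j l hi hl,
    ShortComplex.ShortExact.moduleCat_exact_iff_function_exact]
  rfl

lemma isZero_homology_of_subsingleton [Subsingleton (C.X j)] : Limits.IsZero (C.homology j) :=
  (isZero_homology_iff C rfl rfl).2 fun x =>
    ⟨fun _ => ⟨0, Subsingleton.elim _ _⟩, fun _ => by rw [Subsingleton.elim x 0, map_zero]⟩

lemma nonempty_homology_equiv (hi : c.prev j = i) (hl : c.next j = l) [Subsingleton (C.X l)]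
    {T : Type*} [AddCommGroup T] [Module R T] {f : C.X j →ₗ[R] T} (hf : Function.Surjective f)
    (h_exact : Function.Exact (C.d i j).hom f) : Nonempty (C.homology j ≃ₗ[R] T) := by
  have h_zero : C.d j l = 0 := by
    ext x
    exact Subsingleton.elim _ _
  have := C.isIso_homologyι j l hl h_zero
  have h_surj : Function.Surjective (C.pOpcycles j).hom :=
    (ModuleCat.epi_iff_surjective _).1 inferInstance
  have h_opcycles := (ShortComplex.ShortExact.moduleCat_exact_iff_function_exact _).1
    (ShortComplex.exact_of_g_is_cokernel (ShortComplex.mk _ _ (C.d_pOpcycles i j))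
      (C.opcyclesIsCokernel i j hi))
  exact ⟨(asIso (C.homologyι j)).toLinearEquiv.trans <|
    (h_opcycles.linearEquivOfSurjective h_surj).symm.trans (h_exact.linearEquivOfSurjective hf)⟩

lemma exists_injective_homology (hi : c.prev j = i) [Subsingleton (C.X i)] :
    ∃ f : C.homology j →ₗ[R] C.X j, Function.Injective f := by
  have h_zero : C.d i j = 0 := by
    ext x
    rw [Subsingleton.elim x 0, map_zero, map_zero]
  have := C.isIso_homologyπ i j hi h_zero
  exact ⟨(inv (C.homologyπ j) ≫ C.iCycles j).hom,
    (ModuleCat.mono_iff_injective _).1 inferInstance⟩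

lemma finite_homology [IsNoetherianRing R] [Module.Finite R (C.X j)] :
    Module.Finite R (C.homology j) := by
  have : Module.Finite R (C.cycles j) :=
    .of_injective (C.iCycles j).hom ((ModuleCat.mono_iff_injective _).1 inferInstance)
  exact .of_surjective (C.homologyπ j).hom ((ModuleCat.epi_iff_surjective _).1 inferInstance)

lemma isZero_homology_of_equiv_pi {α : Type*} {D : α → HomologicalComplex (ModuleCat.{u} R) c}
    (e : ∀ q, C.X q ≃ₗ[R] ∀ a, (D a).X q)
    (he : ∀ i j, c.Rel i j → ∀ (x : C.X i) a, e j (C.d i j x) a = (D a).d i j (e i x a))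
    (h : ∀ a, Limits.IsZero ((D a).homology j)) : Limits.IsZero (C.homology j) := by
  have he' (i j) (x : C.X i) (a) : e j (C.d i j x) a = (D a).d i j (e i x a) := by
    by_cases hij : c.Rel i j
    · exact he i j hij x a
    · rw [C.shape i j hij, (D a).shape i j hij]
      simp
  rw [isZero_homology_iff C rfl rfl]
  refine fun x => ⟨fun hx => ?_, ?_⟩
  · have h_range (a) : e j x a ∈ Set.range ((D a).d (c.prev j) j).hom :=
      ((isZero_homology_iff (D a) rfl rfl).1 (h a) _).1 (by
        refine (he' _ _ x a).symm.trans ?_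
        rw [hx, map_zero]
        rfl)
    choose y hy using h_range
    refine ⟨(e _).symm y, (e j).injective (funext fun a => ?_)⟩
    rw [he', LinearEquiv.apply_symm_apply]
    exact hy a
  · rintro ⟨y, rfl⟩
    exact congrArg (fun g => g.hom y) (C.d_comp_d (c.prev j) j (c.next j))

end Homology

section Dual

variable {R : Type*} [CommRing R] {A B C D : Type*} [AddCommGroup A] [AddCommGroup B]
  [AddCommGroup C] [AddCommGroup D] [Module R A] [Module R B] [Module R C] [Module R D]
  {f : A →ₗ[R] B} {g : B →ₗ[R] C} {h : C →ₗ[R] D}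

lemma exists_retraction_ker (g : B →ₗ[R] C) [Module.Projective R (LinearMap.range g)] :
    ∃ π : B →ₗ[R] LinearMap.ker g, π ∘ₗ (LinearMap.ker g).subtype = LinearMap.id := by
  have h_exact : Function.Exact (LinearMap.ker g).subtype g.rangeRestrict := by
    rw [LinearMap.exact_iff, LinearMap.ker_rangeRestrict, Submodule.range_subtype]
  obtain ⟨σ, hσ⟩ := Module.projective_lifting_property g.rangeRestrict LinearMap.id
    g.surjective_rangeRestrict
  have h_split := h_exact.split_tfae'.out 0 1
  exact (h_split.1 ⟨Submodule.subtype_injective _, σ, hσ⟩).2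

lemma exact_lcomp [Module.Projective R (LinearMap.range h)] (M : Type*) [AddCommGroup M]
    [Module R M] (hfg : Function.Exact f g) (hgh : Function.Exact g h) :
    Function.Exact (LinearMap.lcomp R M g) (LinearMap.lcomp R M f) := by
  obtain ⟨π, hπ⟩ := exists_retraction_ker h
  let g' : B →ₗ[R] LinearMap.ker h := g.codRestrict _ hgh.apply_apply_eq_zero
  have hg' : Function.Surjective g' := fun ⟨x, hx⟩ =>
    ((hgh x).1 hx).imp fun _ hy => Subtype.ext hy
  have hfg' : Function.Exact f g' := fun x => Subtype.ext_iff.trans (hfg x)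
  refine fun φ => ⟨fun hφ => ?_, ?_⟩
  · obtain ⟨ψ, rfl⟩ := (LinearMap.exact_lcomp_of_exact_of_surjective M hfg' hg' φ).1 hφ
    exact ⟨ψ ∘ₗ π, LinearMap.ext fun x => congrArg ψ (LinearMap.congr_fun hπ (g' x))⟩
  · rintro ⟨ψ, rfl⟩
    refine LinearMap.ext fun x => ?_
    rw [LinearMap.lcomp_apply, LinearMap.lcomp_apply, hfg.apply_apply_eq_zero, map_zero]
    rfl

end Dual

/-! ## Homology of the complexes of a finite abelian `p`-group -/

section GroupHomology

variable {G : Type u} [AddCommGroup G] [Finite G] {p n : ℕ}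

instance (q : ℤ) : Finite (Simplices (ProperSubgroups G) q) :=
  Subtype.finite

instance (q : ℤ) : Module.Finite ℤ ((reducedChains (ProperSubgroups G)).X q) :=
  inferInstanceAs (Module.Finite ℤ (Simplices (ProperSubgroups G) q →₀ ℤ))

instance (q : ℤ) : Module.Free ℤ ((reducedChains (ProperSubgroups G)).X q) :=
  inferInstanceAs (Module.Free ℤ (Simplices (ProperSubgroups G) q →₀ ℤ))

omit [AddCommGroup G] in
lemma nontrivial_iff_ne_zero (hp : p.Prime) (hG : Nat.card G = p ^ n) :
    Nontrivial G ↔ n ≠ 0 := by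
  rw [← Finite.one_lt_card_iff_nontrivial, hG]
  exact ⟨fun h h_zero => by simp [h_zero] at h, fun h => Nat.one_lt_pow h hp.one_lt⟩

section Nontrivial

variable [Nontrivial G] (hp : p.Prime) (hG : Nat.card G = p ^ n)
include hp hG

lemma exact_reducedChains_d {i j l : ℤ} (hij : j + 1 = i) (hjl : l + 1 = j)
    (h : (∀ g : G, p • g = 0) → j ≠ n - 2) :
    Function.Exact ((reducedChains (ProperSubgroups G)).d i j).hom
      ((reducedChains (ProperSubgroups G)).d j l).hom :=
  fun _ => ⟨exists_reducedChains_d_eq hp hG hij hjl h, fun ⟨y, hy⟩ => hy ▸ reducedChains_d_d y⟩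

theorem isZero_reducedChains_homology {q : ℤ} (h : (∀ g : G, p • g = 0) → q ≠ n - 2) :
    Limits.IsZero ((reducedChains (ProperSubgroups G)).homology q) :=
  (isZero_homology_iff _ (ChainComplex.prev ℤ q) (ChainComplex.next ℤ q)).2
    (exact_reducedChains_d hp hG rfl (sub_add_cancel q 1) h)

lemma subsingleton_reducedChains_X {q : ℤ} (hq : (n : ℤ) - 2 < q) :
    Subsingleton ((reducedChains (ProperSubgroups G)).X q) :=
  have := isEmpty_simplices_of_lt hp hG hq
  inferInstanceAs (Subsingleton (Simplices (ProperSubgroups G) q →₀ ℤ))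

theorem free_reducedChains_homology :
    Module.Free ℤ ((reducedChains (ProperSubgroups G)).homology ((n : ℤ) - 2)) := by
  have := subsingleton_reducedChains_X (q := (n : ℤ) - 2 + 1) hp hG (by omega)
  obtain ⟨f, hf⟩ := exists_injective_homology (reducedChains (ProperSubgroups G))
    (ChainComplex.prev ℤ ((n : ℤ) - 2))
  exact .of_equiv (LinearEquiv.ofInjective f hf).symm

variable (R : Type w) [CommRing R] (M : Type v) [AddCommGroup M] [Module R M]

lemma isZero_homComplex_homology {q : ℕ} (h : (∀ g : G, p • g = 0) → q ≠ n) :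
    Limits.IsZero ((homComplex R G M).homology q) := by
  by_cases h_sub : Subsingleton ((reducedChains (ProperSubgroups G)).X ((q : ℤ) - 2))
  · have : Subsingleton ((homComplex R G M).X q) := inferInstanceAs
      (Subsingleton ((reducedChains (ProperSubgroups G)).X ((q : ℤ) - 2) →ₗ[ℤ] M))
    exact isZero_homology_of_subsingleton _
  obtain _ | q := q
  · have := Simplices.isEmpty_of_lt (P := ProperSubgroups G) (q := ((0 : ℕ) : ℤ) - 2) (by simp)
    exact absurd (inferInstanceAs (Subsingleton (Simplices (ProperSubgroups G) _ →₀ ℤ))) h_sub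
  have hq : q + 1 ≤ n := by
    contrapose! h_sub
    exact subsingleton_reducedChains_X hp hG (by omega)
  have h_exact := exact_lcomp M
    (exact_reducedChains_d hp hG (i := ((q + 1 + 1 : ℕ) : ℤ) - 2) (j := ((q + 1 : ℕ) : ℤ) - 2)
      (l := (q : ℤ) - 2) (by push_cast; ring) (by push_cast; ring) fun h_tors => by
        have := h h_tors
        omega)
    (exact_reducedChains_d hp hG (l := (q : ℤ) - 3) (by push_cast; ring) (by ring) fun _ => by
      omega)
  refine (isZero_homology_iff _ (CochainComplex.prev_nat_succ q)
    (CochainComplex.next ℕ (q + 1))).2 fun φ => ?_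
  exact (Eq.congr_left (homComplex_d_apply R G M (q + 1) φ)).trans <| (h_exact φ).trans <|
    exists_congr fun ψ => Eq.congr_left (homComplex_d_apply R G M q ψ).symm

lemma free_homComplex_homology [Module.Free R M] :
    Module.Free R ((homComplex R G M).homology n) := by
  obtain _ | n := n
  · exact absurd rfl ((nontrivial_iff_ne_zero hp hG).1 ‹_›)
  let d := ((reducedChains (ProperSubgroups G)).d (((n + 1 : ℕ) : ℤ) - 2) ((n : ℤ) - 2)).hom
  have : Subsingleton ((reducedChains (ProperSubgroups G)).X (((n + 1 + 1 : ℕ) : ℤ) - 2)) :=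
    subsingleton_reducedChains_X hp hG (by push_cast; omega)
  have : Subsingleton ((homComplex R G M).X (n + 1 + 1)) := inferInstanceAs
    (Subsingleton ((reducedChains (ProperSubgroups G)).X (((n + 1 + 1 : ℕ) : ℤ) - 2) →ₗ[ℤ] M))
  let restrict := LinearMap.lcomp R M (LinearMap.ker d).subtype
  have h_surj : Function.Surjective restrict := by
    obtain ⟨π, hπ⟩ := exists_retraction_ker d
    exact fun φ => ⟨φ ∘ₗ π, LinearMap.ext fun x => congrArg φ (LinearMap.congr_fun hπ x)⟩
  have h_exact := exact_lcomp M d.exact_subtype_ker_map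
    (exact_reducedChains_d hp hG (l := (n : ℤ) - 3) (by push_cast; ring) (by ring) fun _ => by
      push_cast
      omega)
  obtain ⟨e⟩ := nonempty_homology_equiv (homComplex R G M) (CochainComplex.prev_nat_succ n)
    (CochainComplex.next ℕ (n + 1)) h_surj fun φ =>
      (h_exact φ).trans <| exists_congr fun ψ => Eq.congr_left (homComplex_d_apply R G M n ψ).symm
  exact .of_equiv e.symm

end Nontrivial

section

variable (R : Type w) [CommRing R] (M : Type v) [AddCommGroup M] [Module R M]
  (hp : p.Prime) (hG : Nat.card G = p ^ n)
include hp hG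

theorem isZero_complexD_homology {q : ℕ} (h : (∀ g : G, p • g = 0) → q ≠ n) :
    Limits.IsZero ((complexD R G M).homology q) := by
  obtain h_sub | h_nontrivial := subsingleton_or_nontrivial G
  · obtain rfl : n = 0 := not_not.1
      ((nontrivial_iff_ne_zero hp hG).not.1 (not_nontrivial_iff_subsingleton.2 h_sub))
    rw [complexD_eq_single]
    exact HomologicalComplex.isZero_single_obj_homology _ _ _ _
      (h fun g => Subsingleton.elim _ _)
  · rw [complexD_eq_homComplex]
    exact isZero_homComplex_homology hp hG R M h

theorem free_complexD_homology [Module.Free R M] :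
    Module.Free R ((complexD R G M).homology n) := by
  obtain h_sub | h_nontrivial := subsingleton_or_nontrivial G
  · obtain rfl : n = 0 := not_not.1
      ((nontrivial_iff_ne_zero hp hG).not.1 (not_nontrivial_iff_subsingleton.2 h_sub))
    rw [complexD_eq_single]
    exact .of_equiv (ULift.moduleEquiv.symm.trans (HomologicalComplex.singleObjHomologySelfIso
      (ComplexShape.up ℕ) 0 (ModuleCat.of R (ULift.{u} M))).symm.toLinearEquiv)
  · rw [complexD_eq_homComplex]
    exact free_homComplex_homology hp hG R M

end

lemma exists_equiv_of_nsmul_eq_zero (hp : p.Prime) (h : ∀ g : G, p • g = 0) :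
    ∃ r : ℕ, Nonempty (G ≃+ (Fin r → ZMod p)) := by
  have := Fact.mk hp
  let _ : Module (ZMod p) G := AddCommGroup.zmodModule (n := p) h
  exact ⟨_, ⟨(Module.finBasis (ZMod p) G).equivFun.toAddEquiv⟩⟩

omit [Finite G] in
lemma card_of_equiv (e : G ≃+ (Fin n → ZMod p)) : Nat.card G = p ^ n := by
  rw [Nat.card_congr e.toEquiv, Nat.card_fun, Nat.card_zmod, Nat.card_fin]

end GroupHomology

section Trivial

variable (R : Type w) [CommRing R] (G : Type u) [AddCommGroup G] [Subsingleton G]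
  (M : Type v) [AddCommGroup M] [Module R M]

/-- The complex of a trivial group is the coefficient module in degree `0`. -/
def complexDZeroEquiv : (complexD R G M).X 0 ≃ₗ[R] M :=
  ((HomologicalComplex.eval _ _ 0).mapIso (eqToIso (complexD_eq_single R G M)) ≪≫
    HomologicalComplex.singleObjXSelf (ComplexShape.up ℕ) 0
      (ModuleCat.of R (ULift.{u} M))).toLinearEquiv.trans ULift.moduleEquiv

lemma subsingleton_complexD_X_succ (q : ℕ) : Subsingleton ((complexD R G M).X (q + 1)) := by
  rw [complexD_eq_single]
  exact ModuleCat.subsingleton_of_isZero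
    (HomologicalComplex.isZero_single_obj_X (ComplexShape.up ℕ) 0 _ (q + 1) q.succ_ne_zero)

end Trivial

section MainComparison

variable {k : Type u} [Field k] {E : EllipticCurve k} {N q : ℕ}

lemma Factorizations.finite (q : ℕ) (hN : N ≠ 0) : Finite (Factorizations q N) :=
  .of_injective (fun (n : Factorizations q N) (i : Fin q) =>
    (⟨n.1 i, Nat.lt_succ_of_le (Nat.le_of_dvd (Nat.pos_of_ne_zero hN)
      ((Finset.dvd_prod_of_mem n.1 (Finset.mem_univ i)).trans n.2.2.dvd))⟩ : Fin (N + 1)))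
    fun _ _ h => Subtype.ext (funext fun i => congrArg Fin.val (congrFun h i))

lemma Factorizations.isEmpty_succ_one (q : ℕ) : IsEmpty (Factorizations (q + 1) 1) :=
  ⟨fun n => (n.2.1 0).ne' (Nat.dvd_one.1
    ((Finset.dvd_prod_of_mem n.1 (Finset.mem_univ 0)).trans n.2.2.dvd))⟩

instance (X : Type u) [AddCommGroup X] :
    Unique (Σ n : Factorizations 0 1, AddSubgroupChain X n.1) where
  default := ⟨⟨Fin.elim0, fun i => i.elim0, Fin.prod_univ_zero _⟩,
    ⟨Fin.elim0, fun i => i.elim0, fun i => i.elim0⟩⟩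
  uniq := fun ⟨n, c⟩ => by
    obtain rfl : n = ⟨Fin.elim0, fun i => i.elim0, Fin.prod_univ_zero _⟩ :=
      Subtype.ext (Subsingleton.elim _ _)
    exact congrArg _ (AddSubgroupChain.ext (Subsingleton.elim _ _))

lemma isogenyComplex_d_apply (x : IsogenyCochains E N q) :
    ((isogenyComplex E N).d q (q + 1)).hom x = coboundary E N q x :=
  congrArg (fun g => g.hom x) (CochainComplex.of_d
    (fun q : ℕ => ModuleCat.of k (IsogenyCochains E N q)) _ q)

variable (E N) in
/-- The isogeny complex of degree `N` is isomorphic to the product of the complexes of the subgroups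
of order `N` of `E(k)`. -/
def IsProductOfComplexD : Prop :=
  ∃ e : ∀ q : ℕ, (isogenyComplex E N).X q ≃ₗ[k]
      (∀ G : {G : AddSubgroup (E.Points k) // Nat.card G = N}, (complexD k G.1 k).X q),
    ∀ (q : ℕ) (x : (isogenyComplex E N).X q)
      (G : {G : AddSubgroup (E.Points k) // Nat.card G = N}),
      e (q + 1) ((isogenyComplex E N).d q (q + 1) x) G =
        (complexD k G.1 k).d q (q + 1) (e q x G)

section Torsion

variable {J : Type u} [Finite J] {t : E.Points (J → k)}

lemma isProductOfComplexD_of_one_lt (ht : IsUniversalTorsion N t) (hN : 1 < N) :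
    IsProductOfComplexD E N := by
  have h_nontrivial (G : {G : AddSubgroup (E.Points k) // Nat.card G = N}) : Nontrivial G.1 :=
    (AddSubgroup.nontrivial_iff_ne_bot _).2 fun h =>
      hN.ne (by rw [← G.2, h, AddSubgroup.card_bot])
  let i (G : {G : AddSubgroup (E.Points k) // Nat.card G = N}) :
      homComplex k G.1 k ≅ complexD k G.1 k :=
    eqToIso (complexD_eq_homComplex k G.1 k).symm
  refine ⟨fun q => (comparisonEquiv ht hN q).trans (LinearEquiv.piCongrRight fun G =>
    ((HomologicalComplex.eval _ _ q).mapIso (i G)).toLinearEquiv), fun q x G => ?_⟩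
  have h_comm : comparisonEquiv ht hN (q + 1) (((isogenyComplex E N).d q (q + 1)).hom x) G =
      ((homComplex k G.1 k).d q (q + 1)).hom (comparisonEquiv ht hN q x G) :=
    (congrFun (congrArg (comparisonEquiv ht hN (q + 1)) (isogenyComplex_d_apply x)) G).trans <|
      (comparisonEquiv_coboundary ht hN x G).trans (homComplex_d_apply k G.1 k q _).symm
  exact (congrArg ((i G).hom.f (q + 1)).hom h_comm).trans
    (congrArg (fun g => g.hom (comparisonEquiv ht hN q x G)) ((i G).hom.comm q (q + 1)).symm)

lemma isProductOfComplexD_one (ht : IsUniversalTorsion 1 t) : IsProductOfComplexD E 1 := by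
  have (G : {G : AddSubgroup (E.Points k) // Nat.card G = 1}) : Subsingleton G.1 :=
    (Nat.card_eq_one_iff_unique.1 G.2).1
  have : Unique {G : AddSubgroup (E.Points k) // Nat.card G = 1} :=
    ⟨⟨⟨⊥, AddSubgroup.card_bot⟩⟩, fun G => Subtype.ext (AddSubgroup.card_eq_one.1 G.2)⟩
  have (q : ℕ) : Subsingleton ((isogenyComplex E 1).X (q + 1)) :=
    have := Factorizations.isEmpty_succ_one q
    inferInstanceAs (Subsingleton (IsogenyCochains E 1 (q + 1)))
  have (q : ℕ) (G : {G : AddSubgroup (E.Points k) // Nat.card G = 1}) :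
      Subsingleton ((complexD k G.1 k).X (q + 1)) :=
    subsingleton_complexD_X_succ k G.1 k q
  let e₀ : (isogenyComplex E 1).X 0 ≃ₗ[k]
      (∀ G : {G : AddSubgroup (E.Points k) // Nat.card G = 1}, (complexD k G.1 k).X 0) :=
    (cochainEquiv ht 0).trans <| (LinearEquiv.funUnique _ k k).trans <|
      (LinearEquiv.funUnique {G : AddSubgroup (E.Points k) // Nat.card G = 1} k k).symm.trans <|
      LinearEquiv.piCongrRight fun G => (complexDZeroEquiv k G.1 k).symm
  exact ⟨fun | 0 => e₀ | _ + 1 => 0, fun _ _ _ => Subsingleton.elim _ _⟩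

end Torsion

variable [IsSepClosed k] (E)

theorem isProductOfComplexD (hN : (N : k) ≠ 0) : IsProductOfComplexD E N := by
  obtain ⟨J, _, t, ht⟩ := E.exists_isUniversalTorsion hN
  obtain rfl | h_one := eq_or_ne N 1
  · exact isProductOfComplexD_one ht
  · have h_zero : N ≠ 0 := fun h => hN (by rw [h, Nat.cast_zero])
    exact isProductOfComplexD_of_one_lt ht (by omega)

theorem finite_isogenyComplex_homology (hN : (N : k) ≠ 0) (q : ℕ) :
    Module.Finite k ((isogenyComplex E N).homology q) := by
  obtain ⟨J, _, t, ht⟩ := E.exists_isUniversalTorsion hN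
  have := Factorizations.finite q fun h : N = 0 => hN (by rw [h, Nat.cast_zero])
  have (n : Factorizations q N) : Finite (AddSubgroupChain (E.Points k) n.1) :=
    AddSubgroupChain.finite ht fun i => n.partialProd_dvd i.succ
  have : Module.Finite k ((isogenyComplex E N).X q) := .equiv (cochainEquiv ht q).symm
  exact finite_homology _

theorem isZero_isogenyComplex_homology {p r : ℕ} (hp : p.Prime) (hN : ((p ^ r : ℕ) : k) ≠ 0)
    {j : ℕ} (hj : j ≠ r) : Limits.IsZero ((isogenyComplex E (p ^ r)).homology j) := by
  obtain ⟨e, he⟩ := isProductOfComplexD E hN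
  refine isZero_homology_of_equiv_pi _ e (fun i _ h x G => ?_) fun G => ?_
  · obtain rfl : i + 1 = _ := h
    exact he i x G
  · have : Finite G.1 :=
      Nat.finite_of_card_ne_zero (by rw [G.2]; exact pow_ne_zero r hp.ne_zero)
    exact isZero_complexD_homology k k hp G.2 fun _ => hj

end MainComparison

end IsogenyComplex

end

open IsogenyComplex in
theorem mainTheorem4_general (p : ℕ) (hp : p.Prime) :
    (∀ (G : Type u) [AddCommGroup G] [Finite G], (∃ n : ℕ, Nat.card G = p ^ n) →
      ((∃ g : G, p • g ≠ 0) →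
        (∀ q : ℤ, Limits.IsZero
          ((IsogenyComplex.reducedChains (IsogenyComplex.ProperSubgroups G)).homology q)) ∧
        (∀ (R : Type w) [CommRing R] (M : Type v) [AddCommGroup M] [Module R M] (q : ℕ),
          Limits.IsZero ((IsogenyComplex.complexD R G M).homology q))) ∧
      ((∀ g : G, p • g = 0) →
        (∃ r : ℕ, Nonempty (G ≃+ (Fin r → ZMod p))) ∧
        ∀ r : ℕ, Nonempty (G ≃+ (Fin r → ZMod p)) →
          (Nontrivial G →
            (∀ q : ℤ, q ≠ (r : ℤ) - 2 → Limits.IsZero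
              ((IsogenyComplex.reducedChains (IsogenyComplex.ProperSubgroups G)).homology q)) ∧
            Module.Free ℤ ((IsogenyComplex.reducedChains
              (IsogenyComplex.ProperSubgroups G)).homology ((r : ℤ) - 2))) ∧
          (∀ (R : Type w) [CommRing R] (M : Type v) [AddCommGroup M] [Module R M],
            (∀ q : ℕ, q ≠ r → Limits.IsZero ((IsogenyComplex.complexD R G M).homology q)) ∧
            (Module.Free R M → Module.Free R ((IsogenyComplex.complexD R G M).homology r))))) ∧
    (∀ (k : Type u) [Field k] [IsSepClosed k], (p : k) ≠ 0 →
      ∀ (E : IsogenyComplex.EllipticCurve k) (r : ℕ),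
        (∃ e : ∀ q : ℕ, (IsogenyComplex.isogenyComplex E (p ^ r)).X q ≃ₗ[k]
            (∀ G : {G : AddSubgroup (E.Points k) // Nat.card G = p ^ r},
              (IsogenyComplex.complexD k G.1 k).X q),
          ∀ (q : ℕ) (x : (IsogenyComplex.isogenyComplex E (p ^ r)).X q)
            (G : {G : AddSubgroup (E.Points k) // Nat.card G = p ^ r}),
            e (q + 1) ((IsogenyComplex.isogenyComplex E (p ^ r)).d q (q + 1) x) G =
              (IsogenyComplex.complexD k G.1 k).d q (q + 1) (e q x G)) ∧
        (∀ j : ℕ, j ≠ r →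
          Limits.IsZero ((IsogenyComplex.isogenyComplex E (p ^ r)).homology j)) ∧
        Module.Finite k ((IsogenyComplex.isogenyComplex E (p ^ r)).homology r) ∧
        Module.Projective k ((IsogenyComplex.isogenyComplex E (p ^ r)).homology r)) := by
  refine ⟨fun G _ _ ⟨n, hG⟩ => ⟨fun ⟨g, hg⟩ => ?_, fun h => ⟨exists_equiv_of_nsmul_eq_zero hp h,
    fun r ⟨e⟩ => ?_⟩⟩, fun k _ _ hpk E r => ?_⟩
  · have : Nontrivial G := ⟨g, 0, fun h => hg (by rw [h, smul_zero])⟩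
    exact ⟨fun q => isZero_reducedChains_homology hp hG fun h => absurd (h g) hg,
      fun R _ M _ _ q => isZero_complexD_homology R M hp hG fun h => absurd (h g) hg⟩
  · have hGr := card_of_equiv e
    exact ⟨fun _ => ⟨fun q hq => isZero_reducedChains_homology hp hGr fun _ => hq,
        free_reducedChains_homology hp hGr⟩,
      fun R _ M _ _ => ⟨fun q hq => isZero_complexD_homology R M hp hGr fun _ => hq,
        fun _ => free_complexD_homology R M hp hGr⟩⟩
  · have hk : ((p ^ r : ℕ) : k) ≠ 0 := by
      rw [Nat.cast_pow]
      exact pow_ne_zero r hpk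
    exact ⟨isProductOfComplexD E hk, fun j => isZero_isogenyComplex_homology E hp hk,
      finite_isogenyComplex_homology E hk r, inferInstance⟩

theorem mainTheorem4 (p : ℕ) (hp : p.Prime) :
    (∀ (G : Type u) [AddCommGroup G] [Finite G], (∃ n : ℕ, Nat.card G = p ^ n) →
      ((∃ g : G, p • g ≠ 0) →
        (∀ q : ℤ, Limits.IsZero
          ((IsogenyComplex.reducedChains (IsogenyComplex.ProperSubgroups G)).homology q)) ∧
        (∀ (R : Type w) [CommRing R] (M : Type v) [AddCommGroup M] [Module R M] (q : ℕ),
          Limits.IsZero ((IsogenyComplex.complexD R G M).homology q))) ∧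
      ((∀ g : G, p • g = 0) →
        (∃ r : ℕ, Nonempty (G ≃+ (Fin r → ZMod p))) ∧
        ∀ r : ℕ, Nonempty (G ≃+ (Fin r → ZMod p)) →
          (Nontrivial G →
            (∀ q : ℤ, q ≠ (r : ℤ) - 2 → Limits.IsZero
              ((IsogenyComplex.reducedChains (IsogenyComplex.ProperSubgroups G)).homology q)) ∧
            Module.Free ℤ ((IsogenyComplex.reducedChains
              (IsogenyComplex.ProperSubgroups G)).homology ((r : ℤ) - 2))) ∧
          (∀ (R : Type w) [CommRing R] (M : Type v) [AddCommGroup M] [Module R M],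
            (∀ q : ℕ, q ≠ r → Limits.IsZero ((IsogenyComplex.complexD R G M).homology q)) ∧
            (Module.Free R M → Module.Free R ((IsogenyComplex.complexD R G M).homology r))))) ∧
    (∀ (k : Type u) [Field k] [IsAlgClosed k], (p : k) ≠ 0 →
      ∀ (E : IsogenyComplex.EllipticCurve k) (r : ℕ),
        (∃ e : ∀ q : ℕ, (IsogenyComplex.isogenyComplex E (p ^ r)).X q ≃ₗ[k]
            (∀ G : {G : AddSubgroup (E.Points k) // Nat.card G = p ^ r},
              (IsogenyComplex.complexD k G.1 k).X q),
          ∀ (q : ℕ) (x : (IsogenyComplex.isogenyComplex E (p ^ r)).X q)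
            (G : {G : AddSubgroup (E.Points k) // Nat.card G = p ^ r}),
            e (q + 1) ((IsogenyComplex.isogenyComplex E (p ^ r)).d q (q + 1) x) G =
              (IsogenyComplex.complexD k G.1 k).d q (q + 1) (e q x G)) ∧
        (∀ j : ℕ, j ≠ r →
          Limits.IsZero ((IsogenyComplex.isogenyComplex E (p ^ r)).homology j)) ∧
        Module.Finite k ((IsogenyComplex.isogenyComplex E (p ^ r)).homology r) ∧
        Module.Projective k ((IsogenyComplex.isogenyComplex E (p ^ r)).homology r)) := by
  have h := mainTheorem4_general.{u, v, w} p hp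
  exact ⟨h.1, fun k _ _ => h.2 k⟩
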